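/- **Setting.** Let $V$ be a complex Hausdorff locally convex space that is *hilbertisable*: writing $\mathcal I_V$ for the set of continuous positive semi-definite Hermitian forms $\langle\cdot,\cdot\rangle_\alpha$ on $V$ (antilinear in the first, linear in the second argument) and $\|v\|_\alpha=\sqrt{\langle v,v\rangle_\alpha}$, every continuous seminorm on $V$ is dominated by some $\|\cdot\|_\alpha$. Let $v\mapsto\bar v$ be a continuous antilinear involution on $V$. *The algebra.* On the tensor algebra $\mathcal T^\bullet(V)=\bigoplus_{k\ge 0}V^{\otimes k}$ every $\alpha\in\mathcal I_V$ induces a positive Hermitian form, for which tensors of different degree are orthogonal and $\langle x_1\otimes\dots\otimes x_k,\,y_1\otimes\dots\otimes y_k\rangle^\bullet_\alpha=k!\prod_{m=1}^k\langle x_m,y_m\rangle_\alpha$. Give $\mathcal T^\bullet(V)$ the locally convex topology defined by all the seminorms $\|X\|_\alpha^\bullet=\sqrt{\langle X,X\rangle_\alpha^\bullet}$. Let $\mathscr S$ be the symmetrisation operator, $\mathscr S(x_1\otimes\dots\otimes x_k)=\frac1{k!}\sum_{\sigma\in\mathfrak S_k}x_{\sigma(1)}\otimes\dots\otimes x_{\sigma(k)}$,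 and let $\mathcal S^\bullet(V)=\mathscr S(\mathcal T^\bullet(V))$ carry the subspace topology, the commutative product $X\vee Y=\mathscr S(X\otimes Y)$ and the $*$-involution given by $(x_1\otimes\dots\otimes x_k)^*=\bar x_k\otimes\dots\otimes\bar x_1$. The product and the involution are continuous and extend to the completion $\mathcal S^\bullet(V)^{\mathrm{cpl}}$. *Evaluation.* Let $V'_h$ be the real vector space of all continuous linear functionals $\rho\colon V\to\mathbb C$ with $\overline{\rho(v)}=\rho(\bar v)$ for all $v\in V$. For $\rho\in V'_h$ let $D_\rho(x_1\otimes\dots\otimes x_k)=k\,\rho(x_k)\,x_1\otimes\dots\otimes x_{k-1}$ (and $D_\rho=0$ on scalars), $\tau^*_\rho=\sum_{t\ge 0}\frac1{t!}D_\rho^t$, and $\delta_\rho(X)=\langle\tau^*_\rho X\rangle_0$, the degree $0$ part. The restriction of $\delta_\rho$ to $\mathcal S^\bullet(V)$ is continuous and extends to $\mathcal S^\bullet(V)^{\mathrm{cpl}}$. The Gel'fand transform of $X\in\mathcal S^\bullet(V)^{\mathrm{cpl}}$ is the function $\widehat X\colon V'_h\to\mathbb C$, $\widehat X(\rho)=\delta_\rho(X)$.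 *Functions.* Let $\mathcal I_{V,h}$ be the set of all $\alpha\in\mathcal I_V$ with $\overline{\langle v,w\rangle_\alpha}=\langle\bar v,\bar w\rangle_\alpha$ for all $v,w\in V$. A set $B\subseteq V'_h$ is *bounded* if there is an $\alpha\in\mathcal I_{V,h}$ with $|\rho(v)|\le\|v\|_\alpha$ for all $\rho\in B$, $v\in V$; a multilinear form is bounded if it maps bounded sets to bounded sets. For $f\colon V'_h\to\mathbb C$ put $(\widehat D_\rho f)(\sigma)=\frac{d}{dt}\big|_{t=0}f(\sigma+t\rho)$ and $\widehat D^{(k)}_{(\rho_1,\dots,\rho_k)}f=\widehat D_{\rho_1}\cdots\widehat D_{\rho_k}f$. The function $f$ is *smooth* if all these iterated directional derivatives exist everywhere and, for all $k\ge 0$ and all $\sigma\in V'_h$, $(\rho_1,\dots,\rho_k)\mapsto(\widehat D^{(k)}_{(\rho_1,\dots,\rho_k)}f)(\sigma)$ is a bounded symmetric real-multilinear form. For $\alpha\in\mathcal I_{V,h}$ let $V_{h,\alpha}^{\mathrm{cpl}}$ be the real Hilbert space obtained from $V_h=\{v\in V:\bar v=v\}$ with $\langle\cdot,\cdot\rangle_\alpha$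 by dividing out the vectors of seminorm $0$ and completing; for $v\in V_{h,\alpha}^{\mathrm{cpl}}$ let $v^{\flat_\alpha}=\langle v,\cdot\rangle_\alpha\in V'_h$. The function $f$ is *analytic of Hilbert–Schmidt type* if it is smooth and for all $\sigma,\sigma'\in V'_h$ and $\alpha\in\mathcal I_{V,h}$ there are a constant $C_{\sigma,\sigma',\alpha}\in\mathbb R$ and a Hilbert basis $(e_i)_{i\in I}$ of $V_{h,\alpha}^{\mathrm{cpl}}$ such that $$\sum_{k=0}^\infty\frac1{k!}\sum_{i\in I^k}\Big|\big(\widehat D^{(k)}_{(e_{i_1}^{\flat_\alpha},\dots,e_{i_k}^{\flat_\alpha})}f\big)(\xi)\Big|^2\le C_{\sigma,\sigma',\alpha}$$ for every $\xi$ on the line segment between $\sigma$ and $\sigma'$. Let $\mathscr C^{\omega_{HS}}(V'_h)$ be the set of all such functions. **Theorem.** $\mathscr C^{\omega_{HS}}(V'_h)$ is a unital $*$-subalgebra of the algebra of all functions $V'_h\to\mathbb C$ (with pointwise operations and complex conjugation), and the Gel'fand transformation $X\mapsto\widehat X$ is an isomorphism of unital $*$-algebras from $\big(\mathcal S^\bullet(V)^{\mathrm{cpl}},\vee,{}^*\big)$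 onto $\mathscr C^{\omega_{HS}}(V'_h)$. -/

import Mathlib

open scoped TensorProduct ComplexConjugate ENNReal NNReal

noncomputable section

namespace HilbertTensor

/-! ### Continuous positive Hermitian forms -/

section Forms

variable (V : Type*) [AddCommGroup V] [Module ℂ V] [TopologicalSpace V]

/-- A continuous positive Hermitian form on `V`: sesquilinear (antilinear in the first, linear in
the second argument), Hermitian, positive semi-definite and (jointly) continuous. -/
structure HermForm where
  form : V →ₗ⋆[ℂ] V →ₗ[ℂ] ℂ
  conj_symm : ∀ v w, conj (form v w) = form w v
  nonneg : ∀ v, 0 ≤ (form v v).re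
  cont : Continuous fun p : V × V => form p.1 p.2

variable {V}

/-- The Hilbert seminorm of a positive Hermitian form. -/
def HermForm.nrm (α : HermForm V) (v : V) : ℝ := √(α.form v v).re

variable (V) in
/-- `V` is hilbertisable: it is locally convex and the continuous Hilbert seminorms are cofinal
among all continuous seminorms. -/
def Hilbertisable : Prop :=
  LocallyConvexSpace ℝ V ∧
    ∀ p : Seminorm ℂ V, Continuous p → ∃ α : HermForm V, ∀ v, p v ≤ α.nrm v

/-- Positive multiples of a form. -/
def HermForm.scale (c : ℝ≥0) (α : HermForm V) : HermForm V where
  form := ((c : ℝ) : ℂ) • α.form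
  conj_symm v w := by simp [α.conj_symm]
  nonneg v := by simpa using mul_nonneg c.2 (α.nonneg v)
  cont := continuous_const.mul α.cont

end Forms

/-! ### The tensor algebra -/

section Algebraic

variable (V : Type*) [AddCommGroup V] [Module ℂ V]

/-- The tensor algebra of `V`: the direct sum of the spaces of degree-`k` tensors. -/
def Tens := DirectSum ℕ fun k => ⨂[ℂ]^k V

instance : Ring (Tens V) :=
  { (inferInstance : AddCommGroup (DirectSum ℕ fun k => ⨂[ℂ]^k V)),
    (inferInstance : Semiring (DirectSum ℕ fun k => ⨂[ℂ]^k V)) with }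

instance : Algebra ℂ (Tens V) := inferInstanceAs (Algebra ℂ (DirectSum ℕ fun k => ⨂[ℂ]^k V))

variable {V}

/-- The inclusion of the tensors of degree `k`. -/
def ofDeg (k : ℕ) : (⨂[ℂ]^k V) →ₗ[ℂ] Tens V := DirectSum.lof ℂ ℕ (fun k => ⨂[ℂ]^k V) k

/-- The component of degree `k` of a tensor. -/
def deg (k : ℕ) : Tens V →ₗ[ℂ] ⨂[ℂ]^k V := DirectSum.component ℂ ℕ (fun k => ⨂[ℂ]^k V) k

/-- The linear map on the tensor algebra which is given by `f k` in degree `k`. -/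
def liftT {W : Type*} [AddCommGroup W] [Module ℂ W] (f : ∀ k, (⨂[ℂ]^k V) →ₗ[ℂ] W) :
    Tens V →ₗ[ℂ] W :=
  DirectSum.toModule ℂ ℕ W f

theorem liftT_ofDeg {W : Type*} [AddCommGroup W] [Module ℂ W] (f : ∀ k, (⨂[ℂ]^k V) →ₗ[ℂ] W)
    (k : ℕ) (t : ⨂[ℂ]^k V) : liftT f (ofDeg k t) = f k t :=
  DirectSum.toModule_lof (M := fun k => ⨂[ℂ]^k V) ℂ k t

theorem deg_ofDeg (k : ℕ) (t : ⨂[ℂ]^k V) : deg k (ofDeg k t) = t :=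
  DirectSum.component.lof_self (M := fun k => ⨂[ℂ]^k V) ℂ k t

theorem deg_ofDeg_of_ne {k l : ℕ} (h : k ≠ l) (t : ⨂[ℂ]^k V) : deg l (ofDeg k t) = 0 := by
  refine (DirectSum.component.of (M := fun k => ⨂[ℂ]^k V) ℂ l k t).trans ?_
  rw [dif_neg h]

/-- The simple tensor `x₁ ⊗ ⋯ ⊗ x_k`. -/
def simple {k : ℕ} (x : Fin k → V) : Tens V := ofDeg k (PiTensorProduct.tprod ℂ x)

theorem tens_induction {p : Tens V → Prop}
    (h0 : ∀ (c : ℂ) (k : ℕ) (x : Fin k → V), p (c • simple x))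
    (hadd : ∀ X Y, p X → p Y → p (X + Y)) (X : Tens V) : p X := by
  have hz : p 0 := by simpa using h0 0 0 (Fin.elim0)
  refine DirectSum.induction_on (motive := p) X hz (fun k t => ?_) hadd
  change p (ofDeg k t)
  induction t using PiTensorProduct.induction_on with
  | smul_tprod c x => rw [map_smul]; exact h0 c k x
  | add a b ha hb => rw [map_add]; exact hadd _ _ ha hb

theorem simple_mul {k l : ℕ} (x : Fin k → V) (y : Fin l → V) :
    simple x * simple y = simple (Fin.append x y) := by
  refine (DirectSum.of_mul_of (A := fun k => ⨂[ℂ]^k V) (PiTensorProduct.tprod ℂ x)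
    (PiTensorProduct.tprod ℂ y)).trans ?_
  rw [TensorPower.tprod_mul_tprod]
  rfl

theorem simple_elim0 (x : Fin 0 → V) : simple x = 1 := by
  rw [Subsingleton.elim x Fin.elim0]; rfl

theorem simple_cast {k l : ℕ} (h : k = l) (x : Fin l → V) :
    simple (fun i : Fin k => x (Fin.cast h i)) = simple x := by
  subst h; rfl

/-! Semilinear maps out of the tensor algebra -/

/-- The space `W` with the conjugate scalar multiplication; only used to construct antilinear
maps. -/
def ConjMod (W : Type*) := W

instance (W : Type*) [AddCommGroup W] : AddCommGroup (ConjMod W) := inferInstanceAs (AddCommGroup W)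

instance (W : Type*) [AddCommGroup W] [Module ℂ W] : Module ℂ (ConjMod W) :=
  Module.compHom W (starRingEnd ℂ)

/-- The antilinear map on the tensor algebra with prescribed values `f k x` on simple tensors. -/
def liftConj {W : Type*} [AddCommGroup W] [Module ℂ W]
    (f : ∀ k, MultilinearMap ℂ (fun _ : Fin k => V) (ConjMod W)) : Tens V →ₗ⋆[ℂ] W where
  toFun X := liftT (W := ConjMod W) (fun k => PiTensorProduct.lift (f k)) X
  map_add' X Y := map_add (liftT (W := ConjMod W) (fun k => PiTensorProduct.lift (f k))) X Y
  map_smul' c X := map_smul (liftT (W := ConjMod W) (fun k => PiTensorProduct.lift (f k))) c X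

theorem liftConj_simple {W : Type*} [AddCommGroup W] [Module ℂ W]
    (f : ∀ k, MultilinearMap ℂ (fun _ : Fin k => V) (ConjMod W)) {k : ℕ} (x : Fin k → V) :
    liftConj f (simple x) = f k x :=
  (liftT_ofDeg (W := ConjMod W) _ k _).trans (PiTensorProduct.lift.tprod x)

/-! Symmetrisation and the space of symmetric tensors -/

/-- The symmetrisation operator: on simple tensors of degree `k` it is
`x₁ ⊗ ⋯ ⊗ x_k ↦ (1 / k!) ∑ σ, x_{σ 1} ⊗ ⋯ ⊗ x_{σ k}`. -/
def symm : Tens V →ₗ[ℂ] Tens V :=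
  liftT fun k =>
    (k.factorial : ℂ)⁻¹ • ∑ σ : Equiv.Perm (Fin k),
      ofDeg k ∘ₗ PiTensorProduct.lift ((PiTensorProduct.tprod ℂ).domDomCongr σ)

theorem symm_simple {k : ℕ} (x : Fin k → V) :
    symm (simple x) = (k.factorial : ℂ)⁻¹ • ∑ σ : Equiv.Perm (Fin k), simple (x ∘ σ) := by
  simp only [symm, simple]
  rw [liftT_ofDeg]
  simp [LinearMap.sum_apply]
  rfl

theorem symm_simple_comp {k : ℕ} (x : Fin k → V) (σ : Equiv.Perm (Fin k)) :
    symm (simple (x ∘ σ)) = symm (simple x) := by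
  rw [symm_simple, symm_simple]
  congr 1
  exact Fintype.sum_equiv (Equiv.mulLeft σ) _ _ fun τ => rfl

theorem symm_simple_equiv {k l : ℕ} (x : Fin l → V) (e : Fin k ≃ Fin l) :
    symm (simple (x ∘ e)) = symm (simple x) := by
  obtain rfl : k = l := by simpa using Fintype.card_congr e
  exact symm_simple_comp x e

theorem avg_const {k : ℕ} {W : Type*} [AddCommGroup W] [Module ℂ W] (w : W) :
    (k.factorial : ℂ)⁻¹ • ∑ _σ : Equiv.Perm (Fin k), w = w := by
  rw [Finset.sum_const, Finset.card_univ, Fintype.card_perm, Fintype.card_fin,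
    ← Nat.cast_smul_eq_nsmul ℂ, smul_smul, inv_mul_cancel₀, one_smul]
  exact_mod_cast k.factorial_ne_zero

theorem symm_symm (X : Tens V) : symm (symm X) = symm X := by
  induction X using tens_induction with
  | h0 c k x =>
    rw [map_smul, map_smul]
    congr 1
    conv_lhs => rw [symm_simple, map_smul, map_sum]
    simp only [symm_simple_comp]
    exact avg_const _
  | hadd X Y hX hY => simp only [map_add, hX, hY]

theorem symm_mul_comm (X Y : Tens V) : symm (X * Y) = symm (Y * X) := by
  induction X using tens_induction with
  | hadd X X' hX hX' => simp only [map_add, add_mul, mul_add, hX, hX']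
  | h0 c k x =>
    induction Y using tens_induction with
    | hadd Y Y' hY hY' => simp only [map_add, add_mul, mul_add, hY, hY']
    | h0 d l y =>
      simp only [smul_mul_assoc, mul_smul_comm, map_smul, simple_mul]
      rw [smul_comm]
      congr 2
      rw [← symm_simple_equiv (Fin.append y x) finAddFlip]
      congr 2
      ext i
      refine Fin.addCases (fun i => ?_) (fun i => ?_) i <;> simp

theorem symm_symm_mul (X Y : Tens V) : symm (symm X * Y) = symm (X * Y) := by
  induction X using tens_induction with
  | hadd X X' hX hX' => simp only [map_add, add_mul, hX, hX']
  | h0 c k x =>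
    induction Y using tens_induction with
    | hadd Y Y' hY hY' => simp only [map_add, mul_add, hY, hY']
    | h0 d l y =>
      simp only [smul_mul_assoc, mul_smul_comm, map_smul]
      congr 2
      rw [symm_simple, smul_mul_assoc, map_smul, Finset.sum_mul, map_sum]
      have (σ : Equiv.Perm (Fin k)) :
          symm (simple (x ∘ σ) * simple y) = symm (simple x * simple y) := by
        rw [simple_mul, simple_mul, ← symm_simple_equiv (Fin.append x y)
          ((finSumFinEquiv.symm.trans (Equiv.sumCongr σ (Equiv.refl _))).trans finSumFinEquiv)]
        congr 2
        ext i
        refine Fin.addCases (fun i => ?_) (fun i => ?_) i <;> simp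
      simp only [this]
      exact avg_const _

theorem symm_mul_symm (X Y : Tens V) : symm (X * symm Y) = symm (X * Y) := by
  rw [symm_mul_comm, symm_symm_mul, symm_mul_comm]

theorem symm_one : symm (1 : Tens V) = 1 := by
  rw [← simple_elim0 (Fin.elim0 : Fin 0 → V), symm_simple]
  simp only [simple_elim0]
  exact avg_const _

variable (V) in
/-- The space of symmetric tensors: the range of the projector `symm`. -/
def symTens : Submodule ℂ (Tens V) := LinearMap.range symm

theorem symm_mem (X : Tens V) : symm X ∈ symTens V := ⟨X, rfl⟩

theorem symm_of_mem (X : symTens V) : symm (X : Tens V) = X := by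
  obtain ⟨_, Y, rfl⟩ := X
  exact symm_symm Y

/-- The symmetric tensor product `X ∨ Y = symm (X ⊗ Y)`. -/
instance : Mul (symTens V) := ⟨fun X Y => ⟨symm ((X : Tens V) * (Y : Tens V)), symm_mem _⟩⟩

instance : One (symTens V) := ⟨⟨1, 1, symm_one⟩⟩

theorem coe_vee (X Y : symTens V) : ((X * Y : symTens V) : Tens V) = symm ((X : Tens V) * (Y : Tens V)) := rfl

theorem coe_one : ((1 : symTens V) : Tens V) = 1 := rfl

/-- Symmetric tensors with the product `∨` form a commutative ring. -/
instance : CommRing (symTens V) :=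
  { (inferInstance : AddCommGroup (symTens V)) with
    mul := (· * ·)
    one := 1
    mul_assoc := fun X Y Z => Subtype.ext <| by
      simp only [coe_vee, symm_symm_mul, symm_mul_symm, mul_assoc]
    one_mul := fun X => Subtype.ext <| by simp [coe_vee, coe_one, symm_of_mem]
    mul_one := fun X => Subtype.ext <| by simp [coe_vee, coe_one, symm_of_mem]
    mul_comm := fun X Y => Subtype.ext <| by simp only [coe_vee]; exact symm_mul_comm _ _
    zero_mul := fun X => Subtype.ext <| by simp [coe_vee]
    mul_zero := fun X => Subtype.ext <| by simp [coe_vee]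
    left_distrib := fun X Y Z => Subtype.ext <| by simp [coe_vee, mul_add]
    right_distrib := fun X Y Z => Subtype.ext <| by simp [coe_vee, add_mul] }

instance : Algebra ℂ (symTens V) :=
  Algebra.ofModule
    (fun c X Y => Subtype.ext <| by simp [coe_vee])
    (fun c X Y => Subtype.ext <| by simp [coe_vee])

/-! The involution -/

section Involution

variable [StarAddMonoid V] [StarModule ℂ V]

theorem update_star_rev {W : Type*} [Star W] {k : ℕ} [DecidableEq (Fin k)] (x : Fin k → W)
    (j : Fin k) (v : W) :
    (fun i => star (Function.update x j v i.rev)) =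
      Function.update (fun i => star (x i.rev)) j.rev (star v) := by
  ext i
  by_cases h : i = j.rev
  · subst h; simp
  · have h' : i.rev ≠ j := fun e => h (by rw [← e, Fin.rev_rev])
    simp [Function.update_of_ne h, Function.update_of_ne h']

/-- The antilinear involution `(x₁ ⊗ ⋯ ⊗ x_k)* = x̄_k ⊗ ⋯ ⊗ x̄₁` on the tensor algebra. -/
def starT : Tens V →ₗ⋆[ℂ] Tens V :=
  liftConj fun k =>
    { toFun := fun x => simple fun i => star (x i.rev)
      map_update_add' := fun {_} x i a b => by
        simp only [update_star_rev, star_add, simple, MultilinearMap.map_update_add, map_add]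
        rfl
      map_update_smul' := fun {_} x i c a => by
        simp only [update_star_rev, star_smul, simple, MultilinearMap.map_update_smul, map_smul]
        rfl }

theorem starT_simple {k : ℕ} (x : Fin k → V) :
    starT (simple x) = simple fun i => star (x i.rev) := liftConj_simple _ x

theorem starT_starT (X : Tens V) : starT (starT X) = X := by
  induction X using tens_induction with
  | hadd X Y hX hY => simp only [map_add, hX, hY]
  | h0 c k x => simp [starT_simple, LinearMap.map_smulₛₗ]

theorem starT_mul (X Y : Tens V) : starT (X * Y) = starT Y * starT X := by
  induction X using tens_induction with
  | hadd X X' hX hX' => simp only [map_add, add_mul, mul_add, hX, hX']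
  | h0 c k x =>
    induction Y using tens_induction with
    | hadd Y Y' hY hY' => simp only [map_add, add_mul, mul_add, hY, hY']
    | h0 d l y =>
      simp only [smul_mul_assoc, mul_smul_comm, LinearMap.map_smulₛₗ, simple_mul, starT_simple]
      rw [smul_comm]
      congr 2
      rw [← simple_cast (add_comm k l)]
      congr 1
      ext i
      rw [Fin.append_rev]
      generalize Fin.cast (Nat.add_comm k l) i = j
      refine Fin.addCases (fun i => ?_) (fun i => ?_) j <;> simp

theorem starT_symm (X : Tens V) : starT (symm X) = symm (starT X) := by
  induction X using tens_induction with
  | hadd X Y hX hY => simp only [map_add, hX, hY]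
  | h0 c k x =>
    simp only [LinearMap.map_smulₛₗ, map_smul, starT_simple, symm_simple, map_sum]
    simp only [map_inv₀, map_natCast]
    congr 2
    refine Fintype.sum_equiv ((Equiv.mulLeft Fin.revPerm).trans (Equiv.mulRight Fin.revPerm)) _ _
      fun τ => ?_
    congr 1
    ext i
    simp

instance : Star (symTens V) :=
  ⟨fun X => ⟨starT (X : Tens V), by
    rw [← symm_of_mem X, starT_symm]; exact symm_mem _⟩⟩

theorem coe_star (X : symTens V) : ((star X : symTens V) : Tens V) = starT (X : Tens V) := rfl

instance : StarRing (symTens V) where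
  star_involutive X := Subtype.ext <| by simp [coe_star, starT_starT]
  star_mul X Y := Subtype.ext <| by simp [coe_star, coe_vee, starT_symm, starT_mul]
  star_add X Y := Subtype.ext <| by simp [coe_star]

instance : StarModule ℂ (symTens V) where
  star_smul c X := Subtype.ext <| by simp [coe_star, LinearMap.map_smulₛₗ]

end Involution

end Algebraic

/-! ### The topology on the tensor algebra -/

open scoped ComplexOrder

section Proj

variable {V : Type*} [AddCommGroup V] [Module ℂ V]

/-- The projection onto tensors of degree `k`. -/
def proj (k : ℕ) : Tens V →ₗ[ℂ] Tens V := ofDeg k ∘ₗ deg k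

theorem proj_simple {k : ℕ} (x : Fin k → V) : proj k (simple x) = simple x := by
  simp [proj, simple, deg_ofDeg]

theorem proj_simple_of_ne {k l : ℕ} (h : l ≠ k) (x : Fin k → V) : proj l (simple x) = 0 := by
  simp [proj, simple, deg_ofDeg_of_ne h.symm]

theorem exists_eq_sum_proj (X : Tens V) : ∃ s : Finset ℕ, X = ∑ k ∈ s, proj k X := by
  classical
  refine ⟨DFinsupp.support (β := fun k => ⨂[ℂ]^k V) X, ?_⟩
  exact (DirectSum.sum_support_of (β := fun k => ⨂[ℂ]^k V) X).symm

theorem lift_update_add {k : ℕ} [DecidableEq (Fin k)] (f : Fin k → V →ₗ[ℂ] ℂ) (j : Fin k)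
    (a b : V →ₗ[ℂ] ℂ) :
    PiTensorProduct.lift ((MultilinearMap.mkPiAlgebra ℂ (Fin k) ℂ).compLinearMap
        (Function.update f j (a + b))) =
      PiTensorProduct.lift ((MultilinearMap.mkPiAlgebra ℂ (Fin k) ℂ).compLinearMap
        (Function.update f j a)) +
      PiTensorProduct.lift ((MultilinearMap.mkPiAlgebra ℂ (Fin k) ℂ).compLinearMap
        (Function.update f j b)) := by
  rw [← map_add]
  congr 1
  exact (MultilinearMap.piLinearMap (MultilinearMap.mkPiAlgebra ℂ (Fin k) ℂ)).map_update_add f j a b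

theorem lift_update_smul {k : ℕ} [DecidableEq (Fin k)] (f : Fin k → V →ₗ[ℂ] ℂ) (j : Fin k)
    (c : ℂ) (a : V →ₗ[ℂ] ℂ) :
    PiTensorProduct.lift ((MultilinearMap.mkPiAlgebra ℂ (Fin k) ℂ).compLinearMap
        (Function.update f j (c • a))) =
      c • PiTensorProduct.lift ((MultilinearMap.mkPiAlgebra ℂ (Fin k) ℂ).compLinearMap
        (Function.update f j a)) := by
  rw [← map_smul]
  congr 1
  exact (MultilinearMap.piLinearMap (MultilinearMap.mkPiAlgebra ℂ (Fin k) ℂ)).map_update_smul f j c a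

end Proj

section Topology

variable {V : Type*} [AddCommGroup V] [Module ℂ V] [TopologicalSpace V]

theorem update_form {V W : Type*} {k : ℕ} [DecidableEq (Fin k)] (f : V → W) (x : Fin k → V)
    (j : Fin k) (v : V) :
    (fun m => f (Function.update x j v m)) = Function.update (fun m => f (x m)) j (f v) := by
  ext i
  exact Function.apply_update (fun _ => f) x j v i

/-- The extension of a form `α` to the tensor algebra: tensors of different degree are orthogonal,
and `⟨x₁ ⊗ ⋯ ⊗ x_k, y₁ ⊗ ⋯ ⊗ y_k⟩ = k! ∏ m, ⟨x_m, y_m⟩_α`. -/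
def HermForm.ext (α : HermForm V) : Tens V →ₗ⋆[ℂ] Tens V →ₗ[ℂ] ℂ :=
  liftConj fun k =>
    { toFun := fun x => (k.factorial : ℂ) •
        (PiTensorProduct.lift ((MultilinearMap.mkPiAlgebra ℂ (Fin k) ℂ).compLinearMap
          fun m => α.form (x m))) ∘ₗ deg k
      map_update_add' := fun {_} x i a b => by
        rw [update_form, update_form, update_form, map_add, lift_update_add, LinearMap.add_comp,
          smul_add]
        rfl
      map_update_smul' := fun {_} x i c a => by
        rw [update_form, update_form, LinearMap.map_smulₛₗ, lift_update_smul, LinearMap.smul_comp,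
          smul_comm]
        rfl }

theorem HermForm.ext_simple_left (α : HermForm V) {k : ℕ} (x : Fin k → V) :
    α.ext (simple x) = (k.factorial : ℂ) •
        (PiTensorProduct.lift ((MultilinearMap.mkPiAlgebra ℂ (Fin k) ℂ).compLinearMap
          fun m => α.form (x m))) ∘ₗ deg k :=
  liftConj_simple _ x

theorem HermForm.ext_simple (α : HermForm V) {k : ℕ} (x y : Fin k → V) :
    α.ext (simple x) (simple y) = k.factorial * ∏ m, α.form (x m) (y m) := by
  rw [ext_simple_left]
  simp [simple, deg_ofDeg]

theorem HermForm.ext_simple_of_ne (α : HermForm V) {k l : ℕ} (h : k ≠ l) (x : Fin k → V)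
    (y : Fin l → V) : α.ext (simple x) (simple y) = 0 := by
  rw [ext_simple_left]
  simp [simple, deg_ofDeg_of_ne h.symm]

theorem HermForm.ext_conj_symm (α : HermForm V) (X Y : Tens V) :
    conj (α.ext X Y) = α.ext Y X := by
  induction X using tens_induction with
  | hadd X X' hX hX' => simp only [map_add, LinearMap.add_apply, hX, hX']
  | h0 c k x =>
    induction Y using tens_induction with
    | hadd Y Y' hY hY' => simp only [map_add, LinearMap.add_apply, hY, hY']
    | h0 d l y =>
      simp only [LinearMap.map_smulₛₗ, LinearMap.smul_apply, map_smul, smul_eq_mul, map_mul,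
        Complex.conj_conj]
      by_cases h : k = l
      · subst h
        simp only [ext_simple, map_mul, map_prod, α.conj_symm, map_natCast]
        ring
      · simp [ext_simple_of_ne α h, ext_simple_of_ne α (Ne.symm h)]

theorem ext_proj (α : HermForm V) (k : ℕ) (X Y : Tens V) :
    α.ext (proj k X) (proj k Y) = α.ext X (proj k Y) := by
  induction X using tens_induction with
  | hadd X X' hX hX' => simp only [map_add, LinearMap.add_apply, hX, hX']
  | h0 c l x =>
    induction Y using tens_induction with
    | hadd Y Y' hY hY' => simp only [map_add, hY, hY']
    | h0 d m y =>
      simp only [LinearMap.map_smulₛₗ, LinearMap.smul_apply, map_smul, smul_eq_mul]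
      by_cases h : k = l
      · subst h; rw [proj_simple]
      · rw [proj_simple_of_ne h]
        by_cases h' : k = m
        · subst h'
          rw [proj_simple, α.ext_simple_of_ne (Ne.symm h)]
          simp
        · rw [proj_simple_of_ne h']
          simp

theorem posSemidef_gram (α : HermForm V) {ι : Type*} (x : ι → V) :
    (Matrix.of fun i j => α.form (x i) (x j)).PosSemidef := by
  refine ⟨?_, fun c => ?_⟩
  · ext i j
    simp only [Matrix.conjTranspose_apply, Matrix.of_apply]
    exact α.conj_symm _ _
  · have : (c.sum fun i ci => c.sum fun j cj =>
        star ci * (Matrix.of fun i j => α.form (x i) (x j)) i j * cj) =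
        α.form (c.sum fun i ci => ci • x i) (c.sum fun i ci => ci • x i) := by
      simp only [Finsupp.sum, map_sum, LinearMap.sum_apply, LinearMap.map_smulₛₗ,
        LinearMap.smul_apply, smul_eq_mul, Matrix.of_apply, Finset.mul_sum]
      rw [Finset.sum_comm]
      refine Finset.sum_congr rfl fun i _ => Finset.sum_congr rfl fun j _ => ?_
      simp
      ring
    rw [this, Complex.le_def]
    refine ⟨by simpa using α.nonneg _, ?_⟩
    exact (Complex.conj_eq_iff_im.1 (α.conj_symm _ _)).symm

theorem posSemidef_gram_prod (α : HermForm V) {ι κ : Type*} (x : ι → κ → V) (s : Finset κ) :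
    (Matrix.of fun i j => ∏ m ∈ s, α.form (x i m) (x j m)).PosSemidef := by
  classical
  induction s using Finset.induction_on with
  | empty =>
    refine ⟨by ext; simp, fun c => ?_⟩
    simp only [Finset.prod_empty, Matrix.of_apply, mul_one, Finsupp.sum, ← Finset.mul_sum,
      ← Finset.sum_mul]
    rw [← star_sum]
    exact star_mul_self_nonneg _
  | insert a s ha ih =>
    have := (posSemidef_gram α fun i => x i a).hadamard ih
    convert! this using 1
    ext i j
    simp [Finset.prod_insert ha]

theorem ext_proj_nonneg (α : HermForm V) (k : ℕ) (X : Tens V) :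
    0 ≤ (α.ext (proj k X) (proj k X)).re := by
  have h : deg k X ∈ Submodule.span ℂ (Set.range (PiTensorProduct.tprod ℂ (s := fun _ : Fin k => V))) := by
    rw [PiTensorProduct.span_tprod_eq_top]; trivial
  obtain ⟨c, hc⟩ := Finsupp.mem_span_range_iff_exists_finsupp.1 h
  have hX : proj k X = c.sum fun x cx => cx • simple x := by
    simp only [proj, LinearMap.comp_apply, ← hc, Finsupp.sum, map_sum, map_smul, simple]
  have hp := (posSemidef_gram_prod α (fun x : Fin k → V => x) Finset.univ).2 c
  have : α.ext (proj k X) (proj k X) = k.factorial * (c.sum fun i ci => c.sum fun j cj =>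
        star ci * (Matrix.of fun x y : Fin k → V => ∏ m, α.form (x m) (y m)) i j * cj) := by
    rw [hX]
    simp only [Finsupp.sum, map_sum, LinearMap.sum_apply, LinearMap.map_smulₛₗ, map_smul,
      LinearMap.smul_apply, smul_eq_mul, Matrix.of_apply, HermForm.ext_simple, Finset.mul_sum]
    rw [Finset.sum_comm]
    refine Finset.sum_congr rfl fun i _ => Finset.sum_congr rfl fun j _ => ?_
    simp
    ring
  rw [this, ← Complex.ofReal_natCast, Complex.re_ofReal_mul]
  exact mul_nonneg (Nat.cast_nonneg _) (Complex.le_def.1 hp).1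

theorem HermForm.ext_nonneg (α : HermForm V) (X : Tens V) : 0 ≤ (α.ext X X).re := by
  obtain ⟨s, hs⟩ := exists_eq_sum_proj X
  have : α.ext X X = ∑ k ∈ s, α.ext (proj k X) (proj k X) := by
    conv_lhs => rw [hs, map_sum]
    refine Finset.sum_congr rfl fun k _ => ?_
    rw [ext_proj, ← hs]
  rw [this, Complex.re_sum]
  exact Finset.sum_nonneg fun k _ => ext_proj_nonneg α k X

/-- The positive Hermitian form on the tensor algebra as an inner product (a proof device). -/
abbrev HermForm.core (α : HermForm V) : PreInnerProductSpace.Core ℂ (Tens V) where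
  inner X Y := α.ext X Y
  conj_inner_symm X Y := α.ext_conj_symm Y X
  re_inner_nonneg := α.ext_nonneg
  add_left X Y Z := by simp
  smul_left X Y r := by simp

theorem cauchy_schwarz (α : HermForm V) (X Y : Tens V) :
    ‖α.ext X Y‖ ≤ √(α.ext X X).re * √(α.ext Y Y).re :=
  @InnerProductSpace.Core.norm_inner_le_norm ℂ (Tens V) _ _ _ α.core X Y

/-- The extension of the Hilbert seminorm of `α` to the tensor algebra. -/
def HermForm.tnorm (α : HermForm V) : Seminorm ℂ (Tens V) :=
  Seminorm.of (fun X => √(α.ext X X).re)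
    (fun X Y => @norm_add_le (Tens V)
      (@InnerProductSpace.Core.toSeminormedAddCommGroup ℂ _ _ _ _ α.core).toSeminormedAddGroup X Y)
    (fun c X => by
      have : α.ext (c • X) (c • X) = ((‖c‖ ^ 2 : ℝ) : ℂ) * α.ext X X := by
        simp only [LinearMap.map_smulₛₗ, LinearMap.smul_apply, map_smul, smul_eq_mul]
        rw [← mul_assoc, Complex.mul_conj']
        push_cast
        ring
      rw [this, Complex.re_ofReal_mul, Real.sqrt_mul (by positivity), Real.sqrt_sq (norm_nonneg c)])

theorem HermForm.tnorm_apply (α : HermForm V) (X : Tens V) : α.tnorm X = √(α.ext X X).re := rfl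

/-- The topology of the tensor algebra, as a uniform structure: it is defined by the extensions of
all continuous Hilbert seminorms on `V`. -/
instance : UniformSpace (Tens V) :=
  ⨅ α : HermForm V, α.tnorm.toSeminormedAddCommGroup.toUniformSpace

instance : IsUniformAddGroup (Tens V) :=
  isUniformAddGroup_iInf fun α =>
    @SeminormedAddCommGroup.to_isUniformAddGroup (Tens V) α.tnorm.toSeminormedAddCommGroup

theorem withSeminorms_tnorm :
    WithSeminorms (fun α : HermForm V => α.tnorm) :=
  (SeminormFamily.withSeminorms_iff_uniformSpace_eq_iInf (𝕜 := ℂ) (E := Tens V) _).2 rfl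

end Topology

section Continuity

variable {V : Type*} [AddCommGroup V] [Module ℂ V] [TopologicalSpace V]

theorem tnorm_sq (α : HermForm V) (X : Tens V) : α.tnorm X ^ 2 = (α.ext X X).re := by
  rw [α.tnorm_apply, Real.sq_sqrt (α.ext_nonneg X)]

theorem ext_self (α : HermForm V) (X : Tens V) : α.ext X X = ((α.tnorm X ^ 2 : ℝ) : ℂ) := by
  rw [tnorm_sq]
  exact (Complex.conj_eq_iff_re.1 (α.ext_conj_symm X X)).symm

theorem tnorm_le_of_ext_eq (α : HermForm V) {X Y : Tens V} (h : α.ext Y Y = α.ext X Y) :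
    α.tnorm Y ≤ α.tnorm X := by
  by_contra! hlt
  have h1 : α.tnorm Y ^ 2 ≤ α.tnorm X * α.tnorm Y := by
    rw [tnorm_sq, h]
    exact (Complex.re_le_norm _).trans (cauchy_schwarz α X Y)
  have h2 := apply_nonneg α.tnorm X
  nlinarith

theorem tnorm_proj_le (α : HermForm V) (k : ℕ) (X : Tens V) :
    α.tnorm (proj k X) ≤ α.tnorm X :=
  tnorm_le_of_ext_eq α (ext_proj α k X X)

theorem ext_symm (α : HermForm V) (X Y : Tens V) : α.ext (symm X) Y = α.ext X (symm Y) := by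
  induction X using tens_induction with
  | hadd X X' hX hX' => simp only [map_add, LinearMap.add_apply, hX, hX']
  | h0 c k x =>
    induction Y using tens_induction with
    | hadd Y Y' hY hY' => simp only [map_add, hY, hY']
    | h0 d l y =>
      simp only [LinearMap.map_smulₛₗ, LinearMap.smul_apply, map_smul, symm_simple, map_sum,
        LinearMap.sum_apply]
      by_cases h : k = l
      · subst h
        have key : ∑ σ : Equiv.Perm (Fin k), α.ext (simple (x ∘ σ)) (simple y) =
            ∑ σ : Equiv.Perm (Fin k), α.ext (simple x) (simple (y ∘ σ)) := by
          simp only [α.ext_simple]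
          refine Fintype.sum_equiv (Equiv.inv (Equiv.Perm (Fin k))) _ _ fun σ => ?_
          congr 1
          refine Fintype.prod_equiv σ _ _ fun m => ?_
          simp
        simp only [map_inv₀, map_natCast, smul_eq_mul, ← Finset.mul_sum, key]
        ring
      · simp [α.ext_simple_of_ne h]

theorem tnorm_symm_le (α : HermForm V) (X : Tens V) : α.tnorm (symm X) ≤ α.tnorm X :=
  tnorm_le_of_ext_eq α (by rw [ext_symm, symm_symm])

theorem scale_ext_proj (c : ℝ≥0) (α : HermForm V) (k : ℕ) (X Y : Tens V) :
    (α.scale c).ext (proj k X) (proj k Y) = ((c : ℝ) : ℂ) ^ k * α.ext (proj k X) (proj k Y) := by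
  induction X using tens_induction with
  | hadd X X' hX hX' => simp only [map_add, LinearMap.add_apply, hX, hX', mul_add]
  | h0 a l x =>
    induction Y using tens_induction with
    | hadd Y Y' hY hY' => simp only [map_add, hY, hY', mul_add]
    | h0 d m y =>
      simp only [LinearMap.map_smulₛₗ, LinearMap.smul_apply, map_smul, smul_eq_mul]
      by_cases h : k = l
      · subst h
        by_cases h' : k = m
        · subst h'
          simp only [proj_simple, HermForm.ext_simple, HermForm.scale, LinearMap.smul_apply,
            smul_eq_mul, Finset.prod_mul_distrib, Finset.prod_const, Finset.card_univ,
            Fintype.card_fin]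
          ring
        · simp [proj_simple_of_ne h']
      · simp [proj_simple_of_ne h]

theorem scale_tnorm_proj (α : HermForm V) (k : ℕ) (X : Tens V) :
    (α.scale 16).tnorm (proj k X) = 4 ^ k * α.tnorm (proj k X) := by
  rw [HermForm.tnorm_apply, scale_ext_proj, ← Complex.ofReal_pow, Complex.re_ofReal_mul,
    Real.sqrt_mul (by positivity), ← HermForm.tnorm_apply]
  congr 1
  rw [show ((16 : ℝ≥0) : ℝ) = 4 ^ 2 by norm_num, ← pow_mul, mul_comm 2 k, pow_mul,
    Real.sqrt_sq (by positivity)]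

theorem sum_proj_le (α : HermForm V) (s : Finset ℕ) (X : Tens V) :
    ∑ k ∈ s, 2 ^ k * α.tnorm (proj k X) ≤ 2 * (α.scale 16).tnorm X := by
  have h (k : ℕ) : 2 ^ k * α.tnorm (proj k X) ≤ (1 / 2) ^ k * (α.scale 16).tnorm X := by
    have h1 := tnorm_proj_le (α.scale 16) k X
    rw [scale_tnorm_proj] at h1
    calc 2 ^ k * α.tnorm (proj k X) = (1 / 2) ^ k * (4 ^ k * α.tnorm (proj k X)) := by
          rw [← mul_assoc, ← mul_pow]; norm_num
      _ ≤ _ := by gcongr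
  refine (Finset.sum_le_sum fun k _ => h k).trans ?_
  rw [← Finset.sum_mul]
  refine mul_le_mul_of_nonneg_right ?_ (apply_nonneg _ _)
  have := summable_geometric_two.sum_le_tsum s (fun k _ => by positivity)
  rwa [tsum_geometric_two] at this

theorem ext_mul_proj (α : HermForm V) (k l : ℕ) (X Y X' Y' : Tens V) :
    α.ext (proj k X * proj l Y) (proj k X' * proj l Y') =
      (k + l).choose l * (α.ext (proj k X) (proj k X') * α.ext (proj l Y) (proj l Y')) := by
  induction X using tens_induction with
  | hadd _ _ h h' => simp only [map_add, add_mul, LinearMap.add_apply, h, h', mul_add]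
  | h0 a k₁ x =>
  induction X' using tens_induction with
  | hadd _ _ h h' => simp only [map_add, add_mul, h, h', mul_add]
  | h0 b k₂ x' =>
  induction Y using tens_induction with
  | hadd _ _ h h' => simp only [map_add, mul_add, LinearMap.add_apply, h, h']
  | h0 c l₁ y =>
  induction Y' using tens_induction with
  | hadd _ _ h h' => simp only [map_add, mul_add, h, h']
  | h0 d l₂ y' =>
  by_cases h₁ : k = k₁
  swap
  · simp [proj_simple_of_ne h₁]
  by_cases h₂ : k = k₂
  swap
  · simp [proj_simple_of_ne h₂]
  by_cases h₃ : l = l₁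
  swap
  · simp [proj_simple_of_ne h₃]
  by_cases h₄ : l = l₂
  swap
  · simp [proj_simple_of_ne h₄]
  subst h₁ h₂ h₃ h₄
  simp only [map_smul, smul_mul_assoc, mul_smul_comm, LinearMap.map_smulₛₗ, LinearMap.smul_apply,
    smul_eq_mul, proj_simple, simple_mul, α.ext_simple, Fin.prod_univ_add, Fin.append_left,
    Fin.append_right]
  rw [← Nat.add_choose_mul_factorial_mul_factorial k l]
  push_cast
  ring

theorem tnorm_mul_proj_le (α : HermForm V) (k l : ℕ) (X Y : Tens V) :
    α.tnorm (proj k X * proj l Y) ≤ 2 ^ k * α.tnorm (proj k X) * (2 ^ l * α.tnorm (proj l Y)) := by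
  have h : α.tnorm (proj k X * proj l Y) ^ 2 =
      (k + l).choose l * (α.tnorm (proj k X) ^ 2 * α.tnorm (proj l Y) ^ 2) := by
    rw [tnorm_sq, ext_mul_proj, ext_self, ext_self]
    norm_cast
  have hc : ((k + l).choose l : ℝ) ≤ (2 ^ k * 2 ^ l) ^ 2 := by
    have h1 : ((k + l).choose l : ℝ) ≤ 2 ^ (k + l) := by exact_mod_cast Nat.choose_le_two_pow _ _
    have h2 : (1 : ℝ) ≤ 2 ^ (k + l) := one_le_pow₀ (by norm_num)
    rw [← pow_add]
    nlinarith
  refine (sq_le_sq₀ (apply_nonneg _ _) (by positivity)).1 ?_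
  rw [h]
  calc _ ≤ (2 ^ k * 2 ^ l : ℝ) ^ 2 * (α.tnorm (proj k X) ^ 2 * α.tnorm (proj l Y) ^ 2) := by
        gcongr
    _ = _ := by ring

theorem tnorm_sum_le {ι : Type*} (α : HermForm V) (s : Finset ι) (u : ι → Tens V) :
    α.tnorm (∑ i ∈ s, u i) ≤ ∑ i ∈ s, α.tnorm (u i) :=
  Finset.le_sum_of_subadditive _ (map_zero α.tnorm).le (map_add_le_add _) s u

theorem tnorm_mul_le (α : HermForm V) (X Y : Tens V) :
    α.tnorm (X * Y) ≤ 4 * (α.scale 16).tnorm X * (α.scale 16).tnorm Y := by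
  obtain ⟨s, hs⟩ := exists_eq_sum_proj X
  obtain ⟨t, ht⟩ := exists_eq_sum_proj Y
  calc α.tnorm (X * Y) = α.tnorm (∑ k ∈ s, ∑ l ∈ t, proj k X * proj l Y) := by
        rw [← Finset.sum_mul_sum, ← hs, ← ht]
    _ ≤ ∑ k ∈ s, ∑ l ∈ t, 2 ^ k * α.tnorm (proj k X) * (2 ^ l * α.tnorm (proj l Y)) := by
        refine (tnorm_sum_le _ _ _).trans (Finset.sum_le_sum fun k _ => ?_)
        refine (tnorm_sum_le _ _ _).trans (Finset.sum_le_sum fun l _ => ?_)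
        exact tnorm_mul_proj_le α k l X Y
    _ = (∑ k ∈ s, 2 ^ k * α.tnorm (proj k X)) * ∑ l ∈ t, 2 ^ l * α.tnorm (proj l Y) := by
        rw [Finset.sum_mul_sum]
    _ ≤ (2 * (α.scale 16).tnorm X) * (2 * (α.scale 16).tnorm Y) :=
        mul_le_mul (sum_proj_le α s X) (sum_proj_le α t Y)
          (Finset.sum_nonneg fun _ _ => by positivity) (by positivity)
    _ = _ := by ring

theorem continuous_tnorm (α : HermForm V) : Continuous α.tnorm :=
  withSeminorms_tnorm.continuous_seminorm α

theorem tendsto_zero_of_tnorm_le {ι : Type*} {l : Filter ι} {u : ι → Tens V}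
    (h : ∀ α : HermForm V, ∃ b : ι → ℝ, (∀ i, α.tnorm (u i) ≤ b i) ∧
      Filter.Tendsto b l (nhds 0)) : Filter.Tendsto u l (nhds 0) := by
  rw [withSeminorms_tnorm.tendsto_nhds]
  intro α ε hε
  obtain ⟨b, hb, hb'⟩ := h α
  filter_upwards [hb'.eventually (gt_mem_nhds hε)] with i hi
  rw [sub_zero]
  exact (hb i).trans_lt hi

instance : IsTopologicalRing (Tens V) := by
  refine IsTopologicalRing.of_addGroup_of_nhds_zero ?_ (fun X => ?_) (fun X => ?_)
  · refine tendsto_zero_of_tnorm_le fun α =>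
      ⟨fun p => 4 * (α.scale 16).tnorm p.1 * (α.scale 16).tnorm p.2,
        fun p => tnorm_mul_le α _ _, ?_⟩
    have h := continuous_tnorm (α.scale 16)
    rw [← nhds_prod_eq]
    exact (((continuous_const.mul (h.comp continuous_fst)).mul (h.comp continuous_snd)).tendsto'
      (0 : Tens V × Tens V) 0 (by simp))
  · refine tendsto_zero_of_tnorm_le fun α => ⟨_, fun Y => tnorm_mul_le α X Y, ?_⟩
    exact (continuous_const.mul (continuous_tnorm (α.scale 16))).tendsto' 0 0 (by simp)
  · refine tendsto_zero_of_tnorm_le fun α => ⟨_, fun Y => tnorm_mul_le α Y X, ?_⟩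
    exact ((continuous_const.mul (continuous_tnorm (α.scale 16))).mul
      continuous_const).tendsto' 0 0 (by simp)

theorem continuous_of_tnorm_le {σ : ℂ →+* ℂ} (f : Tens V →ₛₗ[σ] Tens V)
    (h : ∀ α : HermForm V, ∃ (β : HermForm V) (C : ℝ), ∀ X, α.tnorm (f X) ≤ C * β.tnorm X) :
    UniformContinuous f := by
  refine uniformContinuous_of_tendsto_zero (f := f) (tendsto_zero_of_tnorm_le fun α => ?_)
  obtain ⟨β, C, hβ⟩ := h α
  exact ⟨_, hβ, (continuous_const.mul (continuous_tnorm β)).tendsto' 0 0 (by simp)⟩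

theorem uniformContinuous_symm : UniformContinuous (symm : Tens V → Tens V) :=
  continuous_of_tnorm_le symm fun α => ⟨α, 1, fun X => by simpa using tnorm_symm_le α X⟩

instance : UniformContinuousConstSMul ℂ (Tens V) where
  uniformContinuous_const_smul c :=
    continuous_of_tnorm_le (c • (LinearMap.id : Tens V →ₗ[ℂ] Tens V)) fun α =>
      ⟨α, ‖c‖, fun X => (map_smul_eq_mul α.tnorm c X).le⟩

instance : IsUniformAddGroup (symTens V) :=
  inferInstanceAs (IsUniformAddGroup (symTens V).toAddSubgroup)

instance : UniformContinuousConstSMul ℂ (symTens V) where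
  uniformContinuous_const_smul c :=
    ((uniformContinuous_const_smul c).comp uniformContinuous_subtype_val).subtype_mk _

/-- The symmetric tensor product is continuous. -/
instance : IsTopologicalRing (symTens V) :=
  { (inferInstance : IsTopologicalAddGroup (symTens V)) with
    continuous_mul := by
      refine Continuous.subtype_mk (uniformContinuous_symm.continuous.comp ?_) _
      exact (continuous_subtype_val.comp continuous_fst).mul
        (continuous_subtype_val.comp continuous_snd) }

variable (V) in
/-- The completion of the algebra of symmetric tensors; its product is the continuous extension of
the symmetric tensor product. -/
abbrev SymCpl := UniformSpace.Completion (symTens V)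

end Continuity

/-! ### The involution on the completion -/

section CompletionStar

variable {V : Type*} [AddCommGroup V] [Module ℂ V] [TopologicalSpace V]
  [StarAddMonoid V] [StarModule ℂ V] [ContinuousStar V]

/-- The form `(v, w) ↦ conj ⟨v̄, w̄⟩_α`. -/
def HermForm.starForm (α : HermForm V) : HermForm V where
  form :=
    { toFun := fun v =>
        { toFun := fun w => conj (α.form (star v) (star w))
          map_add' := fun w w' => by simp
          map_smul' := fun c w => by simp }
      map_add' := fun v v' => by ext; simp
      map_smul' := fun c v => by ext; simp }
  conj_symm v w := by simp [α.conj_symm]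
  nonneg v := by simpa using α.nonneg (star v)
  cont := Complex.continuous_conj.comp
    (α.cont.comp (continuous_fst.star.prodMk continuous_snd.star))

theorem ext_starT (α : HermForm V) (X Y : Tens V) :
    α.ext (starT X) (starT Y) = conj (α.starForm.ext X Y) := by
  induction X using tens_induction with
  | hadd X X' hX hX' => simp only [map_add, LinearMap.add_apply, hX, hX']
  | h0 c k x =>
    induction Y using tens_induction with
    | hadd Y Y' hY hY' => simp only [map_add, hY, hY']
    | h0 d l y =>
      simp only [LinearMap.map_smulₛₗ, LinearMap.smul_apply, map_smul, smul_eq_mul, map_mul,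
        starT_simple]
      by_cases h : k = l
      · subst h
        simp only [HermForm.ext_simple, map_mul, map_natCast, map_prod, HermForm.starForm,
          LinearMap.coe_mk, AddHom.coe_mk, Complex.conj_conj]
        congr 3
        exact Fintype.prod_equiv Fin.revPerm _ _ fun m => rfl
      · simp [HermForm.ext_simple_of_ne _ h]

theorem uniformContinuous_starT : UniformContinuous (starT : Tens V → Tens V) :=
  continuous_of_tnorm_le starT fun α => ⟨α.starForm, 1, fun X => by
    rw [HermForm.tnorm_apply, ext_starT, Complex.conj_re, one_mul, HermForm.tnorm_apply]⟩

theorem uniformContinuous_star : UniformContinuous (star : symTens V → symTens V) :=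
  (uniformContinuous_starT.comp uniformContinuous_subtype_val).subtype_mk _

/-- The involution of the completion: the continuous extension of the involution of the symmetric
tensors. -/
instance : Star (SymCpl V) := ⟨UniformSpace.Completion.map star⟩

end CompletionStar

/-! ### Evaluation functionals and the Gel'fand transformation -/

section Evaluation

variable {V : Type*} [AddCommGroup V] [Module ℂ V]

/-- The derivative in direction of a linear functional:
`D_ρ (x₁ ⊗ ⋯ ⊗ x_k) = k ρ(x_k) x₁ ⊗ ⋯ ⊗ x_{k-1}`, and `D_ρ` vanishes on scalars. -/
def derivT (ρ : V →ₗ[ℂ] ℂ) : Tens V →ₗ[ℂ] Tens V :=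
  liftT fun k => match k with
    | 0 => 0
    | k + 1 => ((k + 1 : ℕ) : ℂ) • ofDeg k ∘ₗ PiTensorProduct.lift
        (MultilinearMap.uncurryRight
          ((LinearMap.smulRightₗ ρ).compMultilinearMap (PiTensorProduct.tprod ℂ)))

theorem derivT_simple_succ (ρ : V →ₗ[ℂ] ℂ) {k : ℕ} (x : Fin (k + 1) → V) :
    derivT ρ (simple x) = ((k + 1 : ℕ) : ℂ) • ρ (x (Fin.last k)) • simple (Fin.init x) := by
  rw [derivT, simple, liftT_ofDeg]
  simp [simple]

theorem derivT_simple_zero (ρ : V →ₗ[ℂ] ℂ) (x : Fin 0 → V) : derivT ρ (simple x) = 0 := by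
  rw [derivT, simple, liftT_ofDeg]
  simp

/-- The translation `τ*_ρ = ∑ t, D_ρ ^ t / t!`; on every tensor only finitely many terms of the
sum are nonzero. -/
def translT (ρ : V →ₗ[ℂ] ℂ) (X : Tens V) : Tens V :=
  ∑ᶠ t : ℕ, (t.factorial : ℂ)⁻¹ • (derivT ρ ^ t) X

/-- The scalar part `⟨X⟩₀` of a tensor. -/
def scalarPart : Tens V →ₗ[ℂ] ℂ :=
  (PiTensorProduct.isEmptyEquiv (Fin 0)).toLinearMap ∘ₗ deg 0

/-- The evaluation functional `δ_ρ = ⟨·⟩₀ ∘ τ*_ρ`. -/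
def evalT (ρ : V →ₗ[ℂ] ℂ) (X : Tens V) : ℂ := scalarPart (translT ρ X)

theorem proj_proj_of_ne {k l : ℕ} (h : k ≠ l) (X : Tens V) : proj l (proj k X) = 0 := by
  simp [proj, deg_ofDeg_of_ne h]

/-! The evaluation functional is the algebra morphism extending `ρ`, and it is continuous. -/

/-- The linear functional `x₁ ⊗ ⋯ ⊗ x_k ↦ ρ(x₁) ⋯ ρ(x_k)`. -/
def prodT (ρ : V →ₗ[ℂ] ℂ) : Tens V →ₗ[ℂ] ℂ :=
  liftT fun k => PiTensorProduct.lift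
    ((MultilinearMap.mkPiAlgebra ℂ (Fin k) ℂ).compLinearMap fun _ => ρ)

theorem prodT_simple (ρ : V →ₗ[ℂ] ℂ) {k : ℕ} (x : Fin k → V) :
    prodT ρ (simple x) = ∏ m, ρ (x m) := by
  rw [prodT, simple, liftT_ofDeg]
  simp

theorem scalarPart_simple_zero (x : Fin 0 → V) : scalarPart (simple x) = 1 := by
  simp [scalarPart, simple, deg_ofDeg]

theorem scalarPart_simple_succ {k : ℕ} (x : Fin (k + 1) → V) : scalarPart (simple x) = 0 := by
  simp [scalarPart, simple, deg_ofDeg_of_ne]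

theorem derivT_pow_simple (ρ : V →ₗ[ℂ] ℂ) (k t : ℕ) (x : Fin k → V) (h : k < t) :
    (derivT ρ ^ t) (simple x) = 0 := by
  induction t generalizing k with
  | zero => omega
  | succ t ih =>
    rw [pow_succ, Module.End.mul_apply]
    cases k with
    | zero => rw [derivT_simple_zero, map_zero]
    | succ k => rw [derivT_simple_succ, map_smul, map_smul, ih k _ (by omega)]; simp

theorem scalarPart_derivT_pow (ρ : V →ₗ[ℂ] ℂ) (t : ℕ) (X : Tens V) :
    (t.factorial : ℂ)⁻¹ * scalarPart ((derivT ρ ^ t) X) = prodT ρ (proj t X) := by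
  induction X using tens_induction with
  | hadd X Y hX hY => simp only [map_add, mul_add, hX, hY]
  | h0 c k x =>
    simp only [map_smul, smul_eq_mul]
    rw [mul_left_comm]
    congr 1
    induction t generalizing k with
    | zero =>
      cases k with
      | zero => simp [scalarPart_simple_zero, proj_simple, prodT_simple]
      | succ k => simp [scalarPart_simple_succ, proj_simple_of_ne]
    | succ t ih =>
      rw [pow_succ, Module.End.mul_apply]
      cases k with
      | zero => rw [derivT_simple_zero, map_zero, proj_simple_of_ne (by omega)]; simp
      | succ k =>
        rw [derivT_simple_succ, map_smul, map_smul, map_smul, map_smul, Nat.factorial_succ]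
        have h := ih k (Fin.init x)
        by_cases hk : t = k
        · subst hk
          rw [proj_simple, prodT_simple] at h
          rw [proj_simple, prodT_simple, Fin.prod_univ_castSucc]
          simp only [Fin.init] at h
          rw [← h]
          have h0 : ((t : ℂ) + 1) ≠ 0 := by exact_mod_cast Nat.succ_ne_zero t
          push_cast
          simp only [smul_eq_mul]
          field_simp
        · rw [proj_simple_of_ne hk, map_zero] at h
          rw [proj_simple_of_ne (by omega), map_zero]
          have h0 : (t.factorial : ℂ)⁻¹ ≠ 0 := by
            exact inv_ne_zero (by exact_mod_cast t.factorial_ne_zero)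
          rw [(mul_eq_zero.1 h).resolve_left h0]
          simp

theorem exists_derivT_pow_eq_zero (ρ : V →ₗ[ℂ] ℂ) (X : Tens V) :
    ∃ N : ℕ, ∀ t, N ≤ t → (derivT ρ ^ t) X = 0 := by
  induction X using tens_induction with
  | hadd X Y hX hY =>
    obtain ⟨N, hN⟩ := hX
    obtain ⟨M, hM⟩ := hY
    exact ⟨max N M, fun t ht => by
      rw [map_add, hN t (le_of_max_le_left ht), hM t (le_of_max_le_right ht), add_zero]⟩
  | h0 c k x =>
    exact ⟨k + 1, fun t ht => by rw [map_smul, derivT_pow_simple ρ k t x (by omega), smul_zero]⟩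

theorem evalT_eq_prodT (ρ : V →ₗ[ℂ] ℂ) (X : Tens V) : evalT ρ X = prodT ρ X := by
  obtain ⟨N, hN⟩ := exists_derivT_pow_eq_zero ρ X
  obtain ⟨s, hs⟩ := exists_eq_sum_proj X
  have h1 : ∀ t, N ≤ t → prodT ρ (proj t X) = 0 := fun t ht => by
    rw [← scalarPart_derivT_pow, hN t ht]; simp
  have h2 : translT ρ X = ∑ t ∈ Finset.range N, (t.factorial : ℂ)⁻¹ • (derivT ρ ^ t) X := by
    refine finsum_eq_sum_of_support_subset _ fun t ht => ?_
    by_contra hlt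
    simp only [Finset.coe_range, Set.mem_Iio, not_lt] at hlt
    exact ht (by simp [hN t hlt])
  rw [evalT, h2, map_sum]
  simp only [map_smul, smul_eq_mul, scalarPart_derivT_pow]
  have h3 : ∀ t ∉ s, proj t X = 0 := fun t ht => by
    rw [hs, map_sum]
    exact Finset.sum_eq_zero fun k hk => proj_proj_of_ne (by rintro rfl; exact ht hk) X
  conv_rhs => rw [hs, map_sum]
  rw [Finset.sum_subset (Finset.subset_union_left (s₂ := s)) fun t _ ht => h1 t (by simpa using ht),
    ← Finset.sum_subset (Finset.subset_union_right (s₁ := Finset.range N)) fun t _ ht => by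
      rw [h3 t ht, map_zero]]

/-- The rank one form `(v, w) ↦ conj (ρ v) * ρ w`. -/
def rankOne [TopologicalSpace V] (ρ : V →L[ℂ] ℂ) : HermForm V where
  form :=
    { toFun := fun v => conj (ρ v) • (ρ : V →ₗ[ℂ] ℂ)
      map_add' := fun v v' => by simp [add_smul]
      map_smul' := fun c v => by simp [mul_smul] }
  conj_symm v w := by simp [mul_comm]
  nonneg v := by
    simp only [LinearMap.coe_mk, AddHom.coe_mk, LinearMap.smul_apply, smul_eq_mul,
      ContinuousLinearMap.coe_coe, Complex.conj_mul']
    norm_cast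
    positivity
  cont := (Complex.continuous_conj.comp (ρ.continuous.comp continuous_fst)).mul
    (ρ.continuous.comp continuous_snd)

theorem rankOne_ext_proj [TopologicalSpace V] (ρ : V →L[ℂ] ℂ) (k : ℕ) (X Y : Tens V) :
    (rankOne ρ).ext (proj k X) (proj k Y) =
      k.factorial * (conj (prodT (ρ : V →ₗ[ℂ] ℂ) (proj k X)) *
        prodT (ρ : V →ₗ[ℂ] ℂ) (proj k Y)) := by
  induction X using tens_induction with
  | hadd X X' hX hX' => simp only [map_add, LinearMap.add_apply, hX, hX', add_mul, mul_add]
  | h0 c l x =>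
    induction Y using tens_induction with
    | hadd Y Y' hY hY' => simp only [map_add, hY, hY', mul_add]
    | h0 d m y =>
      by_cases h : k = l
      swap
      · simp [proj_simple_of_ne h]
      by_cases h' : k = m
      swap
      · simp [proj_simple_of_ne h']
      subst h h'
      simp only [LinearMap.map_smulₛₗ, LinearMap.smul_apply, map_smul, smul_eq_mul, map_mul,
        proj_simple, HermForm.ext_simple, prodT_simple, rankOne, LinearMap.coe_mk, AddHom.coe_mk,
        Finset.prod_mul_distrib, map_prod, ContinuousLinearMap.coe_coe]
      ring

theorem norm_prodT_le [TopologicalSpace V] (ρ : V →L[ℂ] ℂ) (X : Tens V) :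
    ‖prodT (ρ : V →ₗ[ℂ] ℂ) X‖ ≤ 2 * ((rankOne ρ).scale 16).tnorm X := by
  have h (k : ℕ) : ‖prodT (ρ : V →ₗ[ℂ] ℂ) (proj k X)‖ ≤ 2 ^ k * (rankOne ρ).tnorm (proj k X) := by
    have h1 : (rankOne ρ).tnorm (proj k X) ^ 2 =
        k.factorial * ‖prodT (ρ : V →ₗ[ℂ] ℂ) (proj k X)‖ ^ 2 := by
      rw [tnorm_sq, rankOne_ext_proj, Complex.conj_mul']
      norm_cast
    have h2 : (1 : ℝ) ≤ k.factorial := by exact_mod_cast k.factorial_pos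
    have h3 : ‖prodT (ρ : V →ₗ[ℂ] ℂ) (proj k X)‖ ≤ (rankOne ρ).tnorm (proj k X) := by
      refine (sq_le_sq₀ (norm_nonneg _) (apply_nonneg _ _)).1 ?_
      rw [h1]
      exact le_mul_of_one_le_left (sq_nonneg _) h2
    exact h3.trans (le_mul_of_one_le_left (apply_nonneg _ _) (one_le_pow₀ (by norm_num)))
  obtain ⟨s, hs⟩ := exists_eq_sum_proj X
  calc ‖prodT (ρ : V →ₗ[ℂ] ℂ) X‖ = ‖∑ k ∈ s, prodT (ρ : V →ₗ[ℂ] ℂ) (proj k X)‖ := by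
        rw [← map_sum, ← hs]
    _ ≤ ∑ k ∈ s, 2 ^ k * (rankOne ρ).tnorm (proj k X) :=
        (norm_sum_le _ _).trans (Finset.sum_le_sum fun k _ => h k)
    _ ≤ _ := sum_proj_le _ s X

theorem uniformContinuous_evalT [TopologicalSpace V] (ρ : V →L[ℂ] ℂ) :
    UniformContinuous (evalT (ρ : V →ₗ[ℂ] ℂ)) := by
  have : evalT (ρ : V →ₗ[ℂ] ℂ) = prodT (ρ : V →ₗ[ℂ] ℂ) := funext (evalT_eq_prodT _)
  rw [this]
  refine uniformContinuous_of_tendsto_zero (f := prodT (ρ : V →ₗ[ℂ] ℂ)) ?_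
  exact squeeze_zero_norm (norm_prodT_le ρ)
    ((continuous_const.mul (continuous_tnorm _)).tendsto' 0 0 (by simp))

end Evaluation



section Gelfand

variable (V : Type*) [AddCommGroup V] [Module ℂ V] [TopologicalSpace V]
  [StarAddMonoid V] [StarModule ℂ V]

/-- The real vector space `V'_h` of Hermitian elements of the topological dual `V'`. -/
def HermDual : Submodule ℝ (V →L[ℂ] ℂ) where
  carrier := {ρ | ∀ v, conj (ρ v) = ρ (star v)}
  add_mem' {ρ σ} h h' v := by simp [h v, h' v]
  zero_mem' v := by simp
  smul_mem' c ρ h v := by simp [h v]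

variable {V}

/-- The Gel'fand transform `X̂(ρ) = δ_ρ(X)`, where `δ_ρ` is extended continuously from the symmetric
tensors to the completion. -/
def gelfand (X : SymCpl V) (ρ : HermDual V) : ℂ :=
  UniformSpace.Completion.extension (fun Y : symTens V => evalT (ρ : V →L[ℂ] ℂ) (Y : Tens V)) X

/-! ### Smooth functions and functions analytic of Hilbert-Schmidt type on `V'_h` -/

/-- The forms in `I_{V,h}`: those compatible with the involution. -/
def HermForm.Compatible (α : HermForm V) : Prop :=
  ∀ v w, conj (α.form v w) = α.form (star v) (star w)

/-- Bounded subsets of `V'_h` for the equicontinuous bornology. -/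
def BoundedSet (B : Set (HermDual V)) : Prop :=
  ∃ α : HermForm V, α.Compatible ∧ ∀ ρ ∈ B, ∀ v, ‖(ρ : V →L[ℂ] ℂ) v‖ ≤ α.nrm v

/-- The iterated directional derivative `D̂_{ρ₁} ⋯ D̂_{ρ_k} f`, where
`(D̂_ρ f)(σ)` is the derivative of `t ↦ f (σ + t ρ)` at `t = 0`. -/
def iterDeriv : (k : ℕ) → (Fin k → HermDual V) → (HermDual V → ℂ) → HermDual V → ℂ
  | 0, _, f => f
  | k + 1, ρ, f => fun σ => lineDeriv ℝ (iterDeriv k (Fin.tail ρ) f) σ (ρ 0)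

/-- Smooth functions on `V'_h`: all iterated directional derivatives exist, and at each point they
form a bounded symmetric multilinear form in the directions. -/
def IsSmooth (f : HermDual V → ℂ) : Prop :=
  (∀ (k : ℕ) (ρ : Fin k → HermDual V) (σ ρ₀ : HermDual V),
    LineDifferentiableAt ℝ (iterDeriv k ρ f) σ ρ₀) ∧
  ∀ (k : ℕ) (σ : HermDual V), ∃ M : MultilinearMap ℝ (fun _ : Fin k => HermDual V) ℂ,
    (∀ ρ, M ρ = iterDeriv k ρ f σ) ∧
    (∀ (ρ : Fin k → HermDual V) (τ : Equiv.Perm (Fin k)), M (ρ ∘ τ) = M ρ) ∧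
    ∀ B : Set (HermDual V), BoundedSet B → ∃ C : ℝ, ∀ ρ, (∀ i, ρ i ∈ B) → ‖M ρ‖ ≤ C

end Gelfand

/-- The real vector space `V_h` of Hermitian elements of `V`, equipped with the inner product of
`α` (which is real there if `α` is compatible with the involution). -/
def HermSpace {V : Type*} [AddCommGroup V] [Module ℂ V] [TopologicalSpace V]
    [StarAddMonoid V] (_α : HermForm V) : Type _ := selfAdjoint V

section HermSpace

variable {V : Type*} [AddCommGroup V] [Module ℂ V] [TopologicalSpace V]
  [StarAddMonoid V] [StarModule ℂ V] (α : HermForm V)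

instance : AddCommGroup (HermSpace α) := inferInstanceAs (AddCommGroup (selfAdjoint V))

instance : Module ℝ (HermSpace α) := inferInstanceAs (Module ℝ (selfAdjoint V))

/-- The inclusion of `V_h` into `V`. -/
def HermSpace.val : HermSpace α →ₗ[ℝ] V := (selfAdjoint.submodule ℝ V).subtype

/-- An element of `V_h` regarded as an element of the inner product space of `α`. -/
def HermSpace.mk : selfAdjoint V →ₗ[ℝ] HermSpace α := LinearMap.id

abbrev HermSpace.core : PreInnerProductSpace.Core ℝ (HermSpace α) where
  inner v w := (α.form (HermSpace.val α v) (HermSpace.val α w)).re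
  conj_inner_symm v w := by
    rw [← α.conj_symm]; simp
  re_inner_nonneg v := α.nonneg _
  add_left u v w := by simp
  smul_left v w r := by
    rw [map_smul, ← Complex.coe_smul r, LinearMap.map_smulₛₗ]
    simp

instance : SeminormedAddCommGroup (HermSpace α) :=
  @InnerProductSpace.Core.toSeminormedAddCommGroup ℝ _ _ _ _ (HermSpace.core α)

instance : InnerProductSpace ℝ (HermSpace α) := InnerProductSpace.ofCore (HermSpace.core α)

/-- The real Hilbert space obtained from `V_h` with the inner product of `α` by dividing out the
kernel of the seminorm and completing. -/
abbrev HermCpl := UniformSpace.Completion (HermSpace α)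

open scoped ComplexStarModule

theorem HermSpace.norm_def (x : HermSpace α) : ‖x‖ = α.nrm (HermSpace.val α x) := rfl

variable [IsTopologicalAddGroup V]

theorem HermSpace.continuous_of_coe {f : V →ₗ[ℝ] selfAdjoint V}
    (hf : Continuous fun w => (f w : V)) : Continuous fun w => HermSpace.mk α (f w) := by
  refine continuous_of_continuousAt_zero (HermSpace.mk α ∘ₗ f) ?_
  rw [ContinuousAt, map_zero, tendsto_zero_iff_norm_tendsto_zero]
  have : Continuous fun w => α.nrm (f w) :=
    Real.continuous_sqrt.comp (Complex.continuous_re.comp (α.cont.comp (hf.prodMk hf)))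
  exact this.tendsto' 0 0 (by simp [HermForm.nrm])

variable [ContinuousStar V] [ContinuousSMul ℂ V]

theorem HermSpace.continuous_realPart : Continuous fun w : V => HermSpace.mk α (ℜ w) := by
  refine HermSpace.continuous_of_coe α ?_
  simp only [realPart_apply_coe, ← Complex.coe_smul]
  exact (continuous_id.add continuous_star).const_smul _

theorem HermSpace.continuous_imaginaryPart : Continuous fun w : V => HermSpace.mk α (ℑ w) := by
  refine HermSpace.continuous_of_coe α ?_
  simp only [imaginaryPart_apply_coe, ← Complex.coe_smul]
  exact ((continuous_id.sub continuous_star).const_smul _).const_smul _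

/-- The functional `v^♭ = ⟨v, ·⟩_α` on `V`, for `v` in the Hilbert space completion of `V_h`. It is
the complex linear extension of the functional `w ↦ ⟨v, w⟩_α` on `V_h`. -/
def flat (v : HermCpl α) : HermDual V where
  val :=
    { toFun := fun w => ((inner ℝ v ((HermSpace.mk α (ℜ w) : HermSpace α) : HermCpl α) : ℝ) : ℂ) +
        Complex.I * ((inner ℝ v ((HermSpace.mk α (ℑ w) : HermSpace α) : HermCpl α) : ℝ) : ℂ)
      map_add' := fun w w' => by
        simp only [map_add, UniformSpace.Completion.coe_add, inner_add_right, Complex.ofReal_add]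
        ring
      map_smul' := fun c w => by
        simp only [realPart_smul, imaginaryPart_smul, map_add, map_sub, map_smul,
          UniformSpace.Completion.coe_add, UniformSpace.Completion.coe_sub,
          UniformSpace.Completion.coe_smul, inner_add_right, inner_sub_right, inner_smul_right,
          RingHom.id_apply, smul_eq_mul]
        apply Complex.ext <;> simp
      cont := by
        have h₁ := (UniformSpace.Completion.continuous_coe (HermSpace α)).comp
          (HermSpace.continuous_realPart α)
        have h₂ := (UniformSpace.Completion.continuous_coe (HermSpace α)).comp
          (HermSpace.continuous_imaginaryPart α)
        exact (Complex.continuous_ofReal.comp (continuous_const.inner h₁)).add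
          (continuous_const.mul (Complex.continuous_ofReal.comp (continuous_const.inner h₂))) }
  property := fun w => by
    have h₁ : ℜ (star w) = ℜ w := Subtype.ext <| by simp [realPart_apply_coe, add_comm]
    have h₂ : ℑ (star w) = -ℑ w := Subtype.ext <| by
      simp only [imaginaryPart_apply_coe, star_star, NegMemClass.coe_neg]
      rw [← smul_neg, ← smul_neg, neg_sub]
    change conj (_ + Complex.I * _) = _ + Complex.I * _
    rw [h₁, h₂, map_neg, UniformSpace.Completion.coe_neg, inner_neg_right]
    simp

/-- Functions on `V'_h` that are analytic of Hilbert-Schmidt type: smooth functions such that for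
all `σ, σ'` and all compatible forms `α` the sum of the weighted squares of the derivatives in the
directions of a Hilbert basis is bounded on the line segment from `σ` to `σ'`. -/
def IsAnalyticHS (f : HermDual V → ℂ) : Prop :=
  IsSmooth f ∧ ∀ (σ σ' : HermDual V) (α : HermForm V), α.Compatible →
    ∃ (C : ℝ≥0) (I : Set (HermCpl α)) (e : HilbertBasis I ℝ (HermCpl α)),
      ∀ ξ ∈ segment ℝ σ σ',
        ∑' k : ℕ, ((k.factorial : ℝ≥0∞)⁻¹ *
          ∑' i : Fin k → I, ‖iterDeriv k (fun j => flat α (e (i j))) f ξ‖ₑ ^ 2) ≤ C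

end HermSpace

end HilbertTensor

end

open scoped TensorProduct ComplexConjugate ENNReal NNReal

noncomputable section

namespace HilbertTensor

open scoped ComplexOrder ComplexStarModule

/-! ### Comparison of forms, and seminorm estimates for derivatives and translations. -/

section Bounds

variable {V : Type*} [AddCommGroup V] [Module ℂ V]

/-! The evaluation at `ρ` is the multiplicative extension `prodT ρ` of `ρ` to tensors, so the
Gel'fand transformation is a unital *-homomorphism: this is checked on algebraic tensors and
extended by density. What remains is to identify its kernel and its range.

The link with Hilbert-Schmidt sums is Taylor's formula. On symmetric tensors the derivations
`derivT` commute with each other and with translations. Hence the derivative of `gelfand X` at `ξ`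
in the directions `v_i^♭` is the inner product, in the Fock space of `α`, of `v₁ ⊗ ⋯ ⊗ v_k` with the
tensor `X` translated by `ξ` (`evalT_iterT`, `inner_fockTensor`). The tensors built from a Hilbert
basis, divided by `√(k!)`, are orthonormal. Bessel's inequality together with `tnorm_translT_le`,
which is uniform in all `ξ` dominated by one form, shows that transforms are analytic of
Hilbert-Schmidt type (`isAnalyticHS_gelfand`).

Injectivity: the derivatives at the origin are the Fock coefficients of `X` for every compatible
form, and the compatible forms define the topology (`compatible_add_starForm`).

Surjectivity: for `f` analytic of Hilbert-Schmidt type and each compatible `α`, Riesz-Fischer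
produces a Fock vector whose coefficients are the derivatives of `f` at the origin
(`exists_inner_fockTensor_eq`). These vectors are symmetric and compatible under restriction, so
they come from one element `X` of the completion (`exists_symFock_eq`). Then `gelfand X` and `f`
have the same derivatives at the origin. They coincide because the Hilbert-Schmidt bound along the
segment from `0` to `ρ` forces growth at most `K √(k!)` of the `k`-th derivative, and the Taylor
remainder tends to zero (`IsAnalyticHS.ext`). The algebra structure of the function space is then
transported from the completion. -/

theorem posSemidef_prod_sub_prod {ι κ : Type*} (A B : κ → Matrix ι ι ℂ) (s : Finset κ)
    (hA : ∀ m, (A m).PosSemidef) (hAB : ∀ m, (B m - A m).PosSemidef) :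
    (Matrix.of fun i j => ∏ m ∈ s, B m i j - ∏ m ∈ s, A m i j).PosSemidef ∧
      (Matrix.of fun i j => ∏ m ∈ s, A m i j).PosSemidef := by
  classical
  induction s using Finset.induction_on with
  | empty =>
    constructor
    · convert! (Matrix.PosSemidef.zero : (0 : Matrix ι ι ℂ).PosSemidef) using 1
      ext i j; simp
    · refine ⟨by ext; simp, fun c => ?_⟩
      simp only [Finset.prod_empty, Matrix.of_apply, mul_one, Finsupp.sum, ← Finset.mul_sum,
        ← Finset.sum_mul]
      rw [← star_sum]
      exact star_mul_self_nonneg _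
  | insert a s ha ih =>
    constructor
    -- Telescoping `B P_B - A P_A = B (P_B - P_A) + (B - A) P_A` with `B = A + (B - A)`; each term
    -- is positive by Schur's product theorem. The last term is why positivity of `∏ A` is carried
    -- along in the induction.
    · convert! (((hA a).add (hAB a)).hadamard ih.1).add ((hAB a).hadamard ih.2) using 1
      ext i j
      simp only [Finset.prod_insert ha, Matrix.of_apply, Matrix.add_apply, Matrix.sub_apply,
        Matrix.hadamard_apply]
      ring
    · convert! (hA a).hadamard ih.2 using 1
      ext i j
      simp [Finset.prod_insert ha]

theorem exists_proj_eq_sum_simple (k : ℕ) (X : Tens V) :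
    ∃ c : (Fin k → V) →₀ ℂ, proj k X = c.sum fun x cx => cx • simple x := by
  have h : deg k X ∈ Submodule.span ℂ
      (Set.range (PiTensorProduct.tprod ℂ (s := fun _ : Fin k => V))) := by
    rw [PiTensorProduct.span_tprod_eq_top]; trivial
  obtain ⟨c, hc⟩ := Finsupp.mem_span_range_iff_exists_finsupp.1 h
  refine ⟨c, ?_⟩
  simp only [proj, LinearMap.comp_apply, ← hc, Finsupp.sum, map_sum, map_smul, simple]

theorem derivT_proj_zero (ρ : V →ₗ[ℂ] ℂ) (X : Tens V) : derivT ρ (proj 0 X) = 0 := by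
  induction X using tens_induction with
  | hadd X Y hX hY => simp only [map_add, hX, hY, add_zero]
  | h0 c k x =>
    cases k with
    | zero => rw [map_smul, map_smul, proj_simple, derivT_simple_zero, smul_zero]
    | succ k => rw [map_smul, map_smul, proj_simple_of_ne (by omega), map_zero, smul_zero]

theorem derivT_proj_succ (ρ : V →ₗ[ℂ] ℂ) (k : ℕ) (X : Tens V) :
    derivT ρ (proj (k + 1) X) = proj k (derivT ρ X) := by
  induction X using tens_induction with
  | hadd X Y hX hY => simp only [map_add, hX, hY]
  | h0 c l x =>
    simp only [map_smul]
    congr 1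
    cases l with
    | zero => rw [proj_simple_of_ne (by omega), derivT_simple_zero, map_zero, map_zero]
    | succ l =>
      rw [derivT_simple_succ, map_smul, map_smul]
      by_cases h : k = l
      · subst h; rw [proj_simple, proj_simple, derivT_simple_succ]
      · rw [proj_simple_of_ne h, proj_simple_of_ne (by omega)]; simp

/-- Every larger cut-off is allowed too, so that two tensors can share one. -/
theorem translT_eq_sum (ρ : V →ₗ[ℂ] ℂ) (X : Tens V) : ∃ N : ℕ, ∀ M, N ≤ M →
    translT ρ X = ∑ t ∈ Finset.range M, (t.factorial : ℂ)⁻¹ • (derivT ρ ^ t) X := by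
  obtain ⟨N, hN⟩ := exists_derivT_pow_eq_zero ρ X
  refine ⟨N, fun M hM => finsum_eq_sum_of_support_subset _ fun t ht => ?_⟩
  by_contra hlt
  simp only [Finset.coe_range, Set.mem_Iio, not_lt] at hlt
  exact ht (by simp [hN t (hM.trans hlt)])

variable [TopologicalSpace V]

theorem HermForm.nrm_sq (α : HermForm V) (v : V) : α.nrm v ^ 2 = (α.form v v).re :=
  Real.sq_sqrt (α.nonneg v)

theorem HermForm.nrm_nonneg (α : HermForm V) (v : V) : 0 ≤ α.nrm v := Real.sqrt_nonneg _

/-- The sum of two forms. -/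
def HermForm.add (α β : HermForm V) : HermForm V where
  form := α.form + β.form
  conj_symm v w := by simp [α.conj_symm, β.conj_symm]
  nonneg v := by simpa using add_nonneg (α.nonneg v) (β.nonneg v)
  cont := α.cont.add β.cont

/-- The difference of two forms, one of which dominates the other. -/
def HermForm.sub (β α : HermForm V) (h : ∀ v, α.nrm v ≤ β.nrm v) : HermForm V where
  form := β.form - α.form
  conj_symm v w := by simp [α.conj_symm, β.conj_symm]
  nonneg v := by
    have := pow_le_pow_left₀ (α.nrm_nonneg v) (h v) 2
    rw [α.nrm_sq, β.nrm_sq] at this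
    simpa using this
  cont := β.cont.sub α.cont

theorem posSemidef_gram_sub (α β : HermForm V) (h : ∀ v, α.nrm v ≤ β.nrm v) {ι : Type*}
    (x : ι → V) :
    ((Matrix.of fun i j => β.form (x i) (x j)) -
      (Matrix.of fun i j => α.form (x i) (x j))).PosSemidef := by
  convert! posSemidef_gram (β.sub α h) x using 1

theorem HermForm.ext_sum_simple (α : HermForm V) {ι : Type*} {k : ℕ} (c : ι →₀ ℂ)
    (x : ι → Fin k → V) :
    α.ext (c.sum fun i ci => ci • simple (x i)) (c.sum fun i ci => ci • simple (x i)) =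
      k.factorial * c.sum fun i ci => c.sum fun j cj =>
        star ci * (Matrix.of fun i j => ∏ m, α.form (x i m) (x j m)) i j * cj := by
  simp only [Finsupp.sum, map_sum, LinearMap.sum_apply, LinearMap.map_smulₛₗ, map_smul,
    LinearMap.smul_apply, smul_eq_mul, Matrix.of_apply, HermForm.ext_simple, Finset.mul_sum]
  rw [Finset.sum_comm]
  refine Finset.sum_congr rfl fun i _ => Finset.sum_congr rfl fun j _ => ?_
  simp
  ring

theorem HermForm.ext_self_eq_sum (α : HermForm V) {X : Tens V} {s : Finset ℕ}
    (hs : X = ∑ k ∈ s, proj k X) : α.ext X X = ∑ k ∈ s, α.ext (proj k X) (proj k X) := by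
  conv_lhs => rw [hs, map_sum]
  refine Finset.sum_congr rfl fun k _ => ?_
  rw [ext_proj, ← hs]

/-- Degrees are orthogonal, and in degree `k` the difference of the squared seminorms is `k!` times
the quadratic form of `∏ β - ∏ α`, which is positive by the Schur product argument. -/
theorem tnorm_mono {α β : HermForm V} (h : ∀ v, α.nrm v ≤ β.nrm v) (X : Tens V) :
    α.tnorm X ≤ β.tnorm X := by
  obtain ⟨s, hs⟩ := exists_eq_sum_proj X
  rw [HermForm.tnorm_apply, HermForm.tnorm_apply]
  refine Real.sqrt_le_sqrt ?_
  rw [α.ext_self_eq_sum hs, β.ext_self_eq_sum hs, Complex.re_sum, Complex.re_sum]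
  refine Finset.sum_le_sum fun k _ => ?_
  obtain ⟨c, hc⟩ := exists_proj_eq_sum_simple k X
  have hp := ((posSemidef_prod_sub_prod
    (fun m => Matrix.of fun x y : Fin k → V => α.form (x m) (y m))
    (fun m => Matrix.of fun x y : Fin k → V => β.form (x m) (y m)) Finset.univ
    (fun m => posSemidef_gram α _) (fun m => posSemidef_gram_sub α β h _)).1).2 c
  rw [hc, α.ext_sum_simple c fun x => x, β.ext_sum_simple c fun x => x, ← sub_nonneg,
    ← Complex.sub_re, ← mul_sub, ← Complex.ofReal_natCast, Complex.re_ofReal_mul]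
  refine mul_nonneg (Nat.cast_nonneg _) ?_
  refine (Complex.le_def.1 hp).1.trans (le_of_eq (congrArg Complex.re ?_))
  simp only [Finsupp.sum, Matrix.of_apply, mul_sub, sub_mul, Finset.sum_sub_distrib]

theorem HermForm.nrm_scale (c : ℝ≥0) (α : HermForm V) (v : V) :
    (α.scale (c ^ 2)).nrm v = c * α.nrm v := by
  simp only [HermForm.nrm, HermForm.scale, LinearMap.smul_apply, smul_eq_mul,
    Complex.re_ofReal_mul]
  rw [Real.sqrt_mul (by positivity)]
  congr 1
  push_cast
  exact Real.sqrt_sq c.2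

theorem nrm_rankOne (ρ : V →L[ℂ] ℂ) (v : V) : (rankOne ρ).nrm v = ‖ρ v‖ := by
  simp only [HermForm.nrm, rankOne, LinearMap.coe_mk, AddHom.coe_mk, LinearMap.smul_apply,
    smul_eq_mul, ContinuousLinearMap.coe_coe, Complex.conj_mul']
  rw [← Complex.ofReal_pow, Complex.ofReal_re, Real.sqrt_sq (norm_nonneg _)]

/-- The contraction replaces the Gram factor `α` of the last slot by the rank one factor of `ρ`,
which is dominated by `c² α`. The gap is therefore a Hadamard product of two positive matrices. -/
theorem tnorm_derivT_proj_succ_le {α : HermForm V} {ρ : V →L[ℂ] ℂ} {c : ℝ≥0}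
    (h : ∀ v, ‖ρ v‖ ≤ c * α.nrm v) (k : ℕ) (X : Tens V) :
    α.tnorm (derivT (ρ : V →ₗ[ℂ] ℂ) (proj (k + 1) X)) ≤
      (k + 1) * c * α.tnorm (proj (k + 1) X) := by
  obtain ⟨d, hd⟩ := exists_proj_eq_sum_simple (k + 1) X
  have hD : derivT (ρ : V →ₗ[ℂ] ℂ) (proj (k + 1) X) =
      ((k + 1 : ℕ) : ℂ) • d.sum fun x dx => (dx * ρ (x (Fin.last k))) • simple (Fin.init x) := by
    rw [hd]
    simp only [Finsupp.sum, map_sum, map_smul, derivT_simple_succ, Finset.smul_sum]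
    refine Finset.sum_congr rfl fun x _ => ?_
    simp only [smul_smul, ContinuousLinearMap.coe_coe]
    ring_nf
  have hp := ((posSemidef_gram_prod α (fun x : Fin (k + 1) → V => Fin.init x)
    Finset.univ).hadamard (posSemidef_gram_sub (rankOne ρ) (α.scale (c ^ 2))
      (fun v => by rw [nrm_rankOne, α.nrm_scale]; exact h v)
      (fun x : Fin (k + 1) → V => x (Fin.last k)))).2 d
  -- The prefactors agree: `(k + 1) (k + 1)! = (k + 1)² k!`, where the square comes from the factor
  -- `k + 1` in `derivT`.
  have key : ((k + 1 : ℕ) : ℂ) * c ^ 2 * α.ext (proj (k + 1) X) (proj (k + 1) X) -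
      α.ext (derivT (ρ : V →ₗ[ℂ] ℂ) (proj (k + 1) X)) (derivT (ρ : V →ₗ[ℂ] ℂ) (proj (k + 1) X)) =
      (((k + 1 : ℕ) : ℝ) ^ 2 * k.factorial : ℝ) * (d.sum fun i ci => d.sum fun j cj => star ci *
        (Matrix.hadamard (Matrix.of fun i j : Fin (k + 1) → V =>
            ∏ m, α.form (Fin.init i m) (Fin.init j m))
          ((Matrix.of fun i j : Fin (k + 1) → V =>
              (α.scale (c ^ 2)).form (i (Fin.last k)) (j (Fin.last k))) -
            (Matrix.of fun i j : Fin (k + 1) → V =>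
              (rankOne ρ).form (i (Fin.last k)) (j (Fin.last k))))) i j * cj) := by
    rw [hD, hd, α.ext_sum_simple d fun x => x, Nat.factorial_succ]
    simp only [Finsupp.sum, map_sum, LinearMap.sum_apply, LinearMap.map_smulₛₗ, map_smul,
      LinearMap.smul_apply, smul_eq_mul, Matrix.of_apply, HermForm.ext_simple, Finset.mul_sum,
      Matrix.hadamard_apply, Matrix.sub_apply, HermForm.scale, rankOne, Fin.prod_univ_castSucc,
      Fin.init]
    conv_lhs => arg 2; rw [Finset.sum_comm]
    rw [← Finset.sum_sub_distrib]
    refine Finset.sum_congr rfl fun i _ => ?_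
    rw [← Finset.sum_sub_distrib]
    refine Finset.sum_congr rfl fun j _ => ?_
    simp
    ring
  have h2 := (Complex.le_def.1 hp).1
  have h3 := congrArg Complex.re key
  rw [Complex.re_ofReal_mul, ext_self, ext_self] at h3
  norm_cast at h3
  have h4 : α.tnorm (derivT (ρ : V →ₗ[ℂ] ℂ) (proj (k + 1) X)) ^ 2 ≤
      ((k + 1 : ℕ) : ℝ) * c ^ 2 * α.tnorm (proj (k + 1) X) ^ 2 := by
    have h5 := mul_nonneg (Nat.cast_nonneg ((k + 1) ^ 2 * k.factorial)) h2
    rw [← h3] at h5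
    push_cast at h5 ⊢
    linarith
  refine (sq_le_sq₀ (apply_nonneg _ _) (by positivity)).1 (h4.trans ?_)
  -- The proof so far gives the constant `√(k + 1) c`; it is relaxed to `(k + 1) c`, so that
  -- iteration produces falling factorials.
  have : (1 : ℝ) ≤ k + 1 := by linarith [(Nat.cast_nonneg k : (0 : ℝ) ≤ k)]
  calc _ = (k + 1 : ℝ) * (c * α.tnorm (proj (k + 1) X)) ^ 2 := by push_cast; ring
    _ ≤ (k + 1 : ℝ) ^ 2 * (c * α.tnorm (proj (k + 1) X)) ^ 2 := by
      gcongr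
      nlinarith
    _ = _ := by ring

theorem tnorm_derivT_proj_le {α : HermForm V} {ρ : V →L[ℂ] ℂ} {c : ℝ≥0}
    (h : ∀ v, ‖ρ v‖ ≤ c * α.nrm v) (k : ℕ) (X : Tens V) :
    α.tnorm (derivT (ρ : V →ₗ[ℂ] ℂ) (proj k X)) ≤ k * c * α.tnorm (proj k X) := by
  cases k with
  | zero => rw [derivT_proj_zero]; simp
  | succ k => exact_mod_cast tnorm_derivT_proj_succ_le h k X

/-- The degree-dependent factor `k ≤ 2 ^ k` is absorbed by passing to `α.scale 16`, through
`sum_proj_le`. -/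
theorem tnorm_derivT_le {α : HermForm V} {ρ : V →L[ℂ] ℂ} {c : ℝ≥0}
    (h : ∀ v, ‖ρ v‖ ≤ c * α.nrm v) (X : Tens V) :
    α.tnorm (derivT (ρ : V →ₗ[ℂ] ℂ) X) ≤ 2 * c * (α.scale 16).tnorm X := by
  obtain ⟨s, hs⟩ := exists_eq_sum_proj X
  calc α.tnorm (derivT (ρ : V →ₗ[ℂ] ℂ) X)
      = α.tnorm (∑ k ∈ s, derivT (ρ : V →ₗ[ℂ] ℂ) (proj k X)) := by rw [← map_sum, ← hs]
    _ ≤ ∑ k ∈ s, c * (2 ^ k * α.tnorm (proj k X)) := by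
      refine (tnorm_sum_le _ _ _).trans (Finset.sum_le_sum fun k _ => ?_)
      refine (tnorm_derivT_proj_le h k X).trans ?_
      have : (k : ℝ) ≤ 2 ^ k := by exact_mod_cast (Nat.lt_two_pow_self (n := k)).le
      calc _ = k * (c * α.tnorm (proj k X)) := by ring
        _ ≤ 2 ^ k * (c * α.tnorm (proj k X)) := by gcongr
        _ = _ := by ring
    _ ≤ c * (2 * (α.scale 16).tnorm X) := by
      rw [← Finset.mul_sum]
      exact mul_le_mul_of_nonneg_left (sum_proj_le α s X) c.2
    _ = _ := by ring

theorem tnorm_derivT_pow_proj_le {α : HermForm V} {ρ : V →L[ℂ] ℂ}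
    (h : ∀ v, ‖ρ v‖ ≤ α.nrm v) (n k : ℕ) (X : Tens V) :
    α.tnorm ((derivT (ρ : V →ₗ[ℂ] ℂ) ^ n) (proj k X)) ≤
      k.descFactorial n * α.tnorm (proj k X) := by
  have h' : ∀ v, ‖ρ v‖ ≤ (1 : ℝ≥0) * α.nrm v := fun v => by simpa using h v
  induction n generalizing k X with
  | zero => simp
  | succ n ih =>
    rw [pow_succ, Module.End.mul_apply]
    cases k with
    | zero => rw [derivT_proj_zero]; simp
    | succ k =>
      rw [derivT_proj_succ]
      refine (ih k _).trans ?_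
      rw [← derivT_proj_succ, Nat.succ_descFactorial_succ]
      refine (mul_le_mul_of_nonneg_left (tnorm_derivT_proj_succ_le h' k X)
        (Nat.cast_nonneg _)).trans (le_of_eq ?_)
      push_cast
      ring

/-- After division by `t!` the falling factorials become binomial coefficients. Their sum over `t`
is at most `2 ^ k`, exactly the weight that `sum_proj_le` absorbs. The bound depends on `ρ` only
through its domination by `α`. -/
theorem tnorm_translT_le {α : HermForm V} {ρ : V →L[ℂ] ℂ} (h : ∀ v, ‖ρ v‖ ≤ α.nrm v)
    (X : Tens V) : α.tnorm (translT (ρ : V →ₗ[ℂ] ℂ) X) ≤ 2 * (α.scale 16).tnorm X := by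
  obtain ⟨N, hN⟩ := translT_eq_sum (ρ : V →ₗ[ℂ] ℂ) X
  obtain ⟨s, hs⟩ := exists_eq_sum_proj X
  rw [hN N le_rfl]
  have h1 (t : ℕ) : α.tnorm ((t.factorial : ℂ)⁻¹ • (derivT (ρ : V →ₗ[ℂ] ℂ) ^ t) X) ≤
      ∑ k ∈ s, k.choose t * α.tnorm (proj k X) := by
    conv_lhs => rw [hs, map_sum, Finset.smul_sum]
    refine (tnorm_sum_le _ _ _).trans (Finset.sum_le_sum fun k _ => ?_)
    rw [map_smul_eq_mul, norm_inv, Complex.norm_natCast]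
    have h0 : (0 : ℝ) < t.factorial := by exact_mod_cast t.factorial_pos
    rw [inv_mul_le_iff₀ h0, ← mul_assoc]
    refine (tnorm_derivT_pow_proj_le h t k X).trans (le_of_eq ?_)
    rw [Nat.descFactorial_eq_factorial_mul_choose]
    push_cast
    ring
  calc _ ≤ ∑ t ∈ Finset.range N, ∑ k ∈ s, k.choose t * α.tnorm (proj k X) :=
        (tnorm_sum_le _ _ _).trans (Finset.sum_le_sum fun t _ => h1 t)
    _ = ∑ k ∈ s, (∑ t ∈ Finset.range N, (k.choose t : ℝ)) * α.tnorm (proj k X) := by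
        rw [Finset.sum_comm]; simp only [Finset.sum_mul]
    _ ≤ ∑ k ∈ s, 2 ^ k * α.tnorm (proj k X) := by
        refine Finset.sum_le_sum fun k _ => mul_le_mul_of_nonneg_right ?_ (apply_nonneg _ _)
        have : ∑ t ∈ Finset.range N, k.choose t ≤ 2 ^ k := by
          rw [← Nat.sum_range_choose]
          refine Finset.sum_le_sum_of_ne_zero fun t _ ht => ?_
          by_contra hh
          exact ht (Nat.choose_eq_zero_of_lt (by simpa using hh))
        exact_mod_cast this
    _ ≤ _ := sum_proj_le α s X

end Bounds

/-! ### Polarization, and the calculus of derivations on symmetric tensors. -/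

section SymmetricTensors

variable {V : Type*} [AddCommGroup V] [Module ℂ V]

/-- The power `v ⊗ ⋯ ⊗ v`. -/
def vpow (k : ℕ) (v : V) : Tens V := simple fun _ : Fin k => v

theorem simple_sum {k : ℕ} {ι : Type*} (s : Finset ι) (x : ι → V) :
    simple (fun _ : Fin k => ∑ i ∈ s, x i) =
      ∑ r ∈ Fintype.piFinset fun _ : Fin k => s, simple (x ∘ r) := by
  simp only [simple, MultilinearMap.map_sum_finset, map_sum]
  rfl

/-- Inclusion-exclusion: the coefficient of `simple (x ∘ r)` is the alternating sum over all `T`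
disjoint from the range of `r`. It vanishes unless `r` is surjective, hence a permutation. -/
theorem polarization {k : ℕ} (x : Fin k → V) :
    ∑ T : Finset (Fin k), (-1 : ℂ) ^ T.card • vpow k (∑ i ∈ Tᶜ, x i) =
      ∑ σ : Equiv.Perm (Fin k), simple (x ∘ σ) := by
  classical
  have h1 (T : Finset (Fin k)) : (-1 : ℂ) ^ T.card • vpow k (∑ i ∈ Tᶜ, x i) =
      ∑ r : Fin k → Fin k,
        if T ⊆ (Finset.univ.image r)ᶜ then (-1 : ℂ) ^ T.card • simple (x ∘ r) else 0 := by
    rw [vpow, simple_sum, Finset.smul_sum, ← Finset.sum_filter]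
    refine Finset.sum_congr ?_ fun _ _ => rfl
    ext r
    simp only [Fintype.mem_piFinset, Finset.mem_compl, Finset.mem_filter, Finset.mem_univ, true_and]
    constructor
    · intro h i hi
      simp only [Finset.mem_compl, Finset.mem_image, Finset.mem_univ, true_and, not_exists]
      rintro j rfl
      exact h j hi
    · intro h j hj
      have := h hj
      simp at this
  simp only [h1]
  rw [Finset.sum_comm]
  have h2 (r : Fin k → Fin k) : (∑ T : Finset (Fin k),
      if T ⊆ (Finset.univ.image r)ᶜ then (-1 : ℂ) ^ T.card • simple (x ∘ r) else 0) =
      if Function.Surjective r then simple (x ∘ r) else 0 := by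
    have h3 : (∑ T ∈ ((Finset.univ.image r)ᶜ).powerset, (-1 : ℂ) ^ T.card) =
        if (Finset.univ.image r)ᶜ = ∅ then 1 else 0 := by
      exact_mod_cast congrArg (Int.cast : ℤ → ℂ)
        (Finset.sum_powerset_neg_one_pow_card (x := (Finset.univ.image r)ᶜ))
    rw [← Finset.sum_filter, ← Finset.sum_smul]
    have h4 : Finset.univ.filter (fun T => T ⊆ (Finset.univ.image r)ᶜ) =
        ((Finset.univ.image r)ᶜ).powerset := by
      ext T; simp
    have h5 : (Finset.univ.image r)ᶜ = ∅ ↔ Function.Surjective r := by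
      rw [Finset.compl_eq_empty_iff, ← Finset.coe_inj, Finset.coe_image, Finset.coe_univ,
        Set.image_univ, Set.range_eq_univ]
    rw [h4, h3]
    by_cases h : Function.Surjective r
    · rw [if_pos h, if_pos (h5.2 h), one_smul]
    · rw [if_neg h, if_neg (fun h' => h (h5.1 h')), zero_smul]
  simp only [h2]
  rw [← Finset.sum_filter]
  symm
  refine Finset.sum_bij (fun σ _ => ⇑σ) (fun σ _ => by simp [σ.surjective])
    (fun σ _ τ _ h => Equiv.ext (congrFun h)) (fun r hr => ?_) (fun _ _ => rfl)
  have hr' : Function.Surjective r := by simpa using hr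
  exact ⟨Equiv.ofBijective r (Finite.injective_iff_bijective.1
    (Finite.injective_iff_surjective.2 hr')), Finset.mem_univ _, rfl⟩

theorem vpow_mem_symTens (k : ℕ) (v : V) : vpow k v ∈ symTens V := by
  refine ⟨vpow k v, ?_⟩
  rw [vpow, symm_simple]
  exact avg_const (vpow k v)

theorem symTens_le_span :
    symTens V ≤ Submodule.span ℂ (Set.range fun p : ℕ × V => vpow p.1 p.2) := by
  rintro _ ⟨X, rfl⟩
  induction X using tens_induction with
  | hadd X Y hX hY => rw [map_add]; exact add_mem hX hY
  | h0 c k x =>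
    rw [map_smul, symm_simple, ← polarization]
    refine Submodule.smul_mem _ _ (Submodule.smul_mem _ _ (Submodule.sum_mem _ fun T _ =>
      Submodule.smul_mem _ _ (Submodule.subset_span ⟨(k, _), rfl⟩)))

/-- Symmetric tensors are spanned by powers. -/
theorem symTens_induction {p : ∀ X : Tens V, X ∈ symTens V → Prop}
    (pow : ∀ k v, p (vpow k v) (vpow_mem_symTens k v)) (zero : p 0 (zero_mem _))
    (add : ∀ X Y hX hY, p X hX → p Y hY → p (X + Y) (add_mem hX hY))
    (smul : ∀ (c : ℂ) X hX, p X hX → p (c • X) (Submodule.smul_mem _ c hX))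
    {X : Tens V} (hX : X ∈ symTens V) : p X hX := by
  have h : ∃ h : X ∈ symTens V, p X h := by
    refine Submodule.span_induction (p := fun X _ => ∃ h : X ∈ symTens V, p X h) ?_ ⟨_, zero⟩
      ?_ ?_ (symTens_le_span hX)
    · rintro _ ⟨⟨k, v⟩, rfl⟩
      exact ⟨_, pow k v⟩
    · rintro X Y _ _ ⟨hX, h⟩ ⟨hY, h'⟩
      exact ⟨_, add X Y hX hY h h'⟩
    · rintro c X _ ⟨hX, h⟩
      exact ⟨_, smul c X hX h⟩
  exact h.2

/-- For `k = 0` the truncated exponent is harmless, as the coefficient is zero. -/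
theorem derivT_vpow (ρ : V →ₗ[ℂ] ℂ) (k : ℕ) (v : V) :
    derivT ρ (vpow k v) = ((k : ℂ) * ρ v) • vpow (k - 1) v := by
  cases k with
  | zero => rw [vpow, derivT_simple_zero]; simp
  | succ k => rw [vpow, derivT_simple_succ, smul_smul]; rfl

theorem prodT_vpow (ρ : V →ₗ[ℂ] ℂ) (k : ℕ) (v : V) : prodT ρ (vpow k v) = ρ v ^ k := by
  rw [vpow, prodT_simple]; simp

theorem derivT_mem_symTens (ρ : V →ₗ[ℂ] ℂ) {X : Tens V} (hX : X ∈ symTens V) :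
    derivT ρ X ∈ symTens V := by
  induction hX using symTens_induction with
  | pow k v => rw [derivT_vpow]; exact Submodule.smul_mem _ _ (vpow_mem_symTens _ _)
  | zero => simp
  | add X Y _ _ hX hY => rw [map_add]; exact add_mem hX hY
  | smul c X _ hX => rw [map_smul]; exact Submodule.smul_mem _ _ hX

/-- On powers this is the derivative of `(σ v + t ρ v) ^ k`. Symmetry is essential: `derivT`
contracts the last slot only and compensates by the factor `k`. -/
theorem hasDerivAt_prodT (σ ρ : V →ₗ[ℂ] ℂ) {X : Tens V} (hX : X ∈ symTens V) (t : ℝ) :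
    HasDerivAt (fun t : ℝ => prodT (σ + (t : ℂ) • ρ) X)
      (prodT (σ + (t : ℂ) • ρ) (derivT ρ X)) t := by
  induction hX using symTens_induction with
  | pow k v =>
    simp only [derivT_vpow, prodT_vpow, map_smul, LinearMap.add_apply, LinearMap.smul_apply,
      smul_eq_mul]
    have h : HasDerivAt (fun t : ℝ => σ v + (t : ℂ) * ρ v) (ρ v) t := by
      simpa using ((Complex.ofRealCLM.hasDerivAt (x := t)).mul_const (ρ v)).const_add (σ v)
    refine (h.fun_pow k).congr_deriv ?_
    ring
  | zero => simpa using hasDerivAt_const t (0 : ℂ)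
  | add X Y _ _ hX hY => simpa only [map_add] using hX.fun_add hY
  | smul c X _ hX => simpa only [map_smul, smul_eq_mul] using hX.const_mul c

theorem prodT_mul (ρ : V →ₗ[ℂ] ℂ) (X Y : Tens V) : prodT ρ (X * Y) = prodT ρ X * prodT ρ Y := by
  induction X using tens_induction with
  | hadd X X' hX hX' => simp only [map_add, add_mul, hX, hX']
  | h0 c k x =>
    induction Y using tens_induction with
    | hadd Y Y' hY hY' => simp only [map_add, mul_add, hY, hY']
    | h0 d l y =>
      simp only [smul_mul_assoc, mul_smul_comm, map_smul, smul_eq_mul, simple_mul, prodT_simple,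
        Fin.prod_univ_add, Fin.append_left, Fin.append_right]
      ring

theorem prodT_one (ρ : V →ₗ[ℂ] ℂ) : prodT ρ 1 = 1 := by
  rw [← simple_elim0 (Fin.elim0 : Fin 0 → V), prodT_simple]; simp

theorem prodT_symm (ρ : V →ₗ[ℂ] ℂ) (X : Tens V) : prodT ρ (symm X) = prodT ρ X := by
  induction X using tens_induction with
  | hadd X Y hX hY => simp only [map_add, hX, hY]
  | h0 c k x =>
    rw [map_smul, map_smul, map_smul, symm_simple, map_smul, map_sum]
    congr 1
    have (τ : Equiv.Perm (Fin k)) : prodT ρ (simple (x ∘ τ)) = prodT ρ (simple x) := by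
      rw [prodT_simple, prodT_simple]
      exact Fintype.prod_equiv τ _ _ fun _ => rfl
    simp only [this]
    exact avg_const _

theorem prodT_starT [StarAddMonoid V] [StarModule ℂ V] (ρ : V →ₗ[ℂ] ℂ)
    (hρ : ∀ v, conj (ρ v) = ρ (star v)) (X : Tens V) : prodT ρ (starT X) = conj (prodT ρ X) := by
  induction X using tens_induction with
  | hadd X Y hX hY => simp only [map_add, hX, hY]
  | h0 c k x =>
    rw [LinearMap.map_smulₛₗ, map_smul, map_smul, smul_eq_mul, smul_eq_mul, map_mul, starT_simple,
      prodT_simple, prodT_simple, map_prod]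
    congr 1
    simp only [hρ]
    exact Fintype.prod_equiv Fin.revPerm _ _ fun _ => rfl

/-! ### Iterated derivatives -/

/-- `derivT` as a linear map in the functional. -/
def derivTₗ : (V →ₗ[ℂ] ℂ) →ₗ[ℂ] Module.End ℂ (Tens V) where
  toFun := derivT
  map_add' ρ σ := by
    ext X
    induction X using tens_induction with
    | hadd X Y hX hY => simp only [map_add, hX, hY]
    | h0 c k x =>
      cases k with
      | zero => simp [derivT_simple_zero]
      | succ k =>
        simp only [map_smul, LinearMap.add_apply, derivT_simple_succ, add_smul, smul_add]
  map_smul' c ρ := by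
    ext X
    induction X using tens_induction with
    | hadd X Y hX hY => simp only [map_add, hX, hY]
    | h0 d k x =>
      cases k with
      | zero => simp [derivT_simple_zero]
      | succ k =>
        simp only [map_smul, LinearMap.smul_apply, derivT_simple_succ, RingHom.id_apply]
        simp only [smul_smul, smul_eq_mul]
        ring_nf

/-- The iterated derivative `D_{ρ₁} ⋯ D_{ρ_k}`. -/
def iterT (k : ℕ) : MultilinearMap ℂ (fun _ : Fin k => V →ₗ[ℂ] ℂ) (Module.End ℂ (Tens V)) :=
  (MultilinearMap.mkPiAlgebraFin ℂ k (Module.End ℂ (Tens V))).compLinearMap fun _ => derivTₗ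

theorem iterT_zero (ρ : Fin 0 → V →ₗ[ℂ] ℂ) (X : Tens V) : iterT 0 ρ X = X := by
  simp [iterT]

theorem iterT_succ {k : ℕ} (ρ : Fin (k + 1) → V →ₗ[ℂ] ℂ) (X : Tens V) :
    iterT (k + 1) ρ X = derivT (ρ 0) (iterT k (Fin.tail ρ) X) := by
  simp [iterT, MultilinearMap.mkPiAlgebraFin_apply, List.ofFn_succ, derivTₗ, Fin.tail]

theorem iterT_succ_last {k : ℕ} (ρ : Fin (k + 1) → V →ₗ[ℂ] ℂ) (X : Tens V) :
    iterT (k + 1) ρ X = iterT k (Fin.init ρ) (derivT (ρ (Fin.last k)) X) := by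
  simp only [iterT, MultilinearMap.compLinearMap_apply, MultilinearMap.mkPiAlgebraFin_apply]
  rw [List.ofFn_succ', List.concat_eq_append, List.prod_append, List.prod_singleton,
    Module.End.mul_apply]
  rfl

theorem iterT_vpow {k : ℕ} (ρ : Fin k → V →ₗ[ℂ] ℂ) (n : ℕ) (v : V) :
    iterT k ρ (vpow n v) = ((n.descFactorial k : ℂ) * ∏ i, ρ i v) • vpow (n - k) v := by
  induction k with
  | zero => simp [iterT_zero]
  | succ k ih =>
    rw [iterT_succ, ih, map_smul, derivT_vpow, smul_smul, Nat.descFactorial_succ,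
      Fin.prod_univ_succ, Nat.sub_sub]
    congr 1
    push_cast
    simp only [Fin.tail]
    ring

theorem iterT_mem_symTens {k : ℕ} (ρ : Fin k → V →ₗ[ℂ] ℂ) {X : Tens V} (hX : X ∈ symTens V) :
    iterT k ρ X ∈ symTens V := by
  induction k with
  | zero => rwa [iterT_zero]
  | succ k ih => rw [iterT_succ]; exact derivT_mem_symTens _ (ih _)

theorem iterT_comp_perm {k : ℕ} (ρ : Fin k → V →ₗ[ℂ] ℂ) (τ : Equiv.Perm (Fin k)) {X : Tens V}
    (hX : X ∈ symTens V) : iterT k (ρ ∘ τ) X = iterT k ρ X := by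
  induction hX using symTens_induction with
  | pow n v =>
    rw [iterT_vpow, iterT_vpow]
    congr 2
    exact Fintype.prod_equiv τ _ _ fun _ => rfl
  | zero => simp
  | add X Y _ _ hX hY => rw [map_add, map_add, hX, hY]
  | smul c X _ hX => rw [map_smul, map_smul, hX]

/-- On powers both sides are scalar multiples of one lower power. On tensors that are not symmetric
the contractions do not commute. -/
theorem derivT_iterT {k : ℕ} (ρ : Fin k → V →ₗ[ℂ] ℂ) (ξ : V →ₗ[ℂ] ℂ) {X : Tens V}
    (hX : X ∈ symTens V) : derivT ξ (iterT k ρ X) = iterT k ρ (derivT ξ X) := by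
  induction hX using symTens_induction with
  | pow n v =>
    rw [iterT_vpow, map_smul, derivT_vpow, derivT_vpow, map_smul, iterT_vpow, smul_smul, smul_smul,
      Nat.sub_right_comm]
    congr 1
    -- Both sides are `n.descFactorial (k + 1)`, peeled off at either end.
    have h : n.descFactorial k * (n - k) = n * (n - 1).descFactorial k := by
      cases n with
      | zero => simp
      | succ n => rw [mul_comm, ← Nat.descFactorial_succ, Nat.succ_descFactorial_succ]; simp
    have h' : (n.descFactorial k : ℂ) * ((n - k : ℕ) : ℂ) = n * ((n - 1).descFactorial k : ℂ) := by
      exact_mod_cast h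
    linear_combination (∏ i, ρ i v) * ξ v * h'
  | zero => simp
  | add X Y _ _ hX hY => simp only [map_add, hX, hY]
  | smul c X _ hX => simp only [map_smul, hX]

theorem derivT_pow_iterT {k : ℕ} (ρ : Fin k → V →ₗ[ℂ] ℂ) (ξ : V →ₗ[ℂ] ℂ) (n : ℕ) {X : Tens V}
    (hX : X ∈ symTens V) : (derivT ξ ^ n) (iterT k ρ X) = iterT k ρ ((derivT ξ ^ n) X) := by
  induction n generalizing X with
  | zero => simp
  | succ n ih =>
    rw [pow_succ, Module.End.mul_apply, Module.End.mul_apply, derivT_iterT ρ ξ hX,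
      ih (derivT_mem_symTens ξ hX)]

theorem translT_iterT {k : ℕ} (ρ : Fin k → V →ₗ[ℂ] ℂ) (ξ : V →ₗ[ℂ] ℂ) {X : Tens V}
    (hX : X ∈ symTens V) : translT ξ (iterT k ρ X) = iterT k ρ (translT ξ X) := by
  obtain ⟨N, hN⟩ := translT_eq_sum ξ X
  obtain ⟨M, hM⟩ := translT_eq_sum ξ (iterT k ρ X)
  rw [hN (max N M) (le_max_left _ _), hM (max N M) (le_max_right _ _), map_sum]
  simp only [derivT_pow_iterT ρ ξ _ hX, map_smul]

/-- The pairing `x₁ ⊗ ⋯ ⊗ x_k ↦ k! ρ₁(x₁) ⋯ ρ_k(x_k)` of tensors with functionals. -/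
def pairT (k : ℕ) : MultilinearMap ℂ (fun _ : Fin k => V →ₗ[ℂ] ℂ) (Tens V →ₗ[ℂ] ℂ) :=
  (LinearMap.llcomp ℂ (Tens V) (Tens V) ℂ scalarPart).compMultilinearMap (iterT k)

theorem pairT_apply {k : ℕ} (ρ : Fin k → V →ₗ[ℂ] ℂ) (X : Tens V) :
    pairT k ρ X = scalarPart (iterT k ρ X) := rfl

/-- Taylor's formula: derivatives at `ξ` are the degree `k` coefficients of the tensor translated by
`ξ`, because translation commutes with the derivations. -/
theorem evalT_iterT {k : ℕ} (ρ : Fin k → V →ₗ[ℂ] ℂ) (ξ : V →ₗ[ℂ] ℂ) {X : Tens V}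
    (hX : X ∈ symTens V) : evalT ξ (iterT k ρ X) = pairT k ρ (translT ξ X) := by
  rw [evalT, translT_iterT ρ ξ hX, pairT_apply]

theorem pairT_simple {k : ℕ} (ρ : Fin k → V →ₗ[ℂ] ℂ) (x : Fin k → V) :
    pairT k ρ (simple x) = k.factorial * ∏ i, ρ i (x i) := by
  induction k with
  | zero => simp [pairT_apply, iterT_zero, scalarPart_simple_zero]
  | succ k ih =>
    rw [pairT_apply, iterT_succ_last, derivT_simple_succ, map_smul, map_smul, map_smul, map_smul,
      ← pairT_apply, ih, Fin.prod_univ_castSucc, Nat.factorial_succ]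
    push_cast
    simp only [Fin.init, smul_eq_mul]
    ring

theorem pairT_simple_of_ne {k l : ℕ} (h : k ≠ l) (ρ : Fin k → V →ₗ[ℂ] ℂ) (x : Fin l → V) :
    pairT k ρ (simple x) = 0 := by
  induction k generalizing l with
  | zero =>
    cases l with
    | zero => exact absurd rfl h
    | succ l => rw [pairT_apply, iterT_zero, scalarPart_simple_succ]
  | succ k ih =>
    rw [pairT_apply, iterT_succ_last]
    cases l with
    | zero => rw [derivT_simple_zero, map_zero, map_zero]
    | succ l =>
      rw [derivT_simple_succ, map_smul, map_smul, map_smul, map_smul, ← pairT_apply,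
        ih (by omega), smul_zero, smul_zero]

theorem scalarPart_smul_one (X : Tens V) : scalarPart X • (1 : Tens V) = proj 0 X := by
  induction X using tens_induction with
  | hadd X Y hX hY => simp only [map_add, add_smul, hX, hY]
  | h0 c k x =>
    rw [map_smul, map_smul, smul_assoc]
    congr 1
    cases k with
    | zero => rw [scalarPart_simple_zero, proj_simple, one_smul, simple_elim0]
    | succ k => rw [scalarPart_simple_succ, proj_simple_of_ne (by omega), zero_smul]

variable [TopologicalSpace V]

theorem tnorm_one (α : HermForm V) : α.tnorm (1 : Tens V) = 1 := by
  rw [← simple_elim0 (Fin.elim0 : Fin 0 → V), HermForm.tnorm_apply, α.ext_simple]; simp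

/-- Contracting the slots from the last one on costs a factor `(j + 1) c` in degree `j + 1`. The
resulting `k!` is crude, but only continuity and boundedness in each fixed degree are drawn from it.
-/
theorem norm_pairT_le (α : HermForm V) {k : ℕ} (ρ : Fin k → V →L[ℂ] ℂ) (c : Fin k → ℝ≥0)
    (h : ∀ i v, ‖ρ i v‖ ≤ c i * α.nrm v) (X : Tens V) :
    ‖pairT k (fun i => (ρ i : V →ₗ[ℂ] ℂ)) X‖ ≤
      k.factorial * (∏ i, (c i : ℝ)) * α.tnorm (proj k X) := by
  induction k generalizing X with
  | zero =>
    rw [pairT_apply, iterT_zero, ← scalarPart_smul_one, map_smul_eq_mul, tnorm_one]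
    simp
  | succ k ih =>
    rw [pairT_apply, iterT_succ_last, ← pairT_apply]
    refine (ih (fun i => ρ i.castSucc) (fun i => c i.castSucc) (fun i => h i.castSucc) _).trans ?_
    rw [← derivT_proj_succ, Nat.factorial_succ, Fin.prod_univ_castSucc]
    refine (mul_le_mul_of_nonneg_left
      (tnorm_derivT_proj_succ_le (h (Fin.last k)) k X) (by positivity)).trans (le_of_eq ?_)
    push_cast
    ring

end SymmetricTensors

/-! ### The Riesz correspondence between `HermCpl α` and functionals dominated by `α`. -/

section Flat

variable {V : Type*} [AddCommGroup V] [Module ℂ V] [TopologicalSpace V]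
  [StarAddMonoid V] [StarModule ℂ V] {α β : HermForm V}

theorem HermSpace.inner_def (x y : HermSpace α) :
    inner ℝ x y = (α.form (HermSpace.val α x) (HermSpace.val α y)).re := rfl

theorem HermSpace.star_val (x : HermSpace α) : star (HermSpace.val α x) = HermSpace.val α x :=
  (x : selfAdjoint V).2

theorem HermForm.Compatible.ofReal_inner (hα : α.Compatible) (x y : HermSpace α) :
    ((inner ℝ x y : ℝ) : ℂ) = α.form (HermSpace.val α x) (HermSpace.val α y) := by
  rw [HermSpace.inner_def]
  refine Complex.conj_eq_iff_re.1 ?_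
  rw [hα, HermSpace.star_val, HermSpace.star_val]

/-- A compatible form is real and symmetric on Hermitian vectors, so the cross terms `i⟨a, b⟩` and
`-i⟨b, a⟩` cancel. -/
theorem HermForm.Compatible.nrm_sq_eq (hα : α.Compatible) (w : V) :
    α.nrm w ^ 2 = ‖HermSpace.mk α (ℜ w)‖ ^ 2 + ‖HermSpace.mk α (ℑ w)‖ ^ 2 := by
  have hw : HermSpace.val α (HermSpace.mk α (ℜ w)) +
      Complex.I • HermSpace.val α (HermSpace.mk α (ℑ w)) = w :=
    realPart_add_I_smul_imaginaryPart w
  set a := HermSpace.mk α (ℜ w)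
  set b := HermSpace.mk α (ℑ w)
  rw [α.nrm_sq, ← real_inner_self_eq_norm_sq, ← real_inner_self_eq_norm_sq]
  have h : α.form w w = ((inner ℝ a a + inner ℝ b b : ℝ) : ℂ) := by
    rw [← hw]
    simp only [map_add, LinearMap.add_apply, LinearMap.map_smulₛₗ, LinearMap.smul_apply, map_smul,
      ← hα.ofReal_inner, real_inner_comm a b, Complex.conj_I, smul_eq_mul, Complex.ofReal_add]
    linear_combination -((inner ℝ b b : ℝ) : ℂ) * Complex.I_sq
  rw [h, Complex.ofReal_re]

theorem HermDual.ext_selfAdjoint {ρ σ : HermDual V}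
    (h : ∀ y : selfAdjoint V, (ρ : V →L[ℂ] ℂ) y = (σ : V →L[ℂ] ℂ) y) : ρ = σ := by
  refine Subtype.ext (ContinuousLinearMap.ext fun w => ?_)
  conv_lhs => rw [← realPart_add_I_smul_imaginaryPart w]
  conv_rhs => rw [← realPart_add_I_smul_imaginaryPart w]
  rw [map_add, map_add, map_smul, map_smul, h, h]

theorem HermDual.ofReal_re_val (ρ : HermDual V) (y : HermSpace α) :
    (((ρ : V →L[ℂ] ℂ) (HermSpace.val α y)).re : ℂ) = (ρ : V →L[ℂ] ℂ) (HermSpace.val α y) := by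
  refine Complex.conj_eq_iff_re.1 ?_
  rw [ρ.2, HermSpace.star_val]

theorem denseRange_coe_pi (k : ℕ) :
    DenseRange fun (y : Fin k → HermSpace α) (i : Fin k) => (y i : HermCpl α) :=
  DenseRange.piMap fun _ => UniformSpace.Completion.denseRange_coe

variable [IsTopologicalAddGroup V] [ContinuousStar V] [ContinuousSMul ℂ V]

theorem flat_apply (v : HermCpl α) (w : V) :
    (flat α v : V →L[ℂ] ℂ) w =
      ((inner ℝ v ((HermSpace.mk α (ℜ w) : HermSpace α) : HermCpl α) : ℝ) : ℂ) +
        Complex.I * ((inner ℝ v ((HermSpace.mk α (ℑ w) : HermSpace α) : HermCpl α) : ℝ) : ℂ) :=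
  rfl

theorem flat_val (v : HermCpl α) (y : HermSpace α) :
    (flat α v : V →L[ℂ] ℂ) (HermSpace.val α y) = ((inner ℝ v (y : HermCpl α) : ℝ) : ℂ) := by
  have h : star (HermSpace.val α y) = HermSpace.val α y := HermSpace.star_val y
  have h₁ : HermSpace.mk α (ℜ (HermSpace.val α y)) = y := Subtype.ext <| by
    change ((ℜ (HermSpace.val α y) : selfAdjoint V) : V) = HermSpace.val α y
    rw [realPart_apply_coe, h, ← two_smul ℝ, smul_smul]
    norm_num
  have h₂ : HermSpace.mk α (ℑ (HermSpace.val α y)) = 0 := Subtype.ext <| by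
    change ((ℑ (HermSpace.val α y) : selfAdjoint V) : V) = 0
    rw [imaginaryPart_apply_coe, h, sub_self, smul_zero, smul_zero]
  rw [flat_apply, h₁, h₂, UniformSpace.Completion.coe_zero, inner_zero_right]
  simp

theorem flat_coe (hα : α.Compatible) (y : HermSpace α) (w : V) :
    (flat α (y : HermCpl α) : V →L[ℂ] ℂ) w = α.form (HermSpace.val α y) w := by
  have hw : HermSpace.val α (HermSpace.mk α (ℜ w)) +
      Complex.I • HermSpace.val α (HermSpace.mk α (ℑ w)) = w :=
    realPart_add_I_smul_imaginaryPart w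
  conv_rhs => rw [← hw]
  rw [flat_apply, map_add, map_smul, ← hα.ofReal_inner, ← hα.ofReal_inner,
    UniformSpace.Completion.inner_coe, UniformSpace.Completion.inner_coe, smul_eq_mul]

/-- Cauchy-Schwarz is applied to the real and imaginary parts of `w` separately; `nrm_sq_eq`
recombines them without loss of a constant. -/
theorem norm_flat_apply_le (hα : α.Compatible) (v : HermCpl α) (w : V) :
    ‖(flat α v : V →L[ℂ] ℂ) w‖ ≤ ‖v‖ * α.nrm w := by
  refine (sq_le_sq₀ (norm_nonneg _) (mul_nonneg (norm_nonneg _) (α.nrm_nonneg _))).1 ?_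
  rw [mul_pow, hα.nrm_sq_eq, flat_apply, mul_comm Complex.I, ← Complex.normSq_eq_norm_sq,
    Complex.normSq_add_mul_I, mul_add]
  have h (y : HermSpace α) : (inner ℝ v (y : HermCpl α)) ^ 2 ≤ ‖v‖ ^ 2 * ‖y‖ ^ 2 := by
    rw [← mul_pow, ← UniformSpace.Completion.norm_coe y]
    exact sq_le_sq' (by linarith [neg_le_of_abs_le (abs_real_inner_le_norm v (y : HermCpl α))])
      (real_inner_le_norm _ _)
  exact add_le_add (h _) (h _)

/-- Riesz representation: functionals bounded by a multiple of `‖·‖_α` are of the form `v^♭`. -/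
theorem exists_flat_eq (ρ : HermDual V) {c : ℝ} (hc : 0 ≤ c)
    (h : ∀ v, ‖(ρ : V →L[ℂ] ℂ) v‖ ≤ c * α.nrm v) :
    ∃ u : HermCpl α, ‖u‖ ≤ c ∧ flat α u = ρ := by
  -- Real Riesz representation is applied to `ρ` restricted to Hermitian vectors, where `ρ` is real;
  -- `HermDual.ext_selfAdjoint` recovers `ρ` on all of `V`.
  let f : HermSpace α →ₗ[ℝ] ℝ :=
    Complex.reLm ∘ₗ ((ρ : V →L[ℂ] ℂ) : V →ₗ[ℂ] ℂ).restrictScalars ℝ ∘ₗ HermSpace.val α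
  have hf (y : HermSpace α) : f y = ((ρ : V →L[ℂ] ℂ) (HermSpace.val α y)).re := rfl
  let g : HermSpace α →L[ℝ] ℝ := f.mkContinuous c fun y =>
    (Complex.abs_re_le_norm _).trans (h _)
  have hg (y : HermSpace α) : g.fromCompletion (y : HermCpl α) = f y :=
    g.fromCompletion_apply_coe y
  let u := (InnerProductSpace.toDual ℝ (HermCpl α)).symm g.fromCompletion
  have hu (x : HermCpl α) : inner ℝ u x = g.fromCompletion x :=
    InnerProductSpace.toDual_symm_apply
  refine ⟨u, ?_, ?_⟩
  · rw [LinearIsometryEquiv.norm_map]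
    refine ContinuousLinearMap.opNorm_le_bound _ hc fun x => ?_
    induction x using UniformSpace.Completion.induction_on with
    | hp => exact isClosed_le (by fun_prop) (by fun_prop)
    | ih y =>
      rw [hg, UniformSpace.Completion.norm_coe]
      exact (Complex.abs_re_le_norm _).trans (h _)
  · refine HermDual.ext_selfAdjoint fun y => ?_
    have := flat_val u (HermSpace.mk α y)
    rw [hu, hg, hf, HermDual.ofReal_re_val] at this
    exact this

variable (α) in
/-- `flat` as a linear map into the algebraic dual. -/
def flatₗ : HermCpl α →ₗ[ℝ] V →ₗ[ℂ] ℂ where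
  toFun v := (flat α v : V →L[ℂ] ℂ)
  map_add' v w := by
    ext x
    simp only [ContinuousLinearMap.coe_coe, LinearMap.add_apply, flat_apply, inner_add_left,
      Complex.ofReal_add]
    ring
  map_smul' c v := by
    ext x
    simp only [ContinuousLinearMap.coe_coe, LinearMap.smul_apply, flat_apply, inner_smul_left,
      RingHom.id_apply, conj_trivial, Complex.ofReal_mul, Complex.real_smul]
    ring

theorem flatₗ_apply (v : HermCpl α) : flatₗ α v = ((flat α v : V →L[ℂ] ℂ) : V →ₗ[ℂ] ℂ) := rfl

theorem flat_add (v w : HermCpl α) : flat α (v + w) = flat α v + flat α w :=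
  Subtype.ext <| ContinuousLinearMap.coe_injective (map_add (flatₗ α) v w)

theorem flat_smul (c : ℝ) (v : HermCpl α) : flat α (c • v) = c • flat α v :=
  Subtype.ext <| ContinuousLinearMap.coe_injective (map_smul (flatₗ α) c v)

end Flat

/-! ### Fock spaces -/

section Fock

variable {V : Type*} [AddCommGroup V] [Module ℂ V] [TopologicalSpace V]

/-- The tensor algebra with the inner product of `α`. -/
def Fock (_α : HermForm V) : Type _ := Tens V

variable (α : HermForm V)

instance : AddCommGroup (Fock α) := inferInstanceAs (AddCommGroup (Tens V))

instance : Module ℂ (Fock α) := inferInstanceAs (Module ℂ (Tens V))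

abbrev Fock.core : PreInnerProductSpace.Core ℂ (Fock α) := α.core

instance : SeminormedAddCommGroup (Fock α) :=
  @InnerProductSpace.Core.toSeminormedAddCommGroup ℂ _ _ _ _ (Fock.core α)

instance : InnerProductSpace ℂ (Fock α) := InnerProductSpace.ofCore (Fock.core α)

/-- The Fock space: the completion of the tensor algebra with the inner product of `α`. -/
abbrev FockCpl := UniformSpace.Completion (Fock α)

/-- A tensor as an element of the Fock space. -/
def toFock : Tens V →ₗ[ℂ] FockCpl α :=
  (UniformSpace.Completion.toComplₗᵢ (𝕜 := ℂ) (E := Fock α)).toLinearMap ∘ₗ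
    (LinearMap.id : Tens V →ₗ[ℂ] Tens V)

theorem norm_toFock (X : Tens V) : ‖toFock α X‖ = α.tnorm X :=
  UniformSpace.Completion.norm_coe (E := Fock α) X

theorem inner_toFock (X Y : Tens V) : inner ℂ (toFock α X) (toFock α Y) = α.ext X Y :=
  UniformSpace.Completion.inner_coe (E := Fock α) X Y

theorem denseRange_toFock : DenseRange (toFock α) :=
  UniformSpace.Completion.denseRange_coe (α := Fock α)

variable {α}

theorem FockCpl.ext {x y : FockCpl α}
    (h : ∀ X, inner ℂ x (toFock α X) = inner ℂ y (toFock α X)) : x = y := by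
  refine Dense.eq_of_inner_left (𝕜 := ℂ) (denseRange_toFock α) ?_
  rintro _ ⟨X, rfl⟩
  exact h X

/-- The canonical map between the Fock spaces of two comparable forms. -/
def fockRestrict (α β : HermForm V) : FockCpl β →L[ℂ] FockCpl α :=
  (toFock α).extendOfNorm (toFock β)

/-- The bound that the extension needs is `tnorm_mono`, with constant `1`. -/
theorem fockRestrict_toFock {α β : HermForm V} (h : ∀ v, α.nrm v ≤ β.nrm v) (X : Tens V) :
    fockRestrict α β (toFock β X) = toFock α X :=
  LinearMap.extendOfNorm_eq (denseRange_toFock β)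
    ⟨1, fun X => by rw [norm_toFock, norm_toFock, one_mul]; exact tnorm_mono h X⟩ X

variable (α) in
/-- The canonical map from the completed symmetric tensor algebra to the Fock space. -/
def symFock : SymCpl V →L[ℂ] FockCpl α :=
  ContinuousLinearMap.fromCompletion
    { toLinearMap := toFock α ∘ₗ (symTens V).subtype
      cont := by
        refine Continuous.comp (g := toFock α) ?_ continuous_subtype_val
        refine continuous_of_continuousAt_zero (toFock α) ?_
        rw [ContinuousAt, map_zero, tendsto_zero_iff_norm_tendsto_zero]
        simp only [norm_toFock]
        exact (continuous_tnorm α).tendsto' 0 0 (by simp) }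

theorem symFock_coe (Y : symTens V) : symFock α (Y : SymCpl V) = toFock α (Y : Tens V) :=
  ContinuousLinearMap.fromCompletion_apply_coe _ Y

/-- The `k!` of the pairing and the `k!` of the Fock inner product match, so derivatives in the
directions `α.form (x i)` are Fock coefficients. -/
theorem pairT_form {k : ℕ} (x : Fin k → V) (X : Tens V) :
    pairT k (fun i => α.form (x i)) X = α.ext (simple x) X := by
  induction X using tens_induction with
  | hadd X Y hX hY => simp only [map_add, hX, hY]
  | h0 c l y =>
    rw [map_smul, map_smul]
    congr 1
    by_cases h : k = l
    · subst h; rw [pairT_simple, α.ext_simple]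
    · rw [pairT_simple_of_ne h, α.ext_simple_of_ne h]

variable [StarAddMonoid V] [StarModule ℂ V] [IsTopologicalAddGroup V] [ContinuousStar V]
  [ContinuousSMul ℂ V]

theorem norm_pairT_flat_le (hα : α.Compatible) {k : ℕ} (v : Fin k → HermCpl α) (X : Tens V) :
    ‖pairT k (fun i => flatₗ α (v i)) X‖ ≤ k.factorial * (∏ i, ‖v i‖) * ‖toFock α X‖ := by
  rw [norm_toFock]
  refine (norm_pairT_le α (fun i => (flat α (v i) : V →L[ℂ] ℂ)) (fun i => ‖v i‖₊)
    (fun i w => norm_flat_apply_le hα (v i) w) X).trans ?_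
  exact mul_le_mul_of_nonneg_left (tnorm_proj_le α k X) (by positivity)

/-- The tensor `v₁ ⊗ ⋯ ⊗ v_k` in the Fock space, for vectors of the Hilbert space completion. -/
def fockTensorFun {k : ℕ} (v : Fin k → HermCpl α) : FockCpl α :=
  (InnerProductSpace.toDual ℂ (FockCpl α)).symm
    ((pairT k fun i => flatₗ α (v i)).extendOfNorm (toFock α))

theorem inner_fockTensorFun (hα : α.Compatible) {k : ℕ} (v : Fin k → HermCpl α) (X : Tens V) :
    inner ℂ (fockTensorFun v) (toFock α X) = pairT k (fun i => flatₗ α (v i)) X := by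
  rw [fockTensorFun, InnerProductSpace.toDual_symm_apply]
  exact LinearMap.extendOfNorm_eq (denseRange_toFock α) ⟨_, norm_pairT_flat_le hα v⟩ X

/-- `fockTensorFun` as a continuous multilinear map. -/
def fockTensor (hα : α.Compatible) (k : ℕ) :
    ContinuousMultilinearMap ℝ (fun _ : Fin k => HermCpl α) (FockCpl α) :=
  MultilinearMap.mkContinuous
    { toFun := fockTensorFun
      -- Real multilinearity is tested against the dense algebraic tensors, where it is that of
      -- `pairT` composed with `flatₗ`.
      map_update_add' := fun {_} v i x y => FockCpl.ext fun X => by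
        rw [inner_add_left]
        simp only [inner_fockTensorFun hα]
        rw [← LinearMap.add_apply]
        congr 1
        exact (((pairT k).restrictScalars ℝ).compLinearMap fun _ => flatₗ α).map_update_add v i x y
      map_update_smul' := fun {_} v i c x => FockCpl.ext fun X => by
        rw [← Complex.coe_smul c, inner_smul_left]
        simp only [inner_fockTensorFun hα]
        rw [Complex.conj_ofReal, ← smul_eq_mul, ← LinearMap.smul_apply]
        congr 1
        exact (((pairT k).restrictScalars ℝ).compLinearMap fun _ => flatₗ α).map_update_smul
          v i c x }
    k.factorial fun v => by
      change ‖fockTensorFun v‖ ≤ _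
      rw [fockTensorFun, LinearIsometryEquiv.norm_map]
      exact LinearMap.opNorm_extendOfNorm_le (denseRange_toFock α) (by positivity)
        (norm_pairT_flat_le hα v)

theorem inner_fockTensor (hα : α.Compatible) {k : ℕ} (v : Fin k → HermCpl α) (X : Tens V) :
    inner ℂ (fockTensor hα k v) (toFock α X) = pairT k (fun i => flatₗ α (v i)) X :=
  inner_fockTensorFun hα v X

theorem fockTensor_coe (hα : α.Compatible) {k : ℕ} (y : Fin k → HermSpace α) :
    fockTensor hα k (fun i => (y i : HermCpl α)) =
      toFock α (simple fun i => HermSpace.val α (y i)) := by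
  refine FockCpl.ext fun X => ?_
  rw [inner_fockTensor, inner_toFock, ← pairT_form]
  congr 2
  funext i
  ext w
  exact flat_coe hα (y i) w

/-- By continuity only `w` has to be moved into the dense Hermitian vectors: `inner_fockTensor`
already evaluates algebraic tensors against arbitrary `v`. -/
theorem inner_fockTensor_fockTensor (hα : α.Compatible) {k : ℕ} (v w : Fin k → HermCpl α) :
    inner ℂ (fockTensor hα k v) (fockTensor hα k w) =
      k.factorial * ∏ i, ((inner ℝ (v i) (w i) : ℝ) : ℂ) := by
  refine (denseRange_coe_pi k).induction_on (p := fun w => inner ℂ (fockTensor hα k v)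
    (fockTensor hα k w) = k.factorial * ∏ i, ((inner ℝ (v i) (w i) : ℝ) : ℂ)) w ?_ fun y => ?_
  · refine isClosed_eq (by fun_prop) (continuous_const.mul (continuous_finsetProd _ fun i _ => ?_))
    exact Complex.continuous_ofReal.comp (continuous_const.inner (continuous_apply i))
  · rw [fockTensor_coe, inner_fockTensor, pairT_simple]
    simp only [flatₗ_apply, ContinuousLinearMap.coe_coe, flat_val]

theorem inner_fockTensor_of_ne (hα : α.Compatible) {k l : ℕ} (h : k ≠ l) (v : Fin k → HermCpl α)
    (w : Fin l → HermCpl α) : inner ℂ (fockTensor hα k v) (fockTensor hα l w) = 0 := by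
  refine (denseRange_coe_pi l).induction_on (p := fun w => inner ℂ (fockTensor hα k v)
    (fockTensor hα l w) = 0) w ?_ fun y => ?_
  · exact isClosed_eq (by fun_prop) continuous_const
  · rw [fockTensor_coe, inner_fockTensor, pairT_simple_of_ne h]

end Fock

/-! ### Order of forms, and derivations on the completed symmetric algebra. -/

section FormOrder

variable {V : Type*} [AddCommGroup V] [Module ℂ V] [TopologicalSpace V]

theorem HermForm.nrm_le_add_left (α β : HermForm V) (v : V) : α.nrm v ≤ (α.add β).nrm v := by
  refine Real.sqrt_le_sqrt ?_
  simpa [HermForm.add] using β.nonneg v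

theorem HermForm.nrm_le_add_right (α β : HermForm V) (v : V) : β.nrm v ≤ (α.add β).nrm v := by
  refine Real.sqrt_le_sqrt ?_
  simpa [HermForm.add] using α.nonneg v

theorem HermForm.nrm_scale_mono {α β : HermForm V} (h : ∀ v, α.nrm v ≤ β.nrm v) (c : ℝ≥0)
    (v : V) : (α.scale c).nrm v ≤ (β.scale c).nrm v := by
  have hc : c = NNReal.sqrt c ^ 2 := (NNReal.sq_sqrt c).symm
  rw [hc, α.nrm_scale, β.nrm_scale]
  exact mul_le_mul_of_nonneg_left (h v) (NNReal.coe_nonneg _)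

theorem norm_prodT_le_of_le {α : HermForm V} {ρ : V →L[ℂ] ℂ} (h : ∀ v, ‖ρ v‖ ≤ α.nrm v)
    (X : Tens V) : ‖prodT (ρ : V →ₗ[ℂ] ℂ) X‖ ≤ 2 * (α.scale 16).tnorm X := by
  refine (norm_prodT_le ρ X).trans (mul_le_mul_of_nonneg_left (tnorm_mono
    (HermForm.nrm_scale_mono (fun v => ?_) _) X) zero_le_two)
  rw [nrm_rankOne]
  exact h v

/-- `ρ` need not be bounded by a multiple of `α`; enlarging `α` by `rankOne ρ` makes
`tnorm_derivT_le` available with `c = 1`. -/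
theorem uniformContinuous_derivT (ρ : V →L[ℂ] ℂ) :
    UniformContinuous (derivT (ρ : V →ₗ[ℂ] ℂ)) :=
  continuous_of_tnorm_le _ fun α => ⟨(α.add (rankOne ρ)).scale 16, 2, fun X => by
    refine (tnorm_mono (α.nrm_le_add_left (rankOne ρ)) _).trans ?_
    have := tnorm_derivT_le (α := α.add (rankOne ρ)) (ρ := ρ) (c := 1) (fun v => by
      rw [NNReal.coe_one, one_mul, ← nrm_rankOne]
      exact α.nrm_le_add_right (rankOne ρ) v) X
    simpa using this⟩

/-- The derivative on the completed symmetric tensor algebra. -/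
def derivSym (ρ : V →L[ℂ] ℂ) : SymCpl V →L[ℂ] SymCpl V :=
  ContinuousLinearMap.completion
    { toLinearMap := (derivT (ρ : V →ₗ[ℂ] ℂ)).restrict fun _ => derivT_mem_symTens _
      cont := ((uniformContinuous_derivT ρ).continuous.comp continuous_subtype_val).subtype_mk _ }

theorem derivSym_coe (ρ : V →L[ℂ] ℂ) (Y : symTens V) :
    derivSym ρ (Y : SymCpl V) =
      ((⟨derivT (ρ : V →ₗ[ℂ] ℂ) Y, derivT_mem_symTens _ Y.2⟩ : symTens V) : SymCpl V) :=
  ContinuousLinearMap.completion_apply_coe _ Y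

/-- The iterated derivative on the completed symmetric tensor algebra. -/
def iterSym : (k : ℕ) → (Fin k → V →L[ℂ] ℂ) → SymCpl V →L[ℂ] SymCpl V
  | 0, _ => ContinuousLinearMap.id ℂ _
  | k + 1, ρ => derivSym (ρ 0) ∘L iterSym k (Fin.tail ρ)

theorem iterSym_coe {k : ℕ} (ρ : Fin k → V →L[ℂ] ℂ) (Y : symTens V) :
    iterSym k ρ (Y : SymCpl V) =
      ((⟨iterT k (fun i => (ρ i : V →ₗ[ℂ] ℂ)) Y, iterT_mem_symTens _ Y.2⟩ : symTens V) :
        SymCpl V) := by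
  induction k with
  | zero =>
    simp only [iterT_zero]
    rfl
  | succ k ih =>
    rw [iterSym, ContinuousLinearMap.comp_apply, ih, derivSym_coe]
    simp only [iterT_succ]
    rfl

end FormOrder

/-! ### The Hilbert-Schmidt sum as a bound on finite partial sums. -/

section HilbertSchmidtSum

/-- The double series becomes one family indexed by pairs `(k, i)`, the form in which Bessel and
Riesz-Fischer apply. -/
theorem tsum_tsum_le_iff {I : Type*} (a : ∀ k, (Fin k → I) → ℂ) (C : ℝ≥0) :
    (∑' k : ℕ, ((k.factorial : ℝ≥0∞)⁻¹ * ∑' i : Fin k → I, ‖a k i‖ₑ ^ 2)) ≤ C ↔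
      ∀ s : Finset (Σ k, Fin k → I),
        ∑ p ∈ s, (p.1.factorial : ℝ)⁻¹ * ‖a p.1 p.2‖ ^ 2 ≤ C := by
  have h (k : ℕ) (i : Fin k → I) : (k.factorial : ℝ≥0∞)⁻¹ * ‖a k i‖ₑ ^ 2 =
      (((k.factorial : ℝ≥0)⁻¹ * ‖a k i‖₊ ^ 2 : ℝ≥0) : ℝ≥0∞) := by
    rw [ENNReal.coe_mul, ENNReal.coe_inv (by exact_mod_cast k.factorial_ne_zero)]
    push_cast
    rfl
  simp only [← ENNReal.tsum_mul_left, h]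
  rw [← ENNReal.tsum_sigma' (f := fun p : Σ k, Fin k → I =>
    (((p.1.factorial : ℝ≥0)⁻¹ * ‖a p.1 p.2‖₊ ^ 2 : ℝ≥0) : ℝ≥0∞)), ENNReal.tsum_eq_iSup_sum,
    iSup_le_iff]
  refine forall_congr' fun s => ?_
  rw [← ENNReal.ofNNReal_finsetSum, ENNReal.coe_le_coe, ← NNReal.coe_le_coe]
  push_cast
  rfl

end HilbertSchmidtSum

/-! ### Gel'fand transforms: homomorphism property, derivatives, Hilbert-Schmidt bound. -/

section Gelfand

variable {V : Type*} [AddCommGroup V] [Module ℂ V] [TopologicalSpace V]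
  [StarAddMonoid V]

theorem gelfand_coe [StarModule ℂ V] (Y : symTens V) (ρ : HermDual V) :
    gelfand (Y : SymCpl V) ρ = prodT ((ρ : V →L[ℂ] ℂ) : V →ₗ[ℂ] ℂ) Y := by
  exact (UniformSpace.Completion.extension_coe ((uniformContinuous_evalT (ρ : V →L[ℂ] ℂ)).comp
    uniformContinuous_subtype_val) Y).trans (evalT_eq_prodT _ _)

theorem continuous_gelfand [StarModule ℂ V] (ρ : HermDual V) :
    Continuous fun X : SymCpl V => gelfand X ρ :=
  UniformSpace.Completion.continuous_extension

variable [StarModule ℂ V]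

theorem gelfand_add (X Y : SymCpl V) (ρ : HermDual V) :
    gelfand (X + Y) ρ = gelfand X ρ + gelfand Y ρ := by
  have h := continuous_gelfand ρ
  induction X, Y using UniformSpace.Completion.induction_on₂ with
  | hp => exact isClosed_eq (by fun_prop) (by fun_prop)
  | ih X Y =>
    rw [← UniformSpace.Completion.coe_add, gelfand_coe, gelfand_coe, gelfand_coe]
    exact map_add _ _ _

theorem gelfand_smul (c : ℂ) (X : SymCpl V) (ρ : HermDual V) :
    gelfand (c • X) ρ = c * gelfand X ρ := by
  have h := continuous_gelfand ρ
  induction X using UniformSpace.Completion.induction_on with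
  | hp => exact isClosed_eq (h.comp (continuous_const_smul c)) (continuous_const.mul h)
  | ih X =>
    rw [← UniformSpace.Completion.coe_smul, gelfand_coe, gelfand_coe]
    exact map_smul _ _ _

/-- The extended evaluation functional as a linear map. -/
def gelfandLin (ρ : HermDual V) : SymCpl V →ₗ[ℂ] ℂ where
  toFun X := gelfand X ρ
  map_add' X Y := gelfand_add X Y ρ
  map_smul' c X := gelfand_smul c X ρ

theorem gelfand_sub (X Y : SymCpl V) (ρ : HermDual V) :
    gelfand (X - Y) ρ = gelfand X ρ - gelfand Y ρ :=
  map_sub (gelfandLin ρ) X Y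

theorem gelfand_mul (X Y : SymCpl V) (ρ : HermDual V) :
    gelfand (X * Y) ρ = gelfand X ρ * gelfand Y ρ := by
  have h := continuous_gelfand ρ
  induction X, Y using UniformSpace.Completion.induction_on₂ with
  | hp => exact isClosed_eq (by fun_prop) (by fun_prop)
  | ih X Y =>
    rw [← UniformSpace.Completion.coe_mul, gelfand_coe, gelfand_coe, gelfand_coe, coe_vee,
      prodT_symm, prodT_mul]

theorem gelfand_one (ρ : HermDual V) : gelfand (1 : SymCpl V) ρ = 1 := by
  rw [← UniformSpace.Completion.coe_one, gelfand_coe, coe_one, prodT_one]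

theorem gelfand_star [ContinuousStar V] (X : SymCpl V) (ρ : HermDual V) :
    gelfand (star X) ρ = conj (gelfand X ρ) := by
  have h := continuous_gelfand ρ
  have hs : Continuous (star : SymCpl V → SymCpl V) := UniformSpace.Completion.continuous_map
  induction X using UniformSpace.Completion.induction_on with
  | hp => exact isClosed_eq (h.comp hs) (Complex.continuous_conj.comp h)
  | ih X =>
    have : star (X : SymCpl V) = ((star X : symTens V) : SymCpl V) :=
      UniformSpace.Completion.map_coe uniformContinuous_star X
    rw [this, gelfand_coe, gelfand_coe, coe_star, prodT_starT _ ρ.2]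

theorem norm_gelfand_le {α : HermForm V} {ρ : HermDual V}
    (h : ∀ v, ‖(ρ : V →L[ℂ] ℂ) v‖ ≤ α.nrm v) (X : SymCpl V) :
    ‖gelfand X ρ‖ ≤ 2 * ‖symFock (α.scale 16) X‖ := by
  have hg := continuous_gelfand ρ
  induction X using UniformSpace.Completion.induction_on with
  | hp => exact isClosed_le (by fun_prop) (by fun_prop)
  | ih X =>
    rw [gelfand_coe, symFock_coe, norm_toFock]
    exact norm_prodT_le_of_le h X

/-- The line derivatives of a Gel'fand transform. -/
theorem hasLineDerivAt_gelfand (X : SymCpl V) (σ ρ : HermDual V) :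
    HasLineDerivAt ℝ (gelfand X) (gelfand (derivSym (ρ : V →L[ℂ] ℂ) X) σ) σ ρ := by
  -- The seminorm of `γ` is twice that of the sum, which dominates both `|σ|` and `|ρ|`; it
  -- therefore dominates `σ + t ρ` for `|t| < 1`.
  let γ : HermForm V := ((rankOne (σ : V →L[ℂ] ℂ)).add (rankOne (ρ : V →L[ℂ] ℂ))).scale (2 ^ 2)
  have hγ (t : ℝ) (ht : t ∈ Metric.ball (0 : ℝ) 1) (v : V) :
      ‖((σ + t • ρ : HermDual V) : V →L[ℂ] ℂ) v‖ ≤ γ.nrm v := by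
    have h1 : ‖t‖ ≤ 1 := by simpa using (mem_ball_zero_iff.1 ht).le
    have h2 := (rankOne (σ : V →L[ℂ] ℂ)).nrm_le_add_left (rankOne (ρ : V →L[ℂ] ℂ)) v
    have h3 := (rankOne (σ : V →L[ℂ] ℂ)).nrm_le_add_right (rankOne (ρ : V →L[ℂ] ℂ)) v
    rw [nrm_rankOne] at h2 h3
    rw [HermForm.nrm_scale]
    calc ‖(σ : V →L[ℂ] ℂ) v + t • (ρ : V →L[ℂ] ℂ) v‖
        ≤ ‖(σ : V →L[ℂ] ℂ) v‖ + 1 * ‖(ρ : V →L[ℂ] ℂ) v‖ := by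
          refine (norm_add_le _ _).trans ?_
          rw [norm_smul]
          gcongr
      _ ≤ _ := by push_cast; linarith
  have hlin (t : ℝ) : (((σ + t • ρ : HermDual V) : V →L[ℂ] ℂ) : V →ₗ[ℂ] ℂ) =
      ((σ : V →L[ℂ] ℂ) : V →ₗ[ℂ] ℂ) + (t : ℂ) • ((ρ : V →L[ℂ] ℂ) : V →ₗ[ℂ] ℂ) := by
    ext v
    simp
  -- The filter of algebraic tensors tending to `X`; the formula, known for these, is passed to the
  -- limit.
  let l : Filter (symTens V) := Filter.comap (↑) (nhds X)
  have hl : l.NeBot := UniformSpace.Completion.isDenseInducing_coe.comap_nhds_neBot X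
  have hX : Filter.Tendsto (fun Y : symTens V => (Y : SymCpl V)) l (nhds X) :=
    Filter.tendsto_comap
  -- Uniformity in `t` holds because `norm_gelfand_le` sees `σ + t ρ` only through `γ`.
  have hu : TendstoUniformlyOn
      (fun (Y : symTens V) (t : ℝ) =>
        gelfand (derivSym (ρ : V →L[ℂ] ℂ) (Y : SymCpl V)) (σ + t • ρ))
      (fun t => gelfand (derivSym (ρ : V →L[ℂ] ℂ) X) (σ + t • ρ)) l (Metric.ball 0 1) := by
    rw [Metric.tendstoUniformlyOn_iff]
    intro ε hε
    have hc : Continuous fun Z : SymCpl V =>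
        2 * ‖symFock (γ.scale 16) (derivSym (ρ : V →L[ℂ] ℂ) (X - Z))‖ := by fun_prop
    have h0 := (hc.tendsto' X 0 (by simp)).comp hX
    filter_upwards [h0.eventually (gt_mem_nhds hε)] with Y hY t ht
    rw [dist_eq_norm, ← gelfand_sub, ← map_sub]
    exact (norm_gelfand_le (hγ t ht) _).trans_lt hY
  have := hasDerivAt_of_tendstoUniformlyOn (g := fun t : ℝ => gelfand X (σ + t • ρ))
    (f := fun (Y : symTens V) (t : ℝ) => gelfand (Y : SymCpl V) (σ + t • ρ))
    Metric.isOpen_ball hu (Filter.Eventually.of_forall fun Y t _ => ?_)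
    (fun t _ => ((continuous_gelfand (σ + t • ρ)).tendsto X).comp hX)
    (Metric.mem_ball_self one_pos)
  · simpa [HasLineDerivAt] using this
  · simp only [gelfand_coe, derivSym_coe, hlin]
    exact hasDerivAt_prodT _ _ Y.2 t

theorem iterDeriv_gelfand {k : ℕ} (ρ : Fin k → HermDual V) (X : SymCpl V) :
    iterDeriv k ρ (gelfand X) = gelfand (iterSym k (fun i => (ρ i : V →L[ℂ] ℂ)) X) := by
  induction k with
  | zero => rfl
  | succ k ih =>
    funext σ
    rw [iterDeriv, ih]
    exact (hasLineDerivAt_gelfand _ σ (ρ 0)).lineDeriv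

theorem gelfand_iterSym_coe {k : ℕ} (ρ : Fin k → HermDual V) (Y : symTens V) (σ : HermDual V) :
    gelfand (iterSym k (fun i => (ρ i : V →L[ℂ] ℂ)) Y) σ =
      pairT k (fun i => ((ρ i : V →L[ℂ] ℂ) : V →ₗ[ℂ] ℂ))
        (translT ((σ : V →L[ℂ] ℂ) : V →ₗ[ℂ] ℂ) Y) := by
  rw [iterSym_coe, gelfand_coe, ← evalT_eq_prodT, evalT_iterT _ _ Y.2]

theorem continuous_gelfand_iterSym {k : ℕ} (ρ : Fin k → HermDual V) (σ : HermDual V) :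
    Continuous fun X => gelfand (iterSym k (fun i => (ρ i : V →L[ℂ] ℂ)) X) σ :=
  (continuous_gelfand σ).comp (iterSym k _).continuous

/-- The coercion of `HermDual V` into the algebraic dual. -/
def HermDual.toLin : HermDual V →ₗ[ℝ] V →ₗ[ℂ] ℂ where
  toFun ρ := (ρ : V →L[ℂ] ℂ)
  map_add' _ _ := rfl
  map_smul' _ _ := rfl

/-- The derivatives of a Gel'fand transform at a point as a multilinear form. -/
def gelfandDeriv (X : SymCpl V) (σ : HermDual V) (k : ℕ) :
    MultilinearMap ℝ (fun _ : Fin k => HermDual V) ℂ where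
  toFun ρ := gelfand (iterSym k (fun i => (ρ i : V →L[ℂ] ℂ)) X) σ
  map_update_add' := fun {_} ρ i x y => by
    -- For fixed directions the identity is a closed condition on `X`; on algebraic tensors it is
    -- the multilinearity of `pairT`.
    induction X using UniformSpace.Completion.induction_on with
    | hp =>
      exact isClosed_eq (continuous_gelfand_iterSym _ σ)
        ((continuous_gelfand_iterSym _ σ).add (continuous_gelfand_iterSym _ σ))
    | ih Y =>
      simp only [gelfand_iterSym_coe]
      rw [← LinearMap.add_apply]
      congr 1
      exact (((pairT k).restrictScalars ℝ).compLinearMap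
        fun _ => HermDual.toLin).map_update_add ρ i x y
  map_update_smul' := fun {_} ρ i c x => by
    induction X using UniformSpace.Completion.induction_on with
    | hp =>
      exact isClosed_eq (continuous_gelfand_iterSym _ σ)
        ((continuous_gelfand_iterSym _ σ).const_smul c)
    | ih Y =>
      simp only [gelfand_iterSym_coe]
      rw [← LinearMap.smul_apply]
      congr 1
      exact (((pairT k).restrictScalars ℝ).compLinearMap
        fun _ => HermDual.toLin).map_update_smul ρ i c x

theorem gelfandDeriv_apply (X : SymCpl V) (σ : HermDual V) {k : ℕ} (ρ : Fin k → HermDual V) :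
    gelfandDeriv X σ k ρ = iterDeriv k ρ (gelfand X) σ := by
  rw [iterDeriv_gelfand]; rfl

theorem gelfandDeriv_comp_perm (X : SymCpl V) (σ : HermDual V) {k : ℕ} (ρ : Fin k → HermDual V)
    (τ : Equiv.Perm (Fin k)) : gelfandDeriv X σ k (ρ ∘ τ) = gelfandDeriv X σ k ρ := by
  induction X using UniformSpace.Completion.induction_on with
  | hp => exact isClosed_eq (continuous_gelfand_iterSym _ σ) (continuous_gelfand_iterSym _ σ)
  | ih Y =>
    refine (gelfand_iterSym_coe _ Y σ).trans (Eq.trans ?_ (gelfand_iterSym_coe _ Y σ).symm)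
    rw [← evalT_iterT _ _ Y.2, ← evalT_iterT _ _ Y.2]
    exact congrArg (evalT _)
      (iterT_comp_perm (fun i => ((ρ i : V →L[ℂ] ℂ) : V →ₗ[ℂ] ℂ)) τ Y.2)

theorem norm_gelfandDeriv_le {α : HermForm V} {σ : HermDual V}
    (hσ : ∀ v, ‖(σ : V →L[ℂ] ℂ) v‖ ≤ α.nrm v) {k : ℕ} {ρ : Fin k → HermDual V}
    (hρ : ∀ i v, ‖(ρ i : V →L[ℂ] ℂ) v‖ ≤ α.nrm v) (X : SymCpl V) :
    ‖gelfandDeriv X σ k ρ‖ ≤ k.factorial * (2 * ‖symFock (α.scale 16) X‖) := by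
  induction X using UniformSpace.Completion.induction_on with
  | hp => exact isClosed_le (continuous_gelfand_iterSym _ σ).norm (by fun_prop)
  | ih Y =>
    refine (congrArg norm (gelfand_iterSym_coe ρ Y σ)).trans_le ?_
    refine (norm_pairT_le α (fun i => (ρ i : V →L[ℂ] ℂ)) (fun _ => 1) (by simpa using hρ) _).trans ?_
    rw [symFock_coe, norm_toFock]
    simp only [NNReal.coe_one, Finset.prod_const_one, mul_one]
    refine mul_le_mul_of_nonneg_left ?_ (Nat.cast_nonneg _)
    exact (tnorm_proj_le α k _).trans (tnorm_translT_le hσ _)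

theorem isSmooth_gelfand (X : SymCpl V) : IsSmooth (gelfand X) := by
  refine ⟨fun k ρ σ ρ₀ => ?_, fun k σ => ⟨gelfandDeriv X σ k, fun ρ => gelfandDeriv_apply X σ ρ,
    fun ρ τ => gelfandDeriv_comp_perm X σ ρ τ, ?_⟩⟩
  · rw [iterDeriv_gelfand]
    exact (hasLineDerivAt_gelfand _ σ ρ₀).lineDifferentiableAt
  · rintro B ⟨α, -, hB⟩
    -- `β` dominates the directions in `B` as well as the base point `σ`.
    let β := α.add (rankOne (σ : V →L[ℂ] ℂ))
    refine ⟨_, fun ρ hρ => norm_gelfandDeriv_le (α := β) (fun v => ?_) (fun i v => ?_) X⟩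
    · rw [← nrm_rankOne]
      exact α.nrm_le_add_right _ v
    · exact (hB _ (hρ i) v).trans (α.nrm_le_add_left _ v)

variable {α : HermForm V} [IsTopologicalAddGroup V] [ContinuousStar V] [ContinuousSMul ℂ V]

/-- The normalisation cancels the `k!` in the Fock inner product; different degrees are orthogonal.
-/
theorem orthonormal_fockTensor (hα : α.Compatible) {I : Type*} {e : I → HermCpl α}
    (he : Orthonormal ℝ e) :
    Orthonormal ℂ fun p : Σ k, Fin k → I =>
      ((√(p.1.factorial : ℝ) : ℝ) : ℂ)⁻¹ • fockTensor hα p.1 fun j => e (p.2 j) := by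
  classical
  rw [orthonormal_iff_ite]
  rintro ⟨k, i⟩ ⟨l, j⟩
  rw [inner_smul_left, inner_smul_right]
  by_cases hkl : k = l
  swap
  · rw [inner_fockTensor_of_ne hα hkl, if_neg (fun h => hkl (congrArg Sigma.fst h))]
    simp
  subst hkl
  have hk : ((√(k.factorial : ℝ) : ℝ) : ℂ) ^ 2 = k.factorial := by
    rw [← Complex.ofReal_pow, Real.sq_sqrt (Nat.cast_nonneg _), Complex.ofReal_natCast]
  have hk0 : ((√(k.factorial : ℝ) : ℝ) : ℂ) ≠ 0 := by
    intro h
    rw [h] at hk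
    exact (Nat.cast_ne_zero (R := ℂ)).2 k.factorial_ne_zero (by simpa using hk.symm)
  rw [inner_fockTensor_fockTensor]
  simp only [orthonormal_iff_ite.1 he]
  by_cases hij : i = j
  · subst hij
    simp only [if_true, Complex.ofReal_one, Finset.prod_const_one, mul_one, map_inv₀,
      Complex.conj_ofReal]
    rw [← hk]
    field_simp
  · obtain ⟨m, hm⟩ := Function.ne_iff.1 hij
    rw [Finset.prod_eq_zero (Finset.mem_univ m) (by simp [hm]), if_neg (by simpa using hij)]
    simp

/-- The summands are the squared Bessel coefficients of the translated tensor. The base point `ξ`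
need not be dominated by `α`, hence the larger form `β` in the translation estimate. -/
theorem sum_norm_gelfandDeriv_le {β : HermForm V} (hα : α.Compatible)
    (hαβ : ∀ v, α.nrm v ≤ β.nrm v) {ξ : HermDual V}
    (hξ : ∀ v, ‖(ξ : V →L[ℂ] ℂ) v‖ ≤ β.nrm v) {I : Type*} {e : I → HermCpl α}
    (he : Orthonormal ℝ e) (s : Finset (Σ k, Fin k → I)) (X : SymCpl V) :
    ∑ p ∈ s, (p.1.factorial : ℝ)⁻¹ * ‖gelfandDeriv X ξ p.1 fun j => flat α (e (p.2 j))‖ ^ 2 ≤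
      (2 * ‖symFock (β.scale 16) X‖) ^ 2 := by
  induction X using UniformSpace.Completion.induction_on with
  | hp =>
    refine isClosed_le (continuous_finsetSum _ fun p _ => continuous_const.mul ?_) (by fun_prop)
    exact (continuous_gelfand_iterSym _ ξ).norm.pow 2
  | ih Y =>
    let Z := translT ((ξ : V →L[ℂ] ℂ) : V →ₗ[ℂ] ℂ) (Y : Tens V)
    have h (p : Σ k, Fin k → I) : (p.1.factorial : ℝ)⁻¹ *
        ‖gelfandDeriv (Y : SymCpl V) ξ p.1 fun j => flat α (e (p.2 j))‖ ^ 2 =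
        ‖(inner ℂ (((√(p.1.factorial : ℝ) : ℝ) : ℂ)⁻¹ • fockTensor hα p.1 fun j => e (p.2 j))
          (toFock α Z) : ℂ)‖ ^ 2 := by
      rw [inner_smul_left, inner_fockTensor, norm_mul, mul_pow]
      congr 1
      · simp
      · exact congrArg (‖·‖ ^ 2) (gelfand_iterSym_coe _ Y ξ)
    simp only [h]
    refine ((orthonormal_fockTensor hα he).sum_inner_products_le _).trans ?_
    rw [norm_toFock, symFock_coe, norm_toFock]
    exact pow_le_pow_left₀ (apply_nonneg _ _)
      ((tnorm_mono hαβ Z).trans (tnorm_translT_le hξ Y)) 2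

/-- Gel'fand transforms are analytic of Hilbert-Schmidt type. -/
theorem isAnalyticHS_gelfand (X : SymCpl V) : IsAnalyticHS (gelfand X) := by
  refine ⟨isSmooth_gelfand X, fun σ σ' α hα => ?_⟩
  -- `γ` dominates both endpoints, hence all convex combinations, so the constant does not depend on
  -- `ξ`. The choice of Hilbert basis is immaterial.
  let γ := (rankOne (σ : V →L[ℂ] ℂ)).add (rankOne (σ' : V →L[ℂ] ℂ))
  obtain ⟨I, e, -⟩ := exists_hilbertBasis ℝ (HermCpl α)
  refine ⟨(2 * ‖symFock ((α.add γ).scale 16) X‖₊) ^ 2, I, e, fun ξ hξ => ?_⟩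
  rw [tsum_tsum_le_iff]
  intro s
  simp only [← gelfandDeriv_apply]
  push_cast
  refine sum_norm_gelfandDeriv_le hα (α.nrm_le_add_left γ) (fun v => ?_) e.orthonormal s X
  refine le_trans ?_ (α.nrm_le_add_right γ v)
  have h2 := (rankOne (σ : V →L[ℂ] ℂ)).nrm_le_add_left (rankOne (σ' : V →L[ℂ] ℂ)) v
  have h3 := (rankOne (σ : V →L[ℂ] ℂ)).nrm_le_add_right (rankOne (σ' : V →L[ℂ] ℂ)) v
  rw [nrm_rankOne] at h2 h3
  obtain ⟨a, b, ha, hb, hab, rfl⟩ := hξ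
  calc ‖a • (σ : V →L[ℂ] ℂ) v + b • (σ' : V →L[ℂ] ℂ) v‖
      ≤ a * ‖(σ : V →L[ℂ] ℂ) v‖ + b * ‖(σ' : V →L[ℂ] ℂ) v‖ := by
        refine (norm_add_le _ _).trans (le_of_eq ?_)
        rw [norm_smul, norm_smul, Real.norm_of_nonneg ha, Real.norm_of_nonneg hb]
    _ ≤ a * γ.nrm v + b * γ.nrm v := by gcongr
    _ = γ.nrm v := by rw [← add_mul, hab, one_mul]

end Gelfand

/-! ### Riesz-Fischer, coordinatewise extension, and a vanishing Taylor remainder. -/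

section General

/-- A Bessel-type converse: square summable coefficients with respect to an orthonormal family are
the coefficients of a vector. -/
theorem exists_inner_eq_of_sum_le {H ι : Type*} [NormedAddCommGroup H] [InnerProductSpace ℂ H]
    [CompleteSpace H] {b : ι → H} (hb : Orthonormal ℂ b) (a : ι → ℂ) {C : ℝ} (hC : 0 ≤ C)
    (h : ∀ s : Finset ι, ∑ i ∈ s, ‖a i‖ ^ 2 ≤ C) :
    ∃ x : H, ‖x‖ ^ 2 ≤ C ∧ ∀ i, inner ℂ (b i) x = a i := by
  classical
  have ha : Memℓp a 2 := by
    refine memℓp_gen ?_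
    simp only [ENNReal.toReal_ofNat, Real.rpow_ofNat]
    exact summable_of_sum_le (fun _ => by positivity) h
  let f : lp (fun _ : ι => ℂ) 2 := ⟨a, ha⟩
  refine ⟨hb.orthogonalFamily.linearIsometry f, ?_, fun i => ?_⟩
  · rw [LinearIsometry.norm_map]
    have : ‖f‖ ≤ √C := by
      refine lp.norm_le_of_forall_sum_le (by simp) (Real.sqrt_nonneg _) fun s => ?_
      simp only [ENNReal.toReal_ofNat, Real.rpow_ofNat, Real.sq_sqrt hC]
      exact h s
    calc ‖f‖ ^ 2 ≤ √C ^ 2 := pow_le_pow_left₀ (norm_nonneg _) this 2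
      _ = C := Real.sq_sqrt hC
  · have : b i = hb.orthogonalFamily.linearIsometry (lp.single 2 i (1 : ℂ)) := by
      rw [hb.orthogonalFamily.linearIsometry_apply_single]
      simp
    rw [this, LinearIsometry.inner_map_map, lp.inner_single_left]
    simp [f]

/-- A property of tuples holds if it can be extended coordinatewise from a subset. -/
theorem forall_tuple_of_forall_mem {k : ℕ} {E : Type*} (S : Set E) (p : (Fin k → E) → Prop)
    (step : ∀ v m, (∀ x ∈ S, p (Function.update v m x)) → ∀ x, p (Function.update v m x))
    (h : ∀ v, (∀ i, v i ∈ S) → p v) (v : Fin k → E) : p v := by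
  -- `s` collects the coordinates already freed from the constraint of lying in `S`.
  have key : ∀ (s : Finset (Fin k)) (v : Fin k → E), (∀ i ∉ s, v i ∈ S) → p v := by
    intro s
    induction s using Finset.induction_on with
    | empty => exact fun v hv => h v fun i => hv i (Finset.notMem_empty i)
    | insert m s hm ih =>
      intro v hv
      rw [← Function.update_eq_self m v]
      refine step v m (fun x hx => ih _ fun i hi => ?_) _
      by_cases him : i = m
      · subst him; simpa using hx
      · rw [Function.update_of_ne him]
        exact hv i (by simp [him, hi])
  exact key Finset.univ v fun i hi => absurd (Finset.mem_univ i) hi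

/-- A sequence of successive derivatives with `‖h k‖ ≤ K √(k!)` on `[0, 1]` which vanishes at `0`
vanishes at `1`. -/
theorem eq_zero_of_hasDerivAt_of_norm_le {h : ℕ → ℝ → ℂ} {K : ℝ}
    (hd : ∀ k t, HasDerivAt (h k) (h (k + 1) t) t) (h0 : ∀ k, h k 0 = 0)
    (hK : ∀ k, ∀ t ∈ Set.Icc (0 : ℝ) 1, ‖h k t‖ ≤ K * √(k.factorial : ℝ)) : h 0 1 = 0 := by
  -- The bound on the derivative of order `j + n` is integrated `n` times from `0`, where all
  -- derivatives vanish. For `j = 0` and `t = 1` it becomes `K √(n!) / n! = K / √(n!)`, which tends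
  -- to zero.
  have key (n : ℕ) : ∀ j, ∀ t ∈ Set.Icc (0 : ℝ) 1,
      ‖h j t‖ ≤ K * √((j + n).factorial : ℝ) * (t ^ n / n.factorial) := by
    induction n with
    | zero => simpa using hK
    | succ n ih =>
      intro j
      refine image_norm_le_of_norm_deriv_right_le_deriv_boundary
        (f' := h (j + 1)) (B' := fun t => K * √((j + 1 + n).factorial : ℝ) * (t ^ n / n.factorial))
        (fun t _ => (hd j t).continuousAt.continuousWithinAt)
        (fun t _ => (hd j t).hasDerivWithinAt) (by simp [h0]) (fun t => ?_)
        (fun t ht => ih (j + 1) t (Set.Ico_subset_Icc_self ht))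
      have h1 : j + (n + 1) = j + 1 + n := by ring
      rw [h1]
      refine (((hasDerivAt_pow (n + 1) t).div_const _).const_mul _).congr_deriv ?_
      rw [Nat.factorial_succ]
      have : (n.factorial : ℝ) ≠ 0 := by exact_mod_cast n.factorial_ne_zero
      push_cast
      field_simp
  have hb (n : ℕ) : ‖h 0 1‖ ≤ K * √(1 ^ n / n.factorial : ℝ) := by
    refine (key n 0 1 (by simp)).trans (le_of_eq ?_)
    rw [zero_add, one_pow, mul_assoc, one_div, Real.sqrt_inv, ← div_eq_mul_inv, Real.sqrt_div_self]
  have ht : Filter.Tendsto (fun n : ℕ => K * √(1 ^ n / n.factorial : ℝ)) Filter.atTop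
      (nhds 0) := by
    have := (Real.continuous_sqrt.tendsto' 0 0 (by simp)).comp
      (FloorSemiring.tendsto_pow_div_factorial_atTop (1 : ℝ))
    simpa using this.const_mul K
  exact norm_le_zero_iff.1 (ge_of_tendsto' ht hb)

end General

/-! ### Reduction to simple tensors of Hermitian vectors. -/

section SelfAdjointTensors

variable {V : Type*} [AddCommGroup V] [Module ℂ V] [StarAddMonoid V] [StarModule ℂ V]

/-- Linear maps on tensors are determined by the simple tensors of Hermitian vectors. -/
theorem tens_ext_selfAdjoint {W : Type*} [AddCommGroup W] [Module ℂ W] {φ ψ : Tens V →ₗ[ℂ] W}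
    (h : ∀ (k : ℕ) (y : Fin k → selfAdjoint V),
      φ (simple fun i => (y i : V)) = ψ (simple fun i => (y i : V))) : φ = ψ := by
  ext X
  induction X using tens_induction with
  | hadd X Y hX hY => rw [map_add, map_add, hX, hY]
  | h0 c k x =>
    rw [map_smul, map_smul]
    congr 1
    refine forall_tuple_of_forall_mem (selfAdjoint V : Set V) (fun x => φ (simple x) = ψ (simple x))
      (fun v m hm w => ?_) (fun v hv => h k fun i => ⟨v i, hv i⟩) x
    have h1 := hm _ (ℜ w).2
    have h2 := hm _ (ℑ w).2
    rw [← realPart_add_I_smul_imaginaryPart w]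
    simp only [simple, MultilinearMap.map_update_add, MultilinearMap.map_update_smul, map_add,
      map_smul] at h1 h2 ⊢
    rw [h1, h2]

end SelfAdjointTensors

/-! ### Compatible forms suffice to define the topology. -/

section Compatible

variable {V : Type*} [AddCommGroup V] [Module ℂ V] [TopologicalSpace V] [StarAddMonoid V]

theorem HermForm.Compatible.add {α β : HermForm V} (hα : α.Compatible) (hβ : β.Compatible) :
    (α.add β).Compatible := fun v w => by
  simp only [HermForm.add, LinearMap.add_apply, map_add, hα v w, hβ v w]

theorem compatible_rankOne (ρ : HermDual V) : (rankOne (ρ : V →L[ℂ] ℂ)).Compatible := by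
  intro v w
  simp only [rankOne, LinearMap.coe_mk, AddHom.coe_mk, LinearMap.smul_apply, smul_eq_mul,
    ContinuousLinearMap.coe_coe, map_mul, ← ρ.2 v, ← ρ.2 w]

variable [StarModule ℂ V] [ContinuousStar V]

/-- Adding the conjugate form gives a compatible form above `α`, so compatible forms are cofinal. -/
theorem compatible_add_starForm (α : HermForm V) : (α.add α.starForm).Compatible := fun v w => by
  simp only [HermForm.add, HermForm.starForm, LinearMap.add_apply, LinearMap.coe_mk, AddHom.coe_mk,
    map_add, Complex.conj_conj, star_star]
  exact add_comm _ _

/-- If algebraic tensors `Y` tend to `X`, every seminorm of `Y` is dominated by a compatible one,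
which tends to `‖symFock X‖ = 0`. So `Y` tends to zero, and limits in the completion are unique. -/
theorem eq_zero_of_symFock_eq_zero {X : SymCpl V}
    (h : ∀ α : HermForm V, α.Compatible → symFock α X = 0) : X = 0 := by
  let l : Filter (symTens V) := Filter.comap (↑) (nhds X)
  have hl : l.NeBot := UniformSpace.Completion.isDenseInducing_coe.comap_nhds_neBot X
  have hX : Filter.Tendsto (fun Y : symTens V => (Y : SymCpl V)) l (nhds X) :=
    Filter.tendsto_comap
  have h0 : Filter.Tendsto (fun Y : symTens V => (Y : Tens V)) l (nhds 0) := by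
    refine tendsto_zero_of_tnorm_le fun α =>
      ⟨fun Y => ‖symFock (α.add α.starForm) (Y : SymCpl V)‖, fun Y => ?_, ?_⟩
    · beta_reduce
      rw [symFock_coe, norm_toFock]
      exact tnorm_mono (α.nrm_le_add_left _) _
    · have hc := (symFock (α.add α.starForm)).continuous.norm.tendsto X
      rw [h _ (compatible_add_starForm α), norm_zero] at hc
      exact hc.comp hX
  have h1 : Filter.Tendsto (fun Y : symTens V => Y) l (nhds 0) := tendsto_subtype_rng.2 h0
  have h2 := ((UniformSpace.Completion.continuous_coe (symTens V)).tendsto 0).comp h1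
  rw [UniformSpace.Completion.coe_zero] at h2
  exact tendsto_nhds_unique hX h2

end Compatible

/-! ### Fock vectors representing families of multilinear forms; injectivity. -/

section Representation

variable {V : Type*} [AddCommGroup V] [Module ℂ V] [TopologicalSpace V]
  [StarAddMonoid V] [StarModule ℂ V]

/-- A multilinear form on `V'_h` is bounded if it is bounded on bounded sets. -/
def BoundedForm {k : ℕ} (M : MultilinearMap ℝ (fun _ : Fin k => HermDual V) ℂ) : Prop :=
  ∀ B : Set (HermDual V), BoundedSet B → ∃ C : ℝ, ∀ ρ, (∀ i, ρ i ∈ B) → ‖M ρ‖ ≤ C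

variable [IsTopologicalAddGroup V] [ContinuousStar V] [ContinuousSMul ℂ V] {α : HermForm V}

variable (α) in
/-- `flat` as a linear map. -/
def flatLin : HermCpl α →ₗ[ℝ] HermDual V where
  toFun := flat α
  map_add' := flat_add
  map_smul' := flat_smul

/-- The functionals `u^♭` with `‖u‖ ≤ 1` are dominated by `α`, hence form a bounded set; homogeneity
turns the bound there into a multilinear norm bound. -/
theorem exists_continuousMultilinearMap_flat (hα : α.Compatible) {k : ℕ}
    {M : MultilinearMap ℝ (fun _ : Fin k => HermDual V) ℂ} (hM : BoundedForm M) :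
    ∃ N : ContinuousMultilinearMap ℝ (fun _ : Fin k => HermCpl α) ℂ,
      ∀ v, N v = M fun i => flat α (v i) := by
  obtain ⟨C, hC⟩ := hM {ρ | ∃ u : HermCpl α, ‖u‖ ≤ 1 ∧ flat α u = ρ} ⟨α, hα, by
    rintro _ ⟨u, hu, rfl⟩ v
    exact (norm_flat_apply_le hα u v).trans (mul_le_of_le_one_left (α.nrm_nonneg v) hu)⟩
  refine ⟨(M.compLinearMap fun _ => flatLin α).mkContinuous C fun v => ?_, fun v => rfl⟩
  have hv : v = fun i => ‖v i‖ • (‖v i‖⁻¹ • v i) := by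
    funext i
    by_cases h : v i = 0
    · simp [h]
    · rw [smul_smul, mul_inv_cancel₀ (norm_ne_zero_iff.2 h), one_smul]
  conv_lhs => rw [hv, MultilinearMap.map_smul_univ, norm_smul, norm_prod]
  simp only [norm_norm]
  rw [mul_comm]
  refine mul_le_mul_of_nonneg_right (hC _ fun i => ⟨_, ?_, rfl⟩) (by positivity)
  rw [norm_smul, norm_inv, norm_norm]
  exact inv_mul_le_one

/-- A family of bounded multilinear forms which is of Hilbert-Schmidt type for `α` is represented
by a vector of the Fock space. -/
theorem exists_inner_fockTensor_eq (hα : α.Compatible)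
    {M : ∀ k, MultilinearMap ℝ (fun _ : Fin k => HermDual V) ℂ} (hM : ∀ k, BoundedForm (M k))
    {I : Type*} (e : HilbertBasis I ℝ (HermCpl α)) {C : ℝ} (hC : 0 ≤ C)
    (h : ∀ s : Finset (Σ k, Fin k → I),
      ∑ p ∈ s, (p.1.factorial : ℝ)⁻¹ * ‖M p.1 fun j => flat α (e (p.2 j))‖ ^ 2 ≤ C) :
    ∃ x : FockCpl α, ‖x‖ ^ 2 ≤ C ∧ ∀ k (v : Fin k → HermCpl α),
      inner ℂ (fockTensor hα k v) x = M k fun i => flat α (v i) := by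
  obtain ⟨x, hx, hxa⟩ := exists_inner_eq_of_sum_le (orthonormal_fockTensor hα e.orthonormal)
    (fun p => ((√(p.1.factorial : ℝ) : ℝ) : ℂ)⁻¹ * M p.1 fun j => flat α (e (p.2 j))) hC
    (fun s => (Finset.sum_congr rfl fun p _ => by rw [norm_mul, mul_pow]; simp).trans_le (h s))
  refine ⟨x, hx, fun k v => ?_⟩
  obtain ⟨N, hN⟩ := exists_continuousMultilinearMap_flat hα (hM k)
  rw [← hN]
  -- Riesz-Fischer gives the identity on basis tuples. One coordinate at a time, it extends to the
  -- real span by linearity and to the closure by continuity.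
  refine forall_tuple_of_forall_mem (Set.range e)
    (fun v => inner ℂ (fockTensor hα k v) x = N v) (fun v m hm w => ?_) (fun v hv => ?_) v
  · have hcl : IsClosed {w | inner ℂ (fockTensor hα k (Function.update v m w)) x =
        N (Function.update v m w)} := by
      have hu : Continuous fun w => Function.update v m w :=
        continuous_const.update m continuous_id
      exact isClosed_eq (((fockTensor hα k).cont.comp hu).inner continuous_const)
        (N.cont.comp hu)
    have hsp : (Submodule.span ℝ (Set.range e) : Set (HermCpl α)) ⊆
        {w | inner ℂ (fockTensor hα k (Function.update v m w)) x =
          N (Function.update v m w)} := by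
      intro w hw
      induction hw using Submodule.span_induction with
      | mem w hw => exact hm w hw
      | zero =>
        simp only [Set.mem_ofPred_eq]
        rw [ContinuousMultilinearMap.map_coord_zero _ m (Function.update_self ..),
          ContinuousMultilinearMap.map_coord_zero _ m (Function.update_self ..), inner_zero_left]
      | add w w' _ _ ih ih' =>
        simp only [Set.mem_ofPred_eq] at ih ih' ⊢
        rw [ContinuousMultilinearMap.map_update_add, ContinuousMultilinearMap.map_update_add,
          inner_add_left, ih, ih']
      | smul c w _ ih =>
        simp only [Set.mem_ofPred_eq] at ih ⊢
        rw [ContinuousMultilinearMap.map_update_smul, ContinuousMultilinearMap.map_update_smul,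
          ← Complex.coe_smul, inner_smul_left, ih, Complex.conj_ofReal, Complex.real_smul]
    have hw : w ∈ closure (Submodule.span ℝ (Set.range e) : Set (HermCpl α)) := by
      rw [← Submodule.topologicalClosure_coe, e.dense_span]
      trivial
    exact closure_minimal hsp hcl hw
  · choose i hi using hv
    obtain rfl : (fun j => e (i j)) = v := funext hi
    have := hxa ⟨k, i⟩
    rw [inner_smul_left, map_inv₀, Complex.conj_ofReal] at this
    rw [hN]
    refine mul_left_cancel₀ (inv_ne_zero ?_) this
    exact_mod_cast Real.sqrt_ne_zero'.2 (by exact_mod_cast k.factorial_pos)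

/-- Vectors of the Fock space are determined by their inner products with simple tensors. -/
theorem FockCpl.ext_fockTensor (hα : α.Compatible) {x y : FockCpl α}
    (h : ∀ k (v : Fin k → HermCpl α),
      inner ℂ (fockTensor hα k v) x = inner ℂ (fockTensor hα k v) y) : x = y := by
  refine FockCpl.ext fun X => ?_
  refine LinearMap.congr_fun (f := (innerSL ℂ x).toLinearMap ∘ₗ toFock α)
    (g := (innerSL ℂ y).toLinearMap ∘ₗ toFock α) (tens_ext_selfAdjoint fun k v => ?_) X
  have h1 := h k fun i => ((HermSpace.mk α (v i) : HermSpace α) : HermCpl α)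
  rw [fockTensor_coe] at h1
  -- The hypothesis has the unknown vector in the second slot; conjugation moves it to the first,
  -- where the pairing is linear in the tensor.
  have h2 := congrArg conj h1
  rw [inner_conj_symm, inner_conj_symm] at h2
  exact h2

/-- Translation by `0` is the identity, so derivatives at the origin are the Fock coefficients of
`X` itself. -/
theorem inner_fockTensor_symFock (hα : α.Compatible) {k : ℕ} (v : Fin k → HermCpl α)
    (X : SymCpl V) :
    inner ℂ (fockTensor hα k v) (symFock α X) = gelfandDeriv X 0 k fun i => flat α (v i) := by
  induction X using UniformSpace.Completion.induction_on with
  | hp =>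
    exact isClosed_eq (continuous_const.inner (symFock α).continuous)
      (continuous_gelfand_iterSym _ _)
  | ih Y =>
    refine Eq.trans ?_ (gelfand_iterSym_coe _ Y 0).symm
    have h0 : translT (((0 : HermDual V) : V →L[ℂ] ℂ) : V →ₗ[ℂ] ℂ) (Y : Tens V) = Y := by
      obtain ⟨N, hN⟩ := translT_eq_sum (((0 : HermDual V) : V →L[ℂ] ℂ) : V →ₗ[ℂ] ℂ) (Y : Tens V)
      have hd : derivT (((0 : HermDual V) : V →L[ℂ] ℂ) : V →ₗ[ℂ] ℂ) = 0 :=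
        map_zero (derivTₗ (V := V))
      -- The cut-off `N + 1` guarantees that the term `t = 0`, the only one to survive, is present.
      rw [hN (N + 1) (Nat.le_succ N), Finset.sum_range_succ', hd]
      simp
    rw [h0, symFock_coe, inner_fockTensor]
    rfl

/-- If the transform vanishes, so do its derivatives at the origin, hence all Fock coefficients of
`X` for every compatible form. -/
theorem gelfand_injective : Function.Injective (gelfand : SymCpl V → HermDual V → ℂ) := by
  have key (X : SymCpl V) (hX : gelfand X = 0) : X = 0 := by
    refine eq_zero_of_symFock_eq_zero fun α hα => FockCpl.ext_fockTensor hα fun k v => ?_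
    have h0 : (gelfand (0 : SymCpl V) : HermDual V → ℂ) = 0 :=
      funext fun ρ => map_zero (gelfandLin ρ)
    rw [inner_fockTensor_symFock, gelfandDeriv_apply, hX, ← h0, iterDeriv_gelfand, map_zero, h0,
      inner_zero_right]
    rfl
  intro X Y h
  refine sub_eq_zero.1 (key _ (funext fun ρ => ?_))
  rw [gelfand_sub, h, sub_self]
  rfl

end Representation

/-! ### Determination of a function by its derivatives at the origin. -/

section Uniqueness

variable {V : Type*} [AddCommGroup V] [Module ℂ V] [TopologicalSpace V]
  [StarAddMonoid V]

theorem IsSmooth.hasDerivAt_line {f : HermDual V → ℂ} (hf : IsSmooth f) (ρ : HermDual V) (k : ℕ)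
    (t : ℝ) :
    HasDerivAt (fun t : ℝ => iterDeriv k (fun _ => ρ) f (t • ρ))
      (iterDeriv (k + 1) (fun _ => ρ) f (t • ρ)) t := by
  have h : HasDerivAt (fun s : ℝ => iterDeriv k (fun _ => ρ) f (t • ρ + s • ρ))
      (iterDeriv (k + 1) (fun _ => ρ) f (t • ρ)) (t - t) := by
    rw [sub_self]
    exact (hf.1 k (fun _ => ρ) (t • ρ) ρ).hasLineDerivAt
  have h' := h.comp_sub_const t t
  simpa only [← add_smul, add_sub_cancel] using h'

variable [StarModule ℂ V] [IsTopologicalAddGroup V] [ContinuousStar V] [ContinuousSMul ℂ V]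

/-- For `α = rankOne ρ` one has `ρ = u^♭` with `‖u‖ ≤ 1`. The `k`-th derivative at `t ρ` is the
inner product of `u ⊗ ⋯ ⊗ u`, of norm at most `√(k!)`, with a Fock vector of norm at most `√C`. That
vector depends on `t`, but `C` does not. -/
theorem IsAnalyticHS.norm_iterDeriv_line_le {f : HermDual V → ℂ} (hf : IsAnalyticHS f)
    (ρ : HermDual V) : ∃ K : ℝ, ∀ k, ∀ t ∈ Set.Icc (0 : ℝ) 1,
      ‖iterDeriv k (fun _ => ρ) f (t • ρ)‖ ≤ K * √(k.factorial : ℝ) := by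
  have hα := compatible_rankOne ρ
  obtain ⟨C, I, e, hC⟩ := hf.2 0 ρ _ hα
  obtain ⟨u, hu, hρ⟩ := exists_flat_eq (α := rankOne (ρ : V →L[ℂ] ℂ)) ρ zero_le_one
    (fun v => by rw [nrm_rankOne, one_mul])
  refine ⟨√C, fun k t ht => ?_⟩
  choose M hM _ hMb using fun k => hf.1.2 k (t • ρ)
  have hs := (tsum_tsum_le_iff _ C).1 (hC (t • ρ)
    ⟨1 - t, t, sub_nonneg.2 ht.2, ht.1, sub_add_cancel 1 t, by simp⟩)
  simp only [← hM] at hs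
  obtain ⟨x, hx, hxM⟩ := exists_inner_fockTensor_eq hα hMb e C.2 hs
  have h1 := hxM k fun _ => u
  rw [hM, hρ] at h1
  rw [← h1]
  have h2 : ‖fockTensor hα k fun _ => u‖ ^ 2 ≤ k.factorial := by
    have h3 := inner_fockTensor_fockTensor hα (fun _ : Fin k => u) (fun _ => u)
    rw [inner_self_eq_norm_sq_to_K] at h3
    simp only [real_inner_self_eq_norm_sq, Finset.prod_const, Finset.card_univ,
      Fintype.card_fin] at h3
    have h4 : ‖fockTensor hα k fun _ => u‖ ^ 2 = k.factorial * (‖u‖ ^ 2) ^ k := by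
      refine Complex.ofReal_injective ?_
      push_cast at h3 ⊢
      exact h3
    rw [h4]
    exact mul_le_of_le_one_right (Nat.cast_nonneg _)
      (pow_le_one₀ (by positivity) (pow_le_one₀ (norm_nonneg _) hu))
  calc _ ≤ ‖fockTensor hα k fun _ => u‖ * ‖x‖ := norm_inner_le_norm _ _
    _ ≤ √(k.factorial : ℝ) * √C := by
      gcongr
      · exact Real.le_sqrt_of_sq_le h2
      · exact Real.le_sqrt_of_sq_le hx
    _ = _ := mul_comm _ _

/-- Functions that are analytic of Hilbert-Schmidt type are determined by their Taylor series at
the origin. -/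
theorem IsAnalyticHS.ext {f g : HermDual V → ℂ} (hf : IsAnalyticHS f) (hg : IsAnalyticHS g)
    (h : ∀ (k : ℕ) (ρ : HermDual V),
      iterDeriv k (fun _ => ρ) f 0 = iterDeriv k (fun _ => ρ) g 0) : f = g := by
  funext ρ
  obtain ⟨K, hK⟩ := hf.norm_iterDeriv_line_le ρ
  obtain ⟨L, hL⟩ := hg.norm_iterDeriv_line_le ρ
  have := eq_zero_of_hasDerivAt_of_norm_le (K := K + L)
    (h := fun k t => iterDeriv k (fun _ => ρ) f (t • ρ) - iterDeriv k (fun _ => ρ) g (t • ρ))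
    (fun k t => (hf.1.hasDerivAt_line ρ k t).fun_sub (hg.1.hasDerivAt_line ρ k t))
    (fun k => by rw [zero_smul, h, sub_self])
    (fun k t ht => by
      rw [add_mul]
      exact (norm_sub_le _ _).trans (add_le_add (hK k t ht) (hL k t ht)))
  simpa [iterDeriv, sub_eq_zero] using this

end Uniqueness

/-! ### The completed symmetric algebra as a limit of Fock spaces. -/

section Completeness

variable {V : Type*} [AddCommGroup V] [Module ℂ V] [TopologicalSpace V]

/-- Symmetrisation on the Fock space. -/
def fockSymm (α : HermForm V) : FockCpl α →L[ℂ] FockCpl α :=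
  (toFock α ∘ₗ symm).extendOfNorm (toFock α)

theorem norm_toFock_symm_le (α : HermForm V) (X : Tens V) :
    ‖(toFock α ∘ₗ symm) X‖ ≤ 1 * ‖toFock α X‖ := by
  rw [LinearMap.comp_apply, norm_toFock, norm_toFock, one_mul]
  exact tnorm_symm_le α X

theorem fockSymm_toFock (α : HermForm V) (X : Tens V) :
    fockSymm α (toFock α X) = toFock α (symm X) :=
  LinearMap.extendOfNorm_eq (denseRange_toFock α) ⟨1, norm_toFock_symm_le α⟩ X

theorem inner_fockSymm (α : HermForm V) (x : FockCpl α) (X : Tens V) :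
    inner ℂ (fockSymm α x) (toFock α X) = inner ℂ x (toFock α (symm X)) := by
  refine (denseRange_toFock α).induction_on (p := fun x =>
    inner ℂ (fockSymm α x) (toFock α X) = inner ℂ x (toFock α (symm X))) x ?_ fun Z => ?_
  · exact isClosed_eq (by fun_prop) (by fun_prop)
  · rw [fockSymm_toFock, inner_toFock, inner_toFock, ext_symm]

/-- Symmetrisation is a contraction fixing `x`, so symmetrising an approximation of `x` does not
make it worse. -/
theorem mem_closure_range_of_fockSymm_eq {α : HermForm V} {x : FockCpl α}
    (hx : fockSymm α x = x) :
    x ∈ closure (Set.range fun Y : symTens V => toFock α (Y : Tens V)) := by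
  rw [Metric.mem_closure_range_iff]
  intro ε hε
  obtain ⟨X, hX⟩ := (denseRange_toFock α).exists_dist_lt x hε
  refine ⟨⟨symm X, symm_mem X⟩, ?_⟩
  rw [← hx, ← fockSymm_toFock, dist_eq_norm, ← map_sub]
  refine (LinearMap.norm_extendOfNorm_apply_le (denseRange_toFock α) 1
    (norm_toFock_symm_le α) _).trans_lt ?_
  rwa [one_mul, ← dist_eq_norm]

variable [StarAddMonoid V] [StarModule ℂ V] [ContinuousStar V]

/-- The completed symmetric tensor algebra is the projective limit of the symmetric parts of the
Fock spaces. -/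
theorem exists_symFock_eq (x : ∀ α : HermForm V, FockCpl α)
    (hsymm : ∀ α, α.Compatible → fockSymm α (x α) = x α)
    (hres : ∀ α β, α.Compatible → β.Compatible → (∀ v, α.nrm v ≤ β.nrm v) →
      fockRestrict α β (x β) = x α) :
    ∃ X : SymCpl V, ∀ α, α.Compatible → symFock α X = x α := by
  let u (α : {α : HermForm V // α.Compatible}) (Y : symTens V) : FockCpl α.1 := toFock α.1 Y
  -- Symmetric tensors that approximate `x α` for all compatible `α` simultaneously; the limit of
  -- this filter is the required element.
  let l : Filter (symTens V) := ⨅ α, Filter.comap (u α) (nhds (x α.1))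
  have hmono (α β : {α : HermForm V // α.Compatible}) (h : ∀ v, α.1.nrm v ≤ β.1.nrm v) :
      Filter.comap (u β) (nhds (x β.1)) ≤ Filter.comap (u α) (nhds (x α.1)) := by
    have hu : u α = fockRestrict α.1 β.1 ∘ u β :=
      funext fun Y => (fockRestrict_toFock h _).symm
    rw [hu, ← hres α.1 β.1 α.2 β.2 h, ← Filter.comap_comap]
    exact Filter.comap_mono ((fockRestrict α.1 β.1).continuous.tendsto _).le_comap
  have hl : l.NeBot := by
    -- The family is directed through `α.add β`, where restriction compatibility enters; each member
    -- is proper by symmetry of `x α`.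
    refine Filter.iInf_neBot_of_directed (fun α β => ?_) fun α => ?_
    · exact ⟨⟨α.1.add β.1, α.2.add β.2⟩, hmono _ _ (α.1.nrm_le_add_left β.1),
        hmono _ _ (α.1.nrm_le_add_right β.1)⟩
    · exact Filter.comap_neBot_iff_frequently.2 (mem_closure_iff_frequently.1
        (mem_closure_range_of_fockSymm_eq (hsymm α.1 α.2)))
  have hlim (α : {α : HermForm V // α.Compatible}) : Filter.Tendsto (u α) l (nhds (x α.1)) :=
    Filter.tendsto_iff_comap.2 (iInf_le _ α)
  have hc : Cauchy l := by
    refine ⟨hl, ?_⟩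
    rw [uniformity_eq_comap_nhds_zero (symTens V), ← Filter.tendsto_iff_comap]
    refine tendsto_subtype_rng.2 (tendsto_zero_of_tnorm_le fun α => ?_)
    -- Convergence along `l` is known for compatible forms only, so an arbitrary `α` is replaced by
    -- a compatible form above it.
    let β : {α : HermForm V // α.Compatible} := ⟨α.add α.starForm, compatible_add_starForm α⟩
    refine ⟨fun p => ‖u β p.2 - u β p.1‖, fun p => ?_, ?_⟩
    · beta_reduce
      rw [← map_sub, norm_toFock]
      exact tnorm_mono (α.nrm_le_add_left _) _
    · have := (((hlim β).comp (Filter.tendsto_snd (f := l) (g := l))).sub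
        ((hlim β).comp Filter.tendsto_fst)).norm
      simpa using this
  obtain ⟨X, hX⟩ := CompleteSpace.complete
    (hc.map (UniformSpace.Completion.uniformContinuous_coe (symTens V)))
  refine ⟨X, fun α hα => ?_⟩
  have h1 := ((symFock α).continuous.tendsto X).comp
    (Filter.tendsto_map'_iff.1 (Filter.tendsto_id'.2 hX))
  refine tendsto_nhds_unique h1 ?_
  refine (hlim ⟨α, hα⟩).congr fun Y => ?_
  exact (symFock_coe Y).symm

end Completeness

/-! ### Surjectivity and the isomorphism. -/

section Surjectivity

variable {V : Type*} [AddCommGroup V] [Module ℂ V] [TopologicalSpace V]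
  [IsTopologicalAddGroup V] [ContinuousSMul ℂ V]
  [StarAddMonoid V] [StarModule ℂ V] [ContinuousStar V]

/-- Tested against simple tensors of Hermitian vectors, symmetrisation averages values of `M k` over
permuted arguments, and these values are all equal. -/
theorem fockSymm_eq_self {α : HermForm V} (hα : α.Compatible) {x : FockCpl α}
    {M : ∀ k, MultilinearMap ℝ (fun _ : Fin k => HermDual V) ℂ}
    (hM : ∀ k (ρ : Fin k → HermDual V) (τ : Equiv.Perm (Fin k)), M k (ρ ∘ τ) = M k ρ)
    (hx : ∀ k (v : Fin k → HermCpl α),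
      inner ℂ (fockTensor hα k v) x = M k fun i => flat α (v i)) : fockSymm α x = x := by
  refine FockCpl.ext fun X => ?_
  rw [inner_fockSymm]
  refine LinearMap.congr_fun (f := (innerSL ℂ x).toLinearMap ∘ₗ toFock α ∘ₗ symm)
    (g := (innerSL ℂ x).toLinearMap ∘ₗ toFock α) (tens_ext_selfAdjoint fun k v => ?_) X
  have h1 (y : Fin k → selfAdjoint V) : inner ℂ x (toFock α (simple fun i => (y i : V))) =
      conj (M k fun i => flat α ((HermSpace.mk α (y i) : HermSpace α) : HermCpl α)) := by
    have := hx k fun i => ((HermSpace.mk α (y i) : HermSpace α) : HermCpl α)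
    rw [fockTensor_coe] at this
    rw [← this, inner_conj_symm]
    rfl
  change inner ℂ x (toFock α (symm (simple fun i => (v i : V)))) =
    inner ℂ x (toFock α (simple fun i => (v i : V)))
  rw [symm_simple, map_smul, map_sum, inner_smul_right, inner_sum]
  have h2 (τ : Equiv.Perm (Fin k)) :
      inner ℂ x (toFock α (simple ((fun i => (v i : V)) ∘ τ))) =
        inner ℂ x (toFock α (simple fun i => (v i : V))) := by
    refine (h1 (v ∘ τ)).trans (Eq.trans ?_ (h1 v).symm)
    exact congrArg conj
      (hM k (fun i => flat α ((HermSpace.mk α (v i) : HermSpace α) : HermCpl α)) τ)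
  simp only [h2]
  exact avg_const _

/-- A functional `v^♭` for `α` is also dominated by `β`, hence equals some `u^♭` for `β`. Pairing
the restriction of a vector with `⊗ v_i` is then pairing the vector with `⊗ u_i`, so both sides
evaluate the same `M k`. -/
theorem fockRestrict_eq {α β : HermForm V} (hα : α.Compatible) (hβ : β.Compatible)
    (hαβ : ∀ v, α.nrm v ≤ β.nrm v) {x : FockCpl α} {y : FockCpl β}
    {M : ∀ k, MultilinearMap ℝ (fun _ : Fin k => HermDual V) ℂ}
    (hx : ∀ k (v : Fin k → HermCpl α),
      inner ℂ (fockTensor hα k v) x = M k fun i => flat α (v i))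
    (hy : ∀ k (v : Fin k → HermCpl β),
      inner ℂ (fockTensor hβ k v) y = M k fun i => flat β (v i)) :
    fockRestrict α β y = x := by
  refine FockCpl.ext_fockTensor hα fun k v => ?_
  rw [hx]
  have h (i : Fin k) := exists_flat_eq (α := β) (flat α (v i)) (norm_nonneg (v i)) fun w =>
    (norm_flat_apply_le hα (v i) w).trans (mul_le_mul_of_nonneg_left (hαβ w) (norm_nonneg _))
  choose u _ hu using h
  simp only [← hu]
  rw [← hy]
  refine (denseRange_toFock β).induction_on (p := fun y =>
    inner ℂ (fockTensor hα k v) (fockRestrict α β y) = inner ℂ (fockTensor hβ k u) y) y ?_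
    fun Z => ?_
  · exact isClosed_eq (by fun_prop) (by fun_prop)
  · rw [fockRestrict_toFock hαβ, inner_fockTensor, inner_fockTensor]
    simp only [flatₗ_apply, hu]

theorem exists_gelfand_eq {f : HermDual V → ℂ} (hf : IsAnalyticHS f) :
    ∃ X : SymCpl V, gelfand X = f := by
  choose M hM hMs hMb using fun k => hf.1.2 k 0
  have hex (α : HermForm V) (hα : α.Compatible) : ∃ x : FockCpl α,
      ∀ k (v : Fin k → HermCpl α), inner ℂ (fockTensor hα k v) x = M k fun i => flat α (v i) := by
    -- Existence of the Fock vectors needs the Hilbert-Schmidt bound only at the origin; the bound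
    -- along segments enters through `IsAnalyticHS.ext`.
    obtain ⟨C, I, e, hC⟩ := hf.2 0 0 α hα
    have hs := (tsum_tsum_le_iff _ C).1 (hC 0 (left_mem_segment ℝ 0 0))
    simp only [← hM] at hs
    obtain ⟨x, -, hx⟩ := exists_inner_fockTensor_eq hα hMb e C.2 hs
    exact ⟨x, hx⟩
  classical
  -- The value for incompatible forms is never consulted.
  let x (α : HermForm V) : FockCpl α := if hα : α.Compatible then (hex α hα).choose else 0
  have hx (α : HermForm V) (hα : α.Compatible) (k : ℕ) (v : Fin k → HermCpl α) :
      inner ℂ (fockTensor hα k v) (x α) = M k fun i => flat α (v i) := by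
    simp only [x, dif_pos hα]
    exact (hex α hα).choose_spec k v
  obtain ⟨X, hX⟩ := exists_symFock_eq x (fun α hα => fockSymm_eq_self hα hMs (hx α hα))
    (fun α β hα hβ h => fockRestrict_eq hα hβ h (hx α hα) (hx β hβ))
  -- The derivatives at the origin in direction `ρ` are read off in the Fock space of `rankOne ρ`,
  -- where `ρ` has the form `u^♭`.
  refine ⟨X, (isAnalyticHS_gelfand X).ext hf fun k ρ => ?_⟩
  have hα := compatible_rankOne ρ
  obtain ⟨u, -, hρ⟩ := exists_flat_eq (α := rankOne (ρ : V →L[ℂ] ℂ)) ρ zero_le_one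
    (fun v => by rw [nrm_rankOne, one_mul])
  have h1 := inner_fockTensor_symFock hα (fun _ : Fin k => u) X
  rw [hX _ hα, hx, gelfandDeriv_apply, hM, hρ] at h1
  exact h1.symm

/-- The algebra of functions that are analytic of Hilbert-Schmidt type. -/
def analyticHS : StarSubalgebra ℂ (HermDual V → ℂ) where
  carrier := {f | IsAnalyticHS f}
  -- Closure under the operations is not estimated directly: by surjectivity the functions are
  -- transforms, and the operations are carried out in the completion.
  mul_mem' {f g} hf hg := by
    obtain ⟨X, rfl⟩ := exists_gelfand_eq hf
    obtain ⟨Y, rfl⟩ := exists_gelfand_eq hg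
    have : gelfand X * gelfand Y = gelfand (X * Y) := funext fun ρ => (gelfand_mul X Y ρ).symm
    rw [this]
    exact isAnalyticHS_gelfand _
  add_mem' {f g} hf hg := by
    obtain ⟨X, rfl⟩ := exists_gelfand_eq hf
    obtain ⟨Y, rfl⟩ := exists_gelfand_eq hg
    have : gelfand X + gelfand Y = gelfand (X + Y) := funext fun ρ => (gelfand_add X Y ρ).symm
    rw [this]
    exact isAnalyticHS_gelfand _
  algebraMap_mem' c := by
    have : algebraMap ℂ (HermDual V → ℂ) c = gelfand (c • (1 : SymCpl V)) := funext fun ρ => by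
      rw [gelfand_smul, gelfand_one, mul_one]
      rfl
    rw [this]
    exact isAnalyticHS_gelfand _
  star_mem' {f} hf := by
    obtain ⟨X, rfl⟩ := exists_gelfand_eq hf
    have : star (gelfand X) = gelfand (star X) := funext fun ρ => (gelfand_star X ρ).symm
    rw [this]
    exact isAnalyticHS_gelfand _

/-- The Gel'fand transformation as an isomorphism of *-algebras. -/
def gelfandEquiv : SymCpl V ≃⋆ₐ[ℂ] (analyticHS : StarSubalgebra ℂ (HermDual V → ℂ)) where
  toEquiv := Equiv.ofBijective (fun X => ⟨gelfand X, isAnalyticHS_gelfand X⟩)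
    ⟨fun _ _ h => gelfand_injective (congrArg Subtype.val h), fun f =>
      (exists_gelfand_eq f.2).imp fun _ h => Subtype.ext h⟩
  map_mul' X Y := Subtype.ext (funext fun ρ => gelfand_mul X Y ρ)
  map_add' X Y := Subtype.ext (funext fun ρ => gelfand_add X Y ρ)
  map_star' X := Subtype.ext (funext fun ρ => gelfand_star X ρ)
  map_smul' c X := Subtype.ext (funext fun ρ => gelfand_smul c X ρ)

end Surjectivity

end HilbertTensor

end

/-- Let `V` be a Hausdorff hilbertisable locally convex space with a continuous antilinear
involution. The functions on `V'_h` that are analytic of Hilbert-Schmidt type form a unital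
*-subalgebra of the algebra of all complex functions on `V'_h`, and the Gel'fand transformation is
an isomorphism of unital *-algebras from the completed symmetric tensor algebra onto it. -/
theorem theorem3p21 {V : Type*} [AddCommGroup V] [Module ℂ V] [TopologicalSpace V]
    [IsTopologicalAddGroup V] [ContinuousSMul ℂ V] [T2Space V]
    (hV : HilbertTensor.Hilbertisable V)
    [StarAddMonoid V] [StarModule ℂ V] [ContinuousStar V] :
    ∃ A : StarSubalgebra ℂ (HilbertTensor.HermDual V → ℂ),
      (A : Set (HilbertTensor.HermDual V → ℂ)) = {f | HilbertTensor.IsAnalyticHS f} ∧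
      ∃ Φ : HilbertTensor.SymCpl V ≃⋆ₐ[ℂ] A,
        ∀ (X : HilbertTensor.SymCpl V) (ρ : HilbertTensor.HermDual V),
          (Φ X : HilbertTensor.HermDual V → ℂ) ρ = HilbertTensor.gelfand X ρ := by
  exact ⟨HilbertTensor.analyticHS, rfl, HilbertTensor.gelfandEquiv, fun _ _ => rfl⟩
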